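/- Let $N\ge 2$ and let $\Omega\subset\mathbb R^N$ be a bounded domain with Lipschitz boundary. Let $1<p<N$, $p<q<p^*:=\frac{Np}{N-p}$, $\mu\in L^\infty(\Omega)$ with $\mu\ge 0$ a.e., $0<\gamma<1$, $q<r<p^*$, and $a\in L^\infty(\Omega)$ with $a(x)>0$ for a.a. $x\in\Omega$. Put $\rho_{\mathcal H}(u)=\int_\Omega\big(|u|^p+\mu(x)|u|^q\big)\,dx$, let $L^{\mathcal H}(\Omega)$ be the space of measurable $u:\Omega\to\mathbb R$ with $\rho_{\mathcal H}(u)<\infty$, with the Luxemburg norm $\|u\|_{\mathcal H}=\inf\{\tau>0:\rho_{\mathcal H}(u/\tau)\le 1\}$, let $W^{1,\mathcal H}(\Omega)$ be the space of $u\in L^{\mathcal H}(\Omega)$ with weak gradient satisfying $|\nabla u|\in L^{\mathcal H}(\Omega)$, with the norm $\|\,|\nabla u|\,\|_{\mathcal H}+\|u\|_{\mathcal H}$, and let $W^{1,\mathcal H}_0(\Omega)$ be the closure of $C_0^\infty(\Omega)$ in $W^{1,\mathcal H}(\Omega)$. For $\lambda>0$ consider the problem $$-\operatorname{div}\big(|\nabla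 u|^{p-2}\nabla u+\mu(x)|\nabla u|^{q-2}\nabla u\big)=a(x)u^{-\gamma}+\lambda u^{r-1}\ \text{ in }\Omega,\qquad u=0\ \text{ on }\partial\Omega. \tag{P$_\lambda$}$$ A weak solution of (P$_\lambda$) is a function $u\in W_0^{1,\mathcal H}(\Omega)$ with $u>0$ a.e. in $\Omega$ such that, for every $h\in W_0^{1,\mathcal H}(\Omega)$, $a\,u^{-\gamma}h\in L^1(\Omega)$ and $$\int_\Omega\big(|\nabla u|^{p-2}\nabla u+\mu(x)|\nabla u|^{q-2}\nabla u\big)\cdot\nabla h\,dx=\int_\Omega a(x)u^{-\gamma}h\,dx+\lambda\int_\Omega u^{r-1}h\,dx .$$ For $u\in W_0^{1,\mathcal H}(\Omega)$ define the energy $$\varphi_\lambda(u)=\frac1p\int_\Omega|\nabla u|^p\,dx+\frac1q\int_\Omega\mu(x)|\nabla u|^q\,dx-\frac1{1-\gamma}\int_\Omega a(x)|u|^{1-\gamma}\,dx-\frac{\lambda}{r}\int_\Omega|u|^r\,dx .$$ Then there exists $\hat\lambda_0^*>0$ such that for every $\lambda\in(0,\hat\lambda_0^*]$ problem (P$_\lambda$)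 has at least two weak solutions $u^*,v^*\in W_0^{1,\mathcal H}(\Omega)$ with $\varphi_\lambda(u^*)<0<\varphi_\lambda(v^*)$. -/

import Mathlib

open MeasureTheory Filter Topology
open scoped ENNReal NNReal ContDiff

noncomputable section

namespace DoublePhase

variable {N : ℕ}

/-- `Ω` has Lipschitz boundary: near each boundary point, in a suitable orthonormal frame with
last axis `e`, the set `Ω` is the strict epigraph of a Lipschitz function `g` of the orthogonal
projection `x - ⟪e, x⟫ e` of `x` to the hyperplane orthogonal to `e`. -/
def HasLipschitzBoundary (Ω : Set (EuclideanSpace ℝ (Fin N))) : Prop :=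
  ∀ x₀ ∈ frontier Ω, ∃ (e : EuclideanSpace ℝ (Fin N)) (L : ℝ≥0)
    (g : EuclideanSpace ℝ (Fin N) → ℝ) (δ : ℝ),
    ‖e‖ = 1 ∧ LipschitzWith L g ∧ 0 < δ ∧
      ∀ x ∈ Metric.ball x₀ δ, (x ∈ Ω ↔ g (x - inner ℝ e x • e) < inner ℝ e x)

/-- `φ` belongs to `C_0^∞(Ω)`: it is smooth with compact support contained in `Ω`. -/
def IsTestFunction (Ω : Set (EuclideanSpace ℝ (Fin N)))
    (φ : EuclideanSpace ℝ (Fin N) → ℝ) : Prop :=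
  ContDiff ℝ ∞ φ ∧ HasCompactSupport φ ∧ tsupport φ ⊆ Ω

/-- The vector field `G` is the weak (distributional) gradient of `u` on `Ω`. -/
def HasWeakGradient (Ω : Set (EuclideanSpace ℝ (Fin N)))
    (u : EuclideanSpace ℝ (Fin N) → ℝ)
    (G : EuclideanSpace ℝ (Fin N) → EuclideanSpace ℝ (Fin N)) : Prop :=
  LocallyIntegrableOn u Ω ∧ LocallyIntegrableOn G Ω ∧
    ∀ φ : EuclideanSpace ℝ (Fin N) → ℝ, IsTestFunction Ω φ →
      ∫ x in Ω, φ x • G x = - ∫ x in Ω, u x • gradient φ x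

open Classical in
/-- The weak gradient `∇u` on `Ω` (a representative of it; `0` if `u` has none). -/
def weakGrad (Ω : Set (EuclideanSpace ℝ (Fin N))) (u : EuclideanSpace ℝ (Fin N) → ℝ) :
    EuclideanSpace ℝ (Fin N) → EuclideanSpace ℝ (Fin N) :=
  if h : ∃ G, HasWeakGradient Ω u G then h.choose else 0

theorem HasWeakGradient.weakGrad {Ω : Set (EuclideanSpace ℝ (Fin N))}
    {u : EuclideanSpace ℝ (Fin N) → ℝ}
    {G : EuclideanSpace ℝ (Fin N) → EuclideanSpace ℝ (Fin N)} (h : HasWeakGradient Ω u G) :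
    HasWeakGradient Ω u (weakGrad Ω u) := by
  have h' : ∃ G, HasWeakGradient Ω u G := ⟨G, h⟩
  rw [DoublePhase.weakGrad, dif_pos h']
  exact h'.choose_spec

/-- The weak gradient is unique up to null sets. -/
theorem HasWeakGradient.ae_eq {Ω : Set (EuclideanSpace ℝ (Fin N))} (hΩ : IsOpen Ω)
    {u : EuclideanSpace ℝ (Fin N) → ℝ}
    {G K : EuclideanSpace ℝ (Fin N) → EuclideanSpace ℝ (Fin N)}
    (hG : HasWeakGradient Ω u G) (hK : HasWeakGradient Ω u K) :
    G =ᵐ[volume.restrict Ω] K := by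
  have int : ∀ {F : EuclideanSpace ℝ (Fin N) → EuclideanSpace ℝ (Fin N)}
      {φ : EuclideanSpace ℝ (Fin N) → ℝ}, LocallyIntegrableOn F Ω → IsTestFunction Ω φ →
      Integrable (fun x => φ x • F x) := by
    intro F φ hF hφ
    have h1 : IntegrableOn F (tsupport φ) :=
      hF.integrableOn_compact_subset hφ.2.2 hφ.2.1
    have h2 : IntegrableOn (fun x => φ x • F x) (tsupport φ) :=
      h1.continuousOn_smul hφ.1.continuous.continuousOn hφ.2.1
    rw [← integrableOn_iff_integrable_of_support_subset (s := tsupport φ)]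
    · exact h2
    · exact (Function.support_smul_subset_left φ F).trans (subset_tsupport φ)
  have key : ∀ᵐ x, x ∈ Ω → (G - K) x = 0 := by
    refine hΩ.ae_eq_zero_of_integral_contDiff_smul_eq_zero (hG.2.1.sub hK.2.1) ?_
    intro φ h1 h2 h3
    have hφ : IsTestFunction Ω φ := ⟨h1, h2, h3⟩
    have e1 : ∀ F : EuclideanSpace ℝ (Fin N) → EuclideanSpace ℝ (Fin N),
        ∫ x, φ x • F x = ∫ x in Ω, φ x • F x := by
      intro F
      refine (setIntegral_eq_integral_of_forall_compl_eq_zero ?_).symm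
      intro x hx
      have : φ x = 0 := image_eq_zero_of_notMem_tsupport fun h => hx (h3 h)
      simp [this]
    simp only [Pi.sub_apply, smul_sub]
    rw [integral_sub (int hG.2.1 hφ) (int hK.2.1 hφ), e1, e1, hG.2.2 φ hφ, hK.2.2 φ hφ, sub_self]
  rw [EventuallyEq, ae_restrict_iff' hΩ.measurableSet]
  filter_upwards [key] with x hx hxΩ
  exact sub_eq_zero.1 (hx hxΩ)

/-- The modular `ρ_H(u) = ∫_Ω (|u|^p + μ |u|^q) dx`, with values in `[0, ∞]`. -/
def modular (Ω : Set (EuclideanSpace ℝ (Fin N))) (p q : ℝ)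
    (μ u : EuclideanSpace ℝ (Fin N) → ℝ) : ℝ≥0∞ :=
  ∫⁻ x in Ω, ENNReal.ofReal (|u x| ^ p + μ x * |u x| ^ q)

/-- `u` belongs to the Musielak-Orlicz space `L^H(Ω)`. -/
def MemLH (Ω : Set (EuclideanSpace ℝ (Fin N))) (p q : ℝ)
    (μ u : EuclideanSpace ℝ (Fin N) → ℝ) : Prop :=
  AEStronglyMeasurable u (volume.restrict Ω) ∧ modular Ω p q μ u < ⊤

/-- The Luxemburg norm on `L^H(Ω)`. -/
def luxNorm (Ω : Set (EuclideanSpace ℝ (Fin N))) (p q : ℝ)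
    (μ u : EuclideanSpace ℝ (Fin N) → ℝ) : ℝ :=
  sInf {τ : ℝ | 0 < τ ∧ modular Ω p q μ (fun x => u x / τ) ≤ 1}

/-- `u` belongs to the Musielak-Orlicz Sobolev space `W^{1,H}(Ω)`. -/
def MemW1H (Ω : Set (EuclideanSpace ℝ (Fin N))) (p q : ℝ)
    (μ u : EuclideanSpace ℝ (Fin N) → ℝ) : Prop :=
  MemLH Ω p q μ u ∧ (∃ G, HasWeakGradient Ω u G) ∧
    MemLH Ω p q μ (fun x => ‖weakGrad Ω u x‖)

/-- The norm `‖∇u‖_H + ‖u‖_H` on `W^{1,H}(Ω)`. -/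
def normW1H (Ω : Set (EuclideanSpace ℝ (Fin N))) (p q : ℝ)
    (μ u : EuclideanSpace ℝ (Fin N) → ℝ) : ℝ :=
  luxNorm Ω p q μ (fun x => ‖weakGrad Ω u x‖) + luxNorm Ω p q μ u

/-- `u` belongs to `W_0^{1,H}(Ω)`, the closure of `C_0^∞(Ω)` in `W^{1,H}(Ω)`. -/
def MemW1H0 (Ω : Set (EuclideanSpace ℝ (Fin N))) (p q : ℝ)
    (μ u : EuclideanSpace ℝ (Fin N) → ℝ) : Prop :=
  MemW1H Ω p q μ u ∧ ∃ φ : ℕ → EuclideanSpace ℝ (Fin N) → ℝ,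
    (∀ n, IsTestFunction Ω (φ n)) ∧
      Tendsto (fun n => normW1H Ω p q μ (fun x => u x - φ n x)) atTop (𝓝 0)

/-- `u` is a (positive) weak solution of
`-div(|∇u|^{p-2} ∇u + μ |∇u|^{q-2} ∇u) = a u^{-γ} + lam u^{r-1}` in `Ω`, `u = 0` on `∂Ω`. -/
def IsWeakSolution (Ω : Set (EuclideanSpace ℝ (Fin N))) (p q r γ lam : ℝ)
    (μ a u : EuclideanSpace ℝ (Fin N) → ℝ) : Prop :=
  MemW1H0 Ω p q μ u ∧ (∀ᵐ x ∂(volume.restrict Ω), 0 < u x) ∧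
    ∀ h : EuclideanSpace ℝ (Fin N) → ℝ, MemW1H0 Ω p q μ h →
      IntegrableOn (fun x => a x * u x ^ (-γ) * h x) Ω ∧
      ∫ x in Ω, inner ℝ
          (‖weakGrad Ω u x‖ ^ (p - 2) • weakGrad Ω u x
            + (μ x * ‖weakGrad Ω u x‖ ^ (q - 2)) • weakGrad Ω u x)
          (weakGrad Ω h x)
        = (∫ x in Ω, a x * u x ^ (-γ) * h x) + lam * ∫ x in Ω, u x ^ (r - 1) * h x

/-- The energy functional `φ_lam` of the problem. -/
def energy (Ω : Set (EuclideanSpace ℝ (Fin N))) (p q r γ lam : ℝ)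
    (μ a u : EuclideanSpace ℝ (Fin N) → ℝ) : ℝ :=
  (1 / p) * (∫ x in Ω, ‖weakGrad Ω u x‖ ^ p)
    + (1 / q) * (∫ x in Ω, μ x * ‖weakGrad Ω u x‖ ^ q)
    - (1 / (1 - γ)) * (∫ x in Ω, a x * |u x| ^ (1 - γ))
    - (lam / r) * ∫ x in Ω, |u x| ^ r

end DoublePhase

end

/-! Write k = 1 - γ. Along a ray the energy is the fiber P t^p/p + Q t^q/q - A t^k/k - L t^r/r with
k < p < q < r, where P and Q are the gradient integrals, A is the singular integral and L is
λ∫|u|^r. The singular term wins for small t and the power term for large t. For small λ the gradient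
part dominates on a suitable level {E = ρ}, E being the gradient part of the energy: there the
energy is at least ρ/4 (`exists_barrier`).

The first solution minimizes the energy over {E ≤ ρ}. The infimum is negative because k is the
smallest exponent, so the barrier keeps the minimizer inside (`exists_minimizer`). The second
realizes the infimum over rays of the maximum along the ray. Every nontrivial ray crosses {E = ρ},
so this level is at least ρ/4, and normalizing ∫|u|^r = 1 prevents a minimizing sequence of rays
from degenerating (`exists_minimax`).

Compactness uses no weak topology. A Rellich argument with ball means, combined with the Sobolev
inequality, gives strong convergence in L^s for s < p^*. Lower semicontinuity of E comes from
uniform convexity: near-minimizers of E in shrinking L¹ balls around the limit have small midpoint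
gaps, so their gradients converge strongly (`exists_inV_of_tendsto`, `compactness`). The space is
handled as limits of test functions together with their gradients (`InV`), which is matched with
W_0^{1,H} by `inV_weakGrad` and `memW1H0`.

The singular term need not be differentiable on the space, so the equation is derived from a
one-sided property in nonnegative directions, `IsDirMin`. For the minimizer this is immediate. For
the minimax point the maximizers t_n of the perturbed rays must tend to 1, which holds because a
fiber has at most one global maximum point (`fiber_max_unique`, `isDirMin_of_minimax`). Fatou's
lemma applied to the difference quotients then shows u > 0 a.e. and that the defect of the weak
formulation is nonnegative on h ≥ 0 (`sing_le`, `ae_pos`).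

Each solution also has a fiber with a local extremum at t = 1, so the defect vanishes on multiples
of u. Comparing h with ku and letting k → ∞ shows that it vanishes on every h ≥ 0
(`defect_eq_zero_of_nonneg`), and splitting a general h gives the equation (`isWeakSolution`). -/

noncomputable section

namespace DoublePhase

/-! ### Power integrals and their relation to Lebesgue norms. -/

section PowerIntegral

variable {α : Type*} [MeasurableSpace α] {m : Measure α}
  {F : Type*} [NormedAddCommGroup F]

/-- The integral `∫ ‖f‖ ^ s dm`. -/
def powInt (s : ℝ) (m : Measure α) (f : α → F) : ℝ := ∫ x, ‖f x‖ ^ s ∂m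

lemma powInt_nonneg (s : ℝ) (f : α → F) : 0 ≤ powInt s m f :=
  integral_nonneg fun _ => Real.rpow_nonneg (norm_nonneg _) _

lemma powInt_congr_ae {s : ℝ} {f g : α → F} (h : f =ᵐ[m] g) : powInt s m f = powInt s m g :=
  integral_congr_ae (h.mono fun x hx => by simp only [hx])

lemma powInt_smul [NormedSpace ℝ F] {s t : ℝ} (ht : 0 ≤ t) (f : α → F) :
    powInt s m (fun x => t • f x) = t ^ s * powInt s m f := by
  unfold powInt
  rw [← integral_const_mul]
  congr 1 with x
  rw [norm_smul, Real.norm_of_nonneg ht, Real.mul_rpow ht (norm_nonneg _)]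

lemma integrable_norm_rpow_of_memLp {s : ℝ} (hs : 0 < s) {f : α → F}
    (hf : MemLp f (ENNReal.ofReal s) m) : Integrable (fun x => ‖f x‖ ^ s) m := by
  have := hf.integrable_norm_rpow (by simpa using hs) ENNReal.ofReal_ne_top
  rwa [ENNReal.toReal_ofReal hs.le] at this

lemma lpNorm_eq_powInt {s : ℝ} (hs : 0 < s) {f : α → F} (hf : AEStronglyMeasurable f m) :
    lpNorm f (ENNReal.ofReal s) m = powInt s m f ^ s⁻¹ := by
  rw [lpNorm_eq_integral_norm_rpow_toReal (by simpa using hs) ENNReal.ofReal_ne_top hf,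
    ENNReal.toReal_ofReal hs.le]
  rfl

lemma powInt_eq_lpNorm {s : ℝ} (hs : 0 < s) {f : α → F} (hf : AEStronglyMeasurable f m) :
    powInt s m f = lpNorm f (ENNReal.ofReal s) m ^ s := by
  rw [lpNorm_eq_powInt hs hf, Real.rpow_inv_rpow (powInt_nonneg _ _) hs.ne']

lemma lintegral_enorm_rpow_eq {s : ℝ} (hs : 0 < s) {f : α → F}
    (hf : MemLp f (ENNReal.ofReal s) m) :
    ∫⁻ x, ‖f x‖ₑ ^ s ∂m = ENNReal.ofReal (powInt s m f) := by
  unfold powInt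
  rw [ofReal_integral_eq_lintegral_ofReal (integrable_norm_rpow_of_memLp hs hf)
    (ae_of_all _ fun x => Real.rpow_nonneg (norm_nonneg _) _)]
  congr 1 with x
  rw [← ENNReal.ofReal_rpow_of_nonneg (norm_nonneg _) hs.le, ofReal_norm]

lemma eLpNorm_rpow_eq_lintegral {s : ℝ} (hs : 0 < s) (f : α → F) :
    eLpNorm f (ENNReal.ofReal s) m ^ s = ∫⁻ x, ‖f x‖ₑ ^ s ∂m := by
  rw [eLpNorm_eq_lintegral_rpow_enorm_toReal (by simpa using hs) ENNReal.ofReal_ne_top,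
    ENNReal.toReal_ofReal hs.le, ← ENNReal.rpow_mul, one_div, inv_mul_cancel₀ hs.ne',
    ENNReal.rpow_one]

lemma tendsto_eLpNorm_zero_iff_lintegral {ι : Type*} {l : Filter ι} {s : ℝ} (hs : 0 < s)
    {f : ι → α → F} :
    Tendsto (fun n => eLpNorm (f n) (ENNReal.ofReal s) m) l (𝓝 0) ↔
      Tendsto (fun n => ∫⁻ x, ‖f n x‖ₑ ^ s ∂m) l (𝓝 0) := by
  simp_rw [← eLpNorm_rpow_eq_lintegral hs]
  constructor
  · intro h
    simpa [ENNReal.zero_rpow_of_pos hs] using h.ennrpow_const s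
  · intro h
    have := h.ennrpow_const s⁻¹
    simpa [ENNReal.zero_rpow_of_pos (inv_pos.2 hs), ← ENNReal.rpow_mul, mul_inv_cancel₀ hs.ne']
      using this

lemma tendsto_eLpNorm_zero_iff_powInt {ι : Type*} {l : Filter ι} {s : ℝ} (hs : 0 < s)
    {f : ι → α → F} (hf : ∀ n, MemLp (f n) (ENNReal.ofReal s) m) :
    Tendsto (fun n => eLpNorm (f n) (ENNReal.ofReal s) m) l (𝓝 0) ↔
      Tendsto (fun n => powInt s m (f n)) l (𝓝 0) := by
  rw [tendsto_eLpNorm_zero_iff_lintegral hs]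
  simp_rw [lintegral_enorm_rpow_eq hs (hf _)]
  constructor
  · intro h
    have := (ENNReal.tendsto_toReal ENNReal.zero_ne_top).comp h
    simpa [Function.comp_def, ENNReal.toReal_ofReal (powInt_nonneg _ _)] using this
  · intro h
    simpa using ENNReal.tendsto_ofReal h

lemma tendsto_lpNorm_zero {ι : Type*} {l : Filter ι} {s : ℝ≥0∞}
    {f : ι → α → F} (hf : ∀ n, AEStronglyMeasurable (f n) m)
    (h : Tendsto (fun n => eLpNorm (f n) s m) l (𝓝 0)) :
    Tendsto (fun n => lpNorm (f n) s m) l (𝓝 0) := by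
  have := (ENNReal.tendsto_toReal ENNReal.zero_ne_top).comp h
  simpa [Function.comp_def, toReal_eLpNorm (hf _)] using this

lemma tendsto_powInt {ι : Type*} {l : Filter ι} {s : ℝ} (hs : 1 ≤ s)
    {f : ι → α → F} {g : α → F} (hf : ∀ n, MemLp (f n) (ENNReal.ofReal s) m)
    (hg : MemLp g (ENNReal.ofReal s) m)
    (h : Tendsto (fun n => eLpNorm (f n - g) (ENNReal.ofReal s) m) l (𝓝 0)) :
    Tendsto (fun n => powInt s m (f n)) l (𝓝 (powInt s m g)) := by
  have hs0 : 0 < s := by linarith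
  have hs1 : 1 ≤ ENNReal.ofReal s := by simpa using ENNReal.ofReal_le_ofReal hs
  have h0 := tendsto_lpNorm_zero (fun n => ((hf n).sub hg).1) h
  have h1 : Tendsto (fun n => lpNorm (f n) (ENNReal.ofReal s) m) l
      (𝓝 (lpNorm g (ENNReal.ofReal s) m)) := by
    rw [tendsto_iff_norm_sub_tendsto_zero]
    refine squeeze_zero (fun _ => norm_nonneg _) (fun n => ?_) h0
    rw [Real.norm_eq_abs, abs_sub_le_iff]
    have e1 := lpNorm_add_le ((hf n).sub hg) (g := g) hs1
    have e2 := lpNorm_add_le (hg.sub (hf n)) (g := f n) hs1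
    simp only [sub_add_cancel] at e1 e2
    rw [lpNorm_sub_comm] at e2
    constructor <;> linarith
  simp_rw [powInt_eq_lpNorm hs0 (hf _).1, powInt_eq_lpNorm hs0 hg.1]
  exact h1.rpow_const (Or.inr hs0.le)

lemma tendsto_eLpNorm_of_dominated {s : ℝ} (hs : 0 < s) {f : ℕ → α → F} {b : α → ℝ}
    (hf : ∀ n, AEStronglyMeasurable (f n) m) (hb : MemLp b (ENNReal.ofReal s) m)
    (hfb : ∀ n, ∀ᵐ x ∂m, ‖f n x‖ ≤ b x)
    (hlim : ∀ᵐ x ∂m, Tendsto (fun n => f n x) atTop (𝓝 0)) :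
    Tendsto (fun n => eLpNorm (f n) (ENNReal.ofReal s) m) atTop (𝓝 0) := by
  rw [tendsto_eLpNorm_zero_iff_lintegral hs]
  have hfin : ∫⁻ x, ‖b x‖ₑ ^ s ∂m ≠ ⊤ := by
    rw [lintegral_enorm_rpow_eq hs hb]; exact ENNReal.ofReal_ne_top
  have := tendsto_lintegral_of_dominated_convergence' (μ := m) (F := fun n x => ‖f n x‖ₑ ^ s)
    (f := fun _ => 0) (fun x => ‖b x‖ₑ ^ s) (fun n => (hf n).enorm.pow_const s)
    (fun n => (hfb n).mono fun x hx => ?_) hfin (hlim.mono fun x hx => ?_)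
  · simpa using this
  · refine ENNReal.rpow_le_rpow ?_ hs.le
    rw [enorm_le_iff_norm_le]
    exact hx.trans (Real.le_norm_self _)
  · have := (hx.enorm).ennrpow_const s
    simpa [ENNReal.zero_rpow_of_pos hs] using this

lemma exists_subseq_ae_tendsto {s : ℝ≥0∞} (hs : s ≠ 0) {f : ℕ → α → F} {g : α → F}
    (hf : ∀ n, AEStronglyMeasurable (f n) m) (hg : AEStronglyMeasurable g m)
    (h : Tendsto (fun n => eLpNorm (f n - g) s m) atTop (𝓝 0)) :
    ∃ σ : ℕ → ℕ, StrictMono σ ∧ ∀ᵐ x ∂m, Tendsto (fun n => f (σ n) x) atTop (𝓝 (g x)) :=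
  (tendstoInMeasure_of_tendsto_eLpNorm hs hf hg h).exists_seq_tendsto_ae

end PowerIntegral

/-! ### Differentiability and uniform convexity of power integrals. -/

section Inner

variable {α : Type*} [MeasurableSpace α] {m : Measure α}
  {F : Type*} [NormedAddCommGroup F] [InnerProductSpace ℝ F]

/-- Cauchy–Schwarz. The point x = 0 is treated apart because the exponent s - 2 may be negative. -/
lemma abs_rpow_sub_two_inner_le {s : ℝ} (x y : F) :
    |‖x‖ ^ (s - 2) * inner ℝ x y| ≤ ‖x‖ ^ (s - 1) * ‖y‖ := by
  rw [abs_mul, abs_of_nonneg (Real.rpow_nonneg (norm_nonneg _) _)]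
  rcases eq_or_ne x 0 with rfl | hx
  · simp; positivity
  have hx' : 0 < ‖x‖ := norm_pos_iff.2 hx
  calc ‖x‖ ^ (s - 2) * |inner ℝ x y| ≤ ‖x‖ ^ (s - 2) * (‖x‖ * ‖y‖) := by
        gcongr; exact abs_real_inner_le_norm x y
    _ = ‖x‖ ^ (s - 1) * ‖y‖ := by
        rw [← mul_assoc, ← Real.rpow_add_one hx'.ne']; congr 2; ring

/-- Differentiation of `t ↦ ∫ ‖f + t g‖ ^ s` at `0`. -/
lemma hasDerivAt_powInt {s : ℝ} (hs : 1 < s) {f g : α → F}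
    (hf : MemLp f (ENNReal.ofReal s) m) (hg : MemLp g (ENNReal.ofReal s) m) :
    Integrable (fun x => ‖f x‖ ^ (s - 2) * inner ℝ (f x) (g x)) m ∧
    HasDerivAt (fun t : ℝ => powInt s m (fun x => f x + t • g x))
      (s * ∫ x, ‖f x‖ ^ (s - 2) * inner ℝ (f x) (g x) ∂m) 0 := by
  have hs0 : 0 < s := by linarith
  have hm : AEStronglyMeasurable (fun x => ‖f x‖ ^ (s - 2) * inner ℝ (f x) (g x)) m :=
    (hf.1.norm.aemeasurable.pow_const _).aestronglyMeasurable.mul (hf.1.inner hg.1)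
  have hb : MemLp (fun x => ‖f x‖ + ‖g x‖) (ENNReal.ofReal s) m := hf.norm.add hg.norm
  -- For |t| < 1 the t-derivative of the integrand is at most s(‖f‖ + ‖g‖)^s, which is integrable.
  -- Integrability of the derivative at 0 comes out of the same theorem.
  have key := hasDerivAt_integral_of_dominated_loc_of_deriv_le (μ := m) (x₀ := (0 : ℝ))
    (s := Metric.ball 0 1)
    (F := fun t x => ‖f x + t • g x‖ ^ s)
    (F' := fun t x => s * (‖f x + t • g x‖ ^ (s - 2) * inner ℝ (f x + t • g x) (g x)))
    (bound := fun x => s * ‖‖f x‖ + ‖g x‖‖ ^ s) (Metric.ball_mem_nhds _ one_pos)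
    (Eventually.of_forall fun t => ?_) ?_ ?_ ?_ ?_ ?_
  · have h1 := key.1
    have h2 := key.2
    simp only [zero_smul, add_zero] at h1 h2
    rw [integral_const_mul] at h2
    refine ⟨?_, h2⟩
    simpa [← mul_assoc, inv_mul_cancel₀ hs0.ne'] using h1.const_mul s⁻¹
  · exact ((hf.1.add (hg.1.const_smul t)).norm.aemeasurable.pow_const _).aestronglyMeasurable
  · simpa using integrable_norm_rpow_of_memLp hs0 hf
  · simpa using hm.const_mul s
  · refine ae_of_all _ fun x t ht => ?_
    have ht1 : |t| ≤ 1 := by simpa using (mem_ball_zero_iff.1 ht).le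
    have h1 : ‖f x + t • g x‖ ≤ ‖f x‖ + ‖g x‖ := by
      refine (norm_add_le _ _).trans ?_
      gcongr
      rw [norm_smul, Real.norm_eq_abs]
      exact mul_le_of_le_one_left (norm_nonneg _) ht1
    have h2 : ‖g x‖ ≤ ‖f x‖ + ‖g x‖ := by linarith [norm_nonneg (f x)]
    rw [norm_mul, Real.norm_of_nonneg hs0.le, Real.norm_eq_abs,
      Real.norm_of_nonneg (add_nonneg (norm_nonneg _) (norm_nonneg _))]
    gcongr
    refine (abs_rpow_sub_two_inner_le _ _).trans ?_
    calc ‖f x + t • g x‖ ^ (s - 1) * ‖g x‖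
        ≤ (‖f x‖ + ‖g x‖) ^ (s - 1) * (‖f x‖ + ‖g x‖) := by
          gcongr
      _ = (‖f x‖ + ‖g x‖) ^ s := by
          rw [← Real.rpow_add_one' (by positivity) (by linarith)]; congr 1; ring
  · exact (integrable_norm_rpow_of_memLp hs0 hb).const_mul s
  · refine ae_of_all _ fun x t _ => ?_
    have h1 : HasDerivAt (fun t : ℝ => f x + t • g x) (g x) t := by
      simpa using ((hasDerivAt_id t).smul_const (g x)).const_add (f x)
    have h2 := (hasFDerivAt_norm_rpow (f x + t • g x) hs).comp_hasDerivAt t h1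
    simpa only [Function.comp_def, smul_apply, innerSL_apply_apply,
      smul_eq_mul, mul_assoc] using h2

lemma midpoint_norm_rpow_le {s : ℝ} (hs : 1 < s) (x y : F) :
    ‖(2⁻¹ : ℝ) • (x + y)‖ ^ s ≤ 2⁻¹ * (‖x‖ ^ s + ‖y‖ ^ s) := by
  have hc := convexOn_rpow hs.le |>.2
  have hc := hc (Set.mem_Ici.2 (norm_nonneg x))
    (Set.mem_Ici.2 (norm_nonneg y)) (a := 2⁻¹) (b := 2⁻¹) (by norm_num) (by norm_num)
    (by norm_num)
  simp only [smul_eq_mul] at hc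
  refine le_trans ?_ (hc.trans_eq (by ring))
  gcongr
  rw [norm_smul, Real.norm_of_nonneg (by norm_num : (0:ℝ) ≤ 2⁻¹), ← mul_add]
  gcongr
  exact norm_add_le x y

/-- If the norms differ, strict convexity of t ↦ t^s is strict here. If they agree, the triangle
inequality is strict, since vectors on one ray with equal norms coincide. -/
lemma midpoint_norm_rpow_lt {s : ℝ} (hs : 1 < s) {x y : F} (hxy : x ≠ y) :
    ‖(2⁻¹ : ℝ) • (x + y)‖ ^ s < 2⁻¹ * (‖x‖ ^ s + ‖y‖ ^ s) := by
  have hs0 : 0 < s := by linarith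
  have e : ‖(2⁻¹ : ℝ) • (x + y)‖ = 2⁻¹ * ‖x + y‖ := by
    rw [norm_smul, Real.norm_of_nonneg (by norm_num : (0:ℝ) ≤ 2⁻¹)]
  rcases eq_or_ne ‖x‖ ‖y‖ with h | h
  · have h1 : ‖(2⁻¹ : ℝ) • (x + y)‖ < ‖x‖ := by
      rw [e]
      have : ‖x + y‖ < ‖x‖ + ‖y‖ := by
        refine lt_of_le_of_ne (norm_add_le x y) fun h2 => hxy ?_
        exact (sameRay_iff_norm_add.2 h2).eq_of_norm_eq h
      linarith
    have := Real.rpow_lt_rpow (norm_nonneg _) h1 hs0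
    rw [← h]; linarith
  · have hc := (strictConvexOn_rpow hs).2
    have hc := hc (Set.mem_Ici.2 (norm_nonneg x))
      (Set.mem_Ici.2 (norm_nonneg y)) h (a := 2⁻¹) (b := 2⁻¹) (by norm_num) (by norm_num)
      (by norm_num)
    simp only [smul_eq_mul] at hc
    refine lt_of_le_of_lt ?_ (hc.trans_eq (by ring))
    gcongr
    rw [e, ← mul_add]
    gcongr
    exact norm_add_le x y

/-- A quantitative form of the strict convexity of `‖·‖ ^ s`. -/
lemma exists_norm_sub_rpow_le [FiniteDimensional ℝ F] {s δ : ℝ} (hs : 1 < s) (hδ : 0 < δ) :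
    ∃ C : ℝ, 0 ≤ C ∧ ∀ x y : F, ‖x - y‖ ^ s ≤ δ * (‖x‖ ^ s + ‖y‖ ^ s) +
      C * (2⁻¹ * (‖x‖ ^ s + ‖y‖ ^ s) - ‖(2⁻¹ : ℝ) • (x + y)‖ ^ s) := by
  have hs0 : 0 < s := by linarith
  have hcont : Continuous fun z : F × F => ‖z.1‖ ^ s + ‖z.2‖ ^ s := by fun_prop (disch := simp [hs0.le])
  have hcont2 : Continuous fun z : F × F => ‖z.1 - z.2‖ ^ s := by fun_prop (disch := simp [hs0.le])
  have hcont3 : Continuous fun z : F × F =>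
      2⁻¹ * (‖z.1‖ ^ s + ‖z.2‖ ^ s) - ‖(2⁻¹ : ℝ) • (z.1 + z.2)‖ ^ s := by
    fun_prop (disch := simp [hs0.le])
  -- Every term is homogeneous of degree s, so the sum of the s-th powers may be normalized to 1. If
  -- ‖x - y‖^s is below δ the first term suffices. The remaining pairs form a compact set on which
  -- the midpoint gap is positive, and C bounds the quotient there.
  set K : Set (F × F) := {z | ‖z.1‖ ^ s + ‖z.2‖ ^ s = 1 ∧ δ ≤ ‖z.1 - z.2‖ ^ s} with hK
  have hKc : IsCompact K := by
    refine Metric.isCompact_of_isClosed_isBounded ?_ ?_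
    · exact (isClosed_eq hcont continuous_const).inter (isClosed_le continuous_const hcont2)
    · refine (Metric.isBounded_closedBall (x := (0 : F × F)) (r := 1)).subset ?_
      intro z hz
      have h1 := Real.rpow_nonneg (norm_nonneg z.1) s
      have h2 := Real.rpow_nonneg (norm_nonneg z.2) s
      have h3 : ∀ t : ℝ, 0 ≤ t → t ^ s ≤ 1 → t ≤ 1 := fun t ht h => by
        by_contra! h'
        exact absurd (Real.one_lt_rpow h' hs0) (not_lt.2 h)
      rw [mem_closedBall_zero_iff, Prod.norm_def]
      exact max_le (h3 _ (norm_nonneg _) (by linarith [hz.1])) (h3 _ (norm_nonneg _) (by linarith [hz.1]))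
  have hpos : ∀ z ∈ K, 0 < 2⁻¹ * (‖z.1‖ ^ s + ‖z.2‖ ^ s) - ‖(2⁻¹ : ℝ) • (z.1 + z.2)‖ ^ s := by
    intro z hz
    refine sub_pos.2 (midpoint_norm_rpow_lt hs fun h => ?_)
    have := hz.2
    rw [h, sub_self, norm_zero, Real.zero_rpow hs0.ne'] at this
    linarith
  obtain ⟨C, hC⟩ := hKc.exists_bound_of_continuousOn
    (hcont2.continuousOn.div hcont3.continuousOn fun z hz => (hpos z hz).ne')
  refine ⟨max C 0, le_max_right _ _, fun x y => ?_⟩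
  have hgap := sub_nonneg.2 (midpoint_norm_rpow_le hs x y)
  set T := ‖x‖ ^ s + ‖y‖ ^ s with hT
  have hT0 : 0 ≤ T := by positivity
  rcases hT0.eq_or_lt with h0 | h0
  · have hx : ‖x‖ ^ s = 0 := by
      have := Real.rpow_nonneg (norm_nonneg x) s; have := Real.rpow_nonneg (norm_nonneg y) s; linarith
    have hy : ‖y‖ ^ s = 0 := by linarith
    rw [Real.rpow_eq_zero (norm_nonneg _) hs0.ne', norm_eq_zero] at hx hy
    subst hx hy
    simp [Real.zero_rpow hs0.ne', ← h0]
  by_cases hd : ‖x - y‖ ^ s ≤ δ * T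
  · have : 0 ≤ max C 0 * (2⁻¹ * T - ‖(2⁻¹ : ℝ) • (x + y)‖ ^ s) := mul_nonneg (le_max_right _ _) hgap
    linarith
  push Not at hd
  -- The scaling that normalizes the pair: τ^s = 1/T.
  set τ := T ^ (-s⁻¹) with hτ
  have hτ0 : 0 < τ := Real.rpow_pos_of_pos h0 _
  have hτs : τ ^ s = T⁻¹ := by
    rw [hτ, ← Real.rpow_mul h0.le, neg_mul, inv_mul_cancel₀ hs0.ne', Real.rpow_neg_one]
  have hn : ∀ z : F, ‖τ • z‖ ^ s = T⁻¹ * ‖z‖ ^ s := fun z => by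
    rw [norm_smul, Real.norm_of_nonneg hτ0.le, Real.mul_rpow hτ0.le (norm_nonneg _), hτs]
  have hz : (τ • x, τ • y) ∈ K := by
    constructor
    · simp only [hn]; rw [← mul_add, ← hT, inv_mul_cancel₀ h0.ne']
    · simp only [← smul_sub, hn]
      rw [inv_mul_eq_div, le_div_iff₀ h0]; exact hd.le
  have h1 := (le_abs_self _).trans (hC _ hz)
  have h2 := hpos _ hz
  simp only [Pi.div_apply, ← smul_sub, ← smul_add, smul_comm _ τ, hn, ← mul_add, ← hT] at h1 h2
  have h3 : 0 < 2⁻¹ * T - ‖(2⁻¹ : ℝ) • (x + y)‖ ^ s := by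
    have : 2⁻¹ * (T⁻¹ * T) - T⁻¹ * ‖(2⁻¹ : ℝ) • (x + y)‖ ^ s
      = T⁻¹ * (2⁻¹ * T - ‖(2⁻¹ : ℝ) • (x + y)‖ ^ s) := by ring
    rw [this] at h2
    exact pos_of_mul_pos_right h2 (inv_nonneg.2 hT0)
  have h4 : ‖x - y‖ ^ s ≤ C * (2⁻¹ * T - ‖(2⁻¹ : ℝ) • (x + y)‖ ^ s) := by
    rw [← div_le_iff₀ h3]
    convert h1 using 1
    rw [show 2⁻¹ * (T⁻¹ * T) - T⁻¹ * ‖(2⁻¹ : ℝ) • (x + y)‖ ^ s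
      = T⁻¹ * (2⁻¹ * T - ‖(2⁻¹ : ℝ) • (x + y)‖ ^ s) by ring, mul_div_mul_left _ _ (inv_pos.2 h0).ne']
  have h5 : C * (2⁻¹ * T - ‖(2⁻¹ : ℝ) • (x + y)‖ ^ s) ≤
    max C 0 * (2⁻¹ * T - ‖(2⁻¹ : ℝ) • (x + y)‖ ^ s) := by gcongr; exact le_max_left _ _
  have h6 : 0 ≤ δ * T := by positivity
  linarith

end Inner

/-! ### Test functions: calculus, translation estimates and ball means. -/

section

section Complete

variable {α : Type*} [MeasurableSpace α] {m : Measure α}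
  {F : Type*} [NormedAddCommGroup F]

lemma exists_tendsto_eLpNorm_of_cauchy [CompleteSpace F] {s : ℝ≥0∞} (hs : 1 ≤ s) {f : ℕ → α → F}
    (hf : ∀ n, MemLp (f n) s m)
    (hc : ∀ ε : ℝ≥0∞, 0 < ε → ∃ K, ∀ i ≥ K, ∀ j ≥ K, eLpNorm (f i - f j) s m ≤ ε) :
    ∃ g, MemLp g s m ∧ Tendsto (fun n => eLpNorm (f n - g) s m) atTop (𝓝 0) := by
  have : Fact (1 ≤ s) := ⟨hs⟩
  have hcs : CauchySeq fun n => (hf n).toLp (f n) := by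
    rw [EMetric.cauchySeq_iff]
    intro ε hε
    obtain ⟨ε', h1, h2⟩ := exists_between hε
    obtain ⟨K, hK⟩ := hc ε' h1
    refine ⟨K, fun i hi j hj => lt_of_le_of_lt ?_ h2⟩
    rw [Lp.edist_toLp_toLp]
    exact hK i hi j hj
  obtain ⟨g, hg⟩ := cauchySeq_tendsto_of_complete hcs
  refine ⟨g, Lp.memLp g, ?_⟩
  rw [Lp.tendsto_Lp_iff_tendsto_eLpNorm'] at hg
  refine hg.congr fun n => eLpNorm_congr_ae ?_
  exact (hf n).coeFn_toLp.sub (EventuallyEq.refl _ _)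

end Complete

variable {N : ℕ} {Ω : Set (EuclideanSpace ℝ (Fin N))}

lemma norm_gradient (φ : EuclideanSpace ℝ (Fin N) → ℝ) (x : EuclideanSpace ℝ (Fin N)) :
    ‖gradient φ x‖ = ‖fderiv ℝ φ x‖ := by
  simp [gradient]

namespace IsTestFunction

variable {φ ψ : EuclideanSpace ℝ (Fin N) → ℝ}

lemma differentiable (h : IsTestFunction Ω φ) : Differentiable ℝ φ :=
  h.1.differentiable (by simp)

lemma continuous (h : IsTestFunction Ω φ) : Continuous φ := h.1.continuous

lemma continuous_gradient (h : IsTestFunction Ω φ) : Continuous (gradient φ) := by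
  unfold gradient
  exact (LinearIsometryEquiv.continuous _).comp (h.1.continuous_fderiv (by simp))

lemma add (hφ : IsTestFunction Ω φ) (hψ : IsTestFunction Ω ψ) :
    IsTestFunction Ω (fun x => φ x + ψ x) :=
  ⟨hφ.1.add hψ.1, hφ.2.1.add hψ.2.1,
    (tsupport_add φ ψ).trans (Set.union_subset hφ.2.2 hψ.2.2)⟩

lemma smul (c : ℝ) (hφ : IsTestFunction Ω φ) : IsTestFunction Ω (fun x => c * φ x) :=
  ⟨contDiff_const.mul hφ.1, hφ.2.1.mul_left, (tsupport_mul_subset_right).trans hφ.2.2⟩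

lemma comp {T : ℝ → ℝ} (hT : ContDiff ℝ ∞ T) (hT0 : T 0 = 0) (hφ : IsTestFunction Ω φ) :
    IsTestFunction Ω (fun x => T (φ x)) :=
  ⟨hT.comp hφ.1, hφ.2.1.comp_left hT0, (tsupport_comp_subset hT0 φ).trans hφ.2.2⟩

lemma gradient_add (hφ : IsTestFunction Ω φ) (hψ : IsTestFunction Ω ψ) :
    gradient (fun x => φ x + ψ x) = fun x => gradient φ x + gradient ψ x := by
  ext1 x
  simp only [gradient]
  rw [fderiv_fun_add (hφ.differentiable x) (hψ.differentiable x), map_add]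

lemma gradient_smul (c : ℝ) (hφ : IsTestFunction Ω φ) :
    gradient (fun x => c * φ x) = fun x => c • gradient φ x := by
  ext1 x
  simp only [gradient]
  rw [fderiv_const_mul (hφ.differentiable x), map_smul]

lemma gradient_comp {T : ℝ → ℝ} (hT : ContDiff ℝ ∞ T) (hφ : IsTestFunction Ω φ) :
    gradient (fun x => T (φ x)) = fun x => deriv T (φ x) • gradient φ x := by
  ext1 x
  have h1 : HasDerivAt T (deriv T (φ x)) (φ x) :=
    (hT.differentiable (by simp) _).hasDerivAt
  have h2 := h1.comp_hasFDerivAt x (hφ.differentiable x).hasFDerivAt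
  simp only [gradient]
  rw [show fderiv ℝ (fun x => T (φ x)) x = _ from h2.fderiv, map_smul]

lemma gradient_eq_zero (hφ : IsTestFunction Ω φ) {x} (hx : x ∉ Ω) : gradient φ x = 0 := by
  have : fderiv ℝ φ x = 0 := by
    by_contra h
    exact hx (hφ.2.2 (support_fderiv_subset ℝ h))
  simp [gradient, this]

lemma eq_zero (hφ : IsTestFunction Ω φ) {x} (hx : x ∉ Ω) : φ x = 0 :=
  image_eq_zero_of_notMem_tsupport fun h => hx (hφ.2.2 h)

lemma hasCompactSupport_gradient (hφ : IsTestFunction Ω φ) : HasCompactSupport (gradient φ) := by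
  refine (hφ.2.1.fderiv (𝕜 := ℝ)).mono fun x hx => ?_
  contrapose! hx
  simp only [Function.mem_support, not_not] at hx ⊢
  simp [gradient, hx]

lemma memLp (hφ : IsTestFunction Ω φ) (s : ℝ≥0∞) (m : Measure (EuclideanSpace ℝ (Fin N)))
    [IsFiniteMeasureOnCompacts m] : MemLp φ s m :=
  hφ.continuous.memLp_of_hasCompactSupport hφ.2.1

lemma memLp_gradient (hφ : IsTestFunction Ω φ) (s : ℝ≥0∞)
    (m : Measure (EuclideanSpace ℝ (Fin N))) [IsFiniteMeasureOnCompacts m] :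
    MemLp (gradient φ) s m :=
  hφ.continuous_gradient.memLp_of_hasCompactSupport hφ.hasCompactSupport_gradient

/-- The increment is the integral of the derivative over the segment from x to x + h. Tonelli and
translation invariance then leave a single integral of the gradient. -/
lemma lintegral_sub_translate_le (hφ : IsTestFunction Ω φ) (h : EuclideanSpace ℝ (Fin N)) :
    ∫⁻ x, ‖φ (x + h) - φ x‖ₑ ≤ ‖h‖ₑ * ∫⁻ x, ‖gradient φ x‖ₑ := by
  have hpt : ∀ x, ‖φ (x + h) - φ x‖ₑ ≤
      ∫⁻ t in Set.Ioc (0 : ℝ) 1, ‖h‖ₑ * ‖gradient φ (x + t • h)‖ₑ := by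
    intro x
    have hd : ∀ t : ℝ, HasDerivAt (fun t : ℝ => φ (x + t • h))
        (fderiv ℝ φ (x + t • h) h) t := fun t => by
      have h1 : HasDerivAt (fun t : ℝ => x + t • h) h t := by
        simpa using ((hasDerivAt_id t).smul_const h).const_add x
      exact (hφ.differentiable _).hasFDerivAt.comp_hasDerivAt t h1
    have hcont : Continuous fun t : ℝ => fderiv ℝ φ (x + t • h) h :=
      ((hφ.1.continuous_fderiv (by simp)).comp (by fun_prop)).clm_apply continuous_const
    have := intervalIntegral.integral_eq_sub_of_hasDerivAt (a := (0:ℝ)) (b := 1)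
      (fun t _ => hd t) (hcont.intervalIntegrable _ _)
    simp only [one_smul, zero_smul, add_zero] at this
    rw [← this, intervalIntegral.integral_of_le zero_le_one]
    refine (enorm_integral_le_lintegral_enorm _).trans (lintegral_mono fun t => ?_)
    simp only [enorm_eq_nnnorm, ← ENNReal.coe_mul, ENNReal.coe_le_coe, ← NNReal.coe_le_coe,
      NNReal.coe_mul, coe_nnnorm, norm_gradient]
    rw [mul_comm]
    exact ContinuousLinearMap.le_opNorm _ _
  calc ∫⁻ x, ‖φ (x + h) - φ x‖ₑ
      ≤ ∫⁻ x, ∫⁻ t in Set.Ioc (0 : ℝ) 1, ‖h‖ₑ * ‖gradient φ (x + t • h)‖ₑ :=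
        lintegral_mono hpt
    _ = ∫⁻ t in Set.Ioc (0 : ℝ) 1, ∫⁻ x, ‖h‖ₑ * ‖gradient φ (x + t • h)‖ₑ := by
        refine lintegral_lintegral_swap (Measurable.aemeasurable ?_)
        have : Continuous fun z : EuclideanSpace ℝ (Fin N) × ℝ => gradient φ (z.1 + z.2 • h) :=
          hφ.continuous_gradient.comp (by fun_prop)
        exact this.measurable.enorm.const_mul _
    _ = ∫⁻ t in Set.Ioc (0 : ℝ) 1, ‖h‖ₑ * ∫⁻ x, ‖gradient φ x‖ₑ := by
        congr 1 with t
        rw [lintegral_const_mul _ (by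
          exact (hφ.continuous_gradient.comp (by fun_prop)).measurable.enorm),
          lintegral_add_right_eq_self (fun x => ‖gradient φ x‖ₑ) (t • h)]
    _ = ‖h‖ₑ * ∫⁻ x, ‖gradient φ x‖ₑ := by simp

end IsTestFunction

/-- The mean of `φ` over the ball of radius `ρ` around `x`. -/
def ballMean (ρ : ℝ) (φ : EuclideanSpace ℝ (Fin N) → ℝ) (x : EuclideanSpace ℝ (Fin N)) : ℝ :=
  (volume (Metric.ball (0 : EuclideanSpace ℝ (Fin N)) ρ)).toReal⁻¹ *
    ∫ h in Metric.ball (0 : EuclideanSpace ℝ (Fin N)) ρ, φ (x + h)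

section ballMean

variable {φ : EuclideanSpace ℝ (Fin N) → ℝ} {ρ : ℝ}

lemma volume_ball_toReal_pos (hρ : 0 < ρ) :
    0 < (volume (Metric.ball (0 : EuclideanSpace ℝ (Fin N)) ρ)).toReal :=
  ENNReal.toReal_pos (Metric.measure_ball_pos _ _ hρ).ne' measure_ball_lt_top.ne

lemma enorm_ballMean_le (ρ : ℝ) (φ : EuclideanSpace ℝ (Fin N) → ℝ)
    (x : EuclideanSpace ℝ (Fin N)) : ‖ballMean ρ φ x‖ₑ ≤
      ‖(volume (Metric.ball (0 : EuclideanSpace ℝ (Fin N)) ρ)).toReal⁻¹‖ₑ * ∫⁻ x, ‖φ x‖ₑ := by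
  unfold ballMean
  rw [enorm_mul]
  gcongr
  refine (enorm_integral_le_lintegral_enorm _).trans ((setLIntegral_le_lintegral _ _).trans ?_)
  rw [lintegral_add_left_eq_self (fun h => ‖φ h‖ₑ) x]

/-- The two means differ by the mean of a translation increment, to which the translation estimate
applies. For a fixed radius this makes the means equi-Lipschitz along sequences whose gradients are
bounded in L¹. -/
lemma enorm_ballMean_sub_le (hφ : IsTestFunction Ω φ) (x y : EuclideanSpace ℝ (Fin N)) :
    ‖ballMean ρ φ x - ballMean ρ φ y‖ₑ ≤
      ‖(volume (Metric.ball (0 : EuclideanSpace ℝ (Fin N)) ρ)).toReal⁻¹‖ₑ *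
        (‖x - y‖ₑ * ∫⁻ x, ‖gradient φ x‖ₑ) := by
  have hi : ∀ x, Integrable (fun h => φ (x + h))
      (volume.restrict (Metric.ball (0 : EuclideanSpace ℝ (Fin N)) ρ)) := fun x =>
    ((hφ.continuous.integrable_of_hasCompactSupport hφ.2.1).comp_add_left x).integrableOn
  unfold ballMean
  rw [← mul_sub, ← integral_sub (hi x) (hi y), enorm_mul]
  gcongr
  refine (enorm_integral_le_lintegral_enorm _).trans ((setLIntegral_le_lintegral _ _).trans ?_)
  refine le_trans (le_of_eq ?_) (hφ.lintegral_sub_translate_le (x - y))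
  rw [← lintegral_add_left_eq_self (fun h => ‖φ (h + (x - y)) - φ h‖ₑ) y]
  congr 1 with h
  congr 3
  abel

lemma continuous_ballMean (hφ : IsTestFunction Ω φ) : Continuous (ballMean ρ φ) := by
  unfold ballMean
  refine continuous_const.mul ?_
  obtain ⟨C, hC⟩ := hφ.2.1.exists_bound_of_continuous hφ.continuous
  have : IsFiniteMeasure (volume.restrict (Metric.ball (0 : EuclideanSpace ℝ (Fin N)) ρ)) :=
    ⟨by simpa using measure_ball_lt_top⟩
  exact continuous_of_dominated
    (fun x => (hφ.continuous.comp (by fun_prop)).aestronglyMeasurable) (bound := fun _ => C)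
    (fun x => ae_of_all _ fun h => hC _) (integrable_const C)
    (ae_of_all _ fun h => hφ.continuous.comp (by fun_prop))

/-- The translation estimate averaged over |h| < ρ. It makes the means a uniformly good L¹
approximation when the gradients are bounded in L¹. -/
lemma lintegral_ballMean_sub_le (hρ : 0 < ρ) (hφ : IsTestFunction Ω φ) :
    ∫⁻ x, ‖ballMean ρ φ x - φ x‖ₑ ≤ ENNReal.ofReal ρ * ∫⁻ x, ‖gradient φ x‖ₑ := by
  set B := Metric.ball (0 : EuclideanSpace ℝ (Fin N)) ρ with hB
  have hV := volume_ball_toReal_pos (N := N) hρ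
  have hVfin : volume B ≠ ⊤ := measure_ball_lt_top.ne
  have hVinv : ‖(volume B).toReal⁻¹‖ₑ = (volume B)⁻¹ := by
    rw [Real.enorm_eq_ofReal (inv_nonneg.2 hV.le), ENNReal.ofReal_inv_of_pos hV,
      ENNReal.ofReal_toReal hVfin]
  have hpt : ∀ x, ‖ballMean ρ φ x - φ x‖ₑ ≤ (volume B)⁻¹ * ∫⁻ h in B, ‖φ (x + h) - φ x‖ₑ := by
    intro x
    have hi : Integrable (fun h => φ (x + h)) (volume.restrict B) :=
      ((hφ.continuous.integrable_of_hasCompactSupport hφ.2.1).comp_add_left x).integrableOn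
    have e : ballMean ρ φ x - φ x = (volume B).toReal⁻¹ * ∫ h in B, (φ (x + h) - φ x) := by
      rw [integral_sub hi (integrableOn_const hVfin), setIntegral_const, mul_sub, smul_eq_mul,
        ← mul_assoc, Measure.real, inv_mul_cancel₀ hV.ne', one_mul]
      rfl
    rw [e, enorm_mul, hVinv]
    gcongr
    exact enorm_integral_le_lintegral_enorm _
  have hmeas : Measurable (Function.uncurry fun x h => ‖φ (x + h) - φ x‖ₑ) := by
    have : Continuous fun z : EuclideanSpace ℝ (Fin N) × EuclideanSpace ℝ (Fin N) =>
        φ (z.1 + z.2) - φ z.1 :=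
      (hφ.continuous.comp (by fun_prop)).sub (hφ.continuous.comp (by fun_prop))
    exact this.measurable.enorm
  calc ∫⁻ x, ‖ballMean ρ φ x - φ x‖ₑ
      ≤ ∫⁻ x, (volume B)⁻¹ * ∫⁻ h in B, ‖φ (x + h) - φ x‖ₑ := lintegral_mono hpt
    _ = (volume B)⁻¹ * ∫⁻ h in B, ∫⁻ x, ‖φ (x + h) - φ x‖ₑ := by
        rw [lintegral_const_mul _ hmeas.lintegral_prod_right,
          lintegral_lintegral_swap hmeas.aemeasurable]
    _ ≤ (volume B)⁻¹ * ∫⁻ h in B, ENNReal.ofReal ρ * ∫⁻ x, ‖gradient φ x‖ₑ := by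
        refine mul_le_mul' le_rfl (setLIntegral_mono' measurableSet_ball fun h hh => ?_)
        refine (hφ.lintegral_sub_translate_le h).trans ?_
        gcongr
        rw [← ofReal_norm]
        exact ENNReal.ofReal_le_ofReal (mem_ball_zero_iff.1 hh).le
    _ = ENNReal.ofReal ρ * ∫⁻ x, ‖gradient φ x‖ₑ := by
        rw [setLIntegral_const, mul_comm _ (volume B), ← mul_assoc,
          ENNReal.inv_mul_cancel (Metric.measure_ball_pos _ _ hρ).ne' hVfin, one_mul]

end ballMean

end

/-! ### Rellich compactness and the Sobolev inequality for test functions. -/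

section

variable {N : ℕ} {Ω : Set (EuclideanSpace ℝ (Fin N))}

/-- Rellich compactness for test functions. -/
theorem IsTestFunction.exists_subseq_tendsto (hΩ : volume Ω ≠ ⊤)
    {φ : ℕ → EuclideanSpace ℝ (Fin N) → ℝ} (hφ : ∀ n, IsTestFunction Ω (φ n)) {C : ℝ≥0∞}
    (hC : C ≠ ⊤) (h1 : ∀ n, ∫⁻ x, ‖φ n x‖ₑ ≤ C) (h2 : ∀ n, ∫⁻ x, ‖gradient (φ n) x‖ₑ ≤ C) :
    ∃ σ : ℕ → ℕ, StrictMono σ ∧ ∃ u, MemLp u 1 (volume.restrict Ω) ∧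
      Tendsto (fun n => eLpNorm (φ (σ n) - u) 1 (volume.restrict Ω)) atTop (𝓝 0) := by
  have hfin : IsFiniteMeasure (volume.restrict Ω) := ⟨by simpa using hΩ.lt_top⟩
  set ρ : ℕ → ℝ := fun k => 1 / ((k : ℝ) + 1) with hρ
  have hρ0 : ∀ k, 0 < ρ k := fun k => by positivity
  set d := TopologicalSpace.denseSeq (EuclideanSpace ℝ (Fin N)) with hd
  set M : ℕ → ℝ≥0∞ := fun k =>
    ‖(volume (Metric.ball (0 : EuclideanSpace ℝ (Fin N)) (ρ k))).toReal⁻¹‖ₑ * C with hM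
  have hMtop : ∀ k, M k ≠ ⊤ := fun k => ENNReal.mul_ne_top enorm_ne_top hC
  have hbd : ∀ n k x, ‖ballMean (ρ k) (φ n) x‖ₑ ≤ M k := fun n k x =>
    (enorm_ballMean_le _ _ _).trans (mul_le_mul' le_rfl (h1 n))
  have hlip : ∀ n k x y, ‖ballMean (ρ k) (φ n) x - ballMean (ρ k) (φ n) y‖ₑ ≤ M k * ‖x - y‖ₑ := by
    intro n k x y
    refine (enorm_ballMean_sub_le (hφ n) x y).trans ?_
    rw [hM, mul_assoc, mul_comm C]
    gcongr
    exact h2 n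
  have hbd' : ∀ n k x, ‖ballMean (ρ k) (φ n) x‖ ≤ (M k).toReal := fun n k x => by
    rw [← toReal_enorm]
    exact ENNReal.toReal_mono (hMtop k) (hbd n k x)
  have hlip' : ∀ n k x y, ‖ballMean (ρ k) (φ n) x - ballMean (ρ k) (φ n) y‖
      ≤ (M k).toReal * ‖x - y‖ := by
    intro n k x y
    rw [← toReal_enorm, ← toReal_enorm (x - y), ← ENNReal.toReal_mul]
    exact ENNReal.toReal_mono (ENNReal.mul_ne_top (hMtop k) enorm_ne_top) (hlip n k x y)
  -- Compactness of a countable product of intervals replaces the diagonal argument: one subsequence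
  -- serves all radii and all points of a dense sequence.
  obtain ⟨g, -, σ, hσ, hg⟩ := (isCompact_univ_pi
    (s := fun z : ℕ × ℕ => Metric.closedBall (0 : ℝ) (M z.1).toReal)
    (fun z => isCompact_closedBall _ _)).tendsto_subseq
    (x := fun n z => ballMean (ρ z.1) (φ n) (d z.2))
    (fun n z _ => by simpa using hbd' n z.1 (d z.2))
  rw [tendsto_pi_nhds] at hg
  -- The common Lipschitz constant spreads convergence from the dense points to every point.
  have hconv : ∀ k x, ∃ l, Tendsto (fun n => ballMean (ρ k) (φ (σ n)) x) atTop (𝓝 l) := by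
    intro k x
    refine cauchySeq_tendsto_of_complete (Metric.cauchySeq_iff'.2 fun ε hε => ?_)
    have hMp : 0 < (M k).toReal + 1 := by positivity
    obtain ⟨j, hj⟩ := (TopologicalSpace.denseRange_denseSeq
      (EuclideanSpace ℝ (Fin N))).exists_dist_lt x (show 0 < ε / 4 / ((M k).toReal + 1) by positivity)
    obtain ⟨K, hK⟩ := Metric.cauchySeq_iff'.1 (hg (k, j)).cauchySeq (ε / 4) (by positivity)
    refine ⟨K, fun n hn => ?_⟩
    have e1 : ∀ i, dist (ballMean (ρ k) (φ (σ i)) x) (ballMean (ρ k) (φ (σ i)) (d j)) ≤ ε / 4 := by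
      intro i
      rw [dist_eq_norm]
      refine (hlip' _ _ _ _).trans ?_
      rw [← dist_eq_norm]
      have := (lt_div_iff₀ hMp).1 hj
      nlinarith [dist_nonneg (x := x) (y := d j)]
    have e2 := hK n hn
    have e3 := e1 n
    have e4 := e1 K
    rw [dist_comm] at e4
    simp only [Function.comp_apply] at e2
    have := dist_triangle4 (ballMean (ρ k) (φ (σ n)) x) (ballMean (ρ k) (φ (σ n)) (d j))
      (ballMean (ρ k) (φ (σ K)) (d j)) (ballMean (ρ k) (φ (σ K)) x)
    linarith
  choose G hG using hconv
  have hGmeas : ∀ k, AEStronglyMeasurable (G k) (volume.restrict Ω) := fun k =>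
    aestronglyMeasurable_of_tendsto_ae atTop
      (fun n => (continuous_ballMean (hφ (σ n))).aestronglyMeasurable) (ae_of_all _ (hG k))
  have hA : ∀ k, Tendsto (fun n => eLpNorm (ballMean (ρ k) (φ (σ n)) - G k) 1
      (volume.restrict Ω)) atTop (𝓝 0) := by
    intro k
    have := tendsto_eLpNorm_of_dominated (m := volume.restrict Ω) (s := 1) one_pos
      (f := fun n => ballMean (ρ k) (φ (σ n)) - G k) (b := fun _ => 2 * (M k).toReal)
      (fun n => (continuous_ballMean (hφ (σ n))).aestronglyMeasurable.sub (hGmeas k))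
      (memLp_const _) (fun n => ae_of_all _ fun x => ?_) (ae_of_all _ fun x => ?_)
    · simpa using this
    · have e1 := hbd' (σ n) k x
      have e2 : ‖G k x‖ ≤ (M k).toReal :=
        le_of_tendsto (hG k x).norm (Eventually.of_forall fun n => hbd' (σ n) k x)
      exact (norm_sub_le _ _).trans (by linarith)
    · simpa using (hG k x).sub_const (G k x)
  have hφm : ∀ n, MemLp (φ n) 1 (volume.restrict Ω) := fun n => (hφ n).memLp _ _
  have hB : ∀ k n, eLpNorm (φ n - ballMean (ρ k) (φ n)) 1 (volume.restrict Ω)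
      ≤ ENNReal.ofReal (ρ k) * C := by
    intro k n
    rw [eLpNorm_sub_comm, eLpNorm_one_eq_lintegral_enorm]
    refine (setLIntegral_le_lintegral _ _).trans
      ((lintegral_ballMean_sub_le (hρ0 k) (hφ n)).trans ?_)
    gcongr
    exact h2 n
  -- The radius is fixed first, so that replacing φ by its mean costs less than ε/4 for every n.
  -- Only then is the index chosen from the convergence of the means at that radius.
  refine ⟨σ, hσ, exists_tendsto_eLpNorm_of_cauchy le_rfl (fun n => hφm _) fun ε hε => ?_⟩
  have hρlim : Tendsto (fun k => ENNReal.ofReal (ρ k) * C) atTop (𝓝 0) := by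
    have := ENNReal.tendsto_ofReal (tendsto_one_div_add_atTop_nhds_zero_nat (𝕜 := ℝ))
    rw [ENNReal.ofReal_zero] at this
    simpa only [zero_mul] using ENNReal.Tendsto.mul_const this (Or.inr hC)
  have hε4 : 0 < ε / 4 := ENNReal.div_pos hε.ne' (by simp)
  obtain ⟨k, hk⟩ := (hρlim.eventually (gt_mem_nhds hε4)).exists
  obtain ⟨K, hK⟩ := eventually_atTop.1 ((hA k).eventually (gt_mem_nhds hε4))
  refine ⟨K, fun i hi j hj => ?_⟩
  have hmm : ∀ n, AEStronglyMeasurable (ballMean (ρ k) (φ n)) (volume.restrict Ω) := fun n =>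
    (continuous_ballMean (hφ n)).aestronglyMeasurable
  have e : φ (σ i) - φ (σ j) = ((φ (σ i) - ballMean (ρ k) (φ (σ i))) +
      (ballMean (ρ k) (φ (σ i)) - G k)) - ((φ (σ j) - ballMean (ρ k) (φ (σ j))) +
      (ballMean (ρ k) (φ (σ j)) - G k)) := by abel
  have hs : ∀ i, K ≤ i → eLpNorm ((φ (σ i) - ballMean (ρ k) (φ (σ i))) +
      (ballMean (ρ k) (φ (σ i)) - G k)) 1 (volume.restrict Ω) ≤ ε / 4 + ε / 4 := fun i hi =>
    (eLpNorm_add_le ((hφm _).1.sub (hmm _)) ((hmm _).sub (hGmeas k)) le_rfl).trans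
      (add_le_add ((hB k _).trans hk.le) (hK i hi).le)
  rw [e]
  refine (eLpNorm_sub_le ?_ ?_ le_rfl).trans ((add_le_add (hs i hi) (hs j hj)).trans_eq ?_)
  · exact ((hφm _).1.sub (hmm _)).add ((hmm _).sub (hGmeas k))
  · exact ((hφm _).1.sub (hmm _)).add ((hmm _).sub (hGmeas k))
  · rw [← two_mul, ← two_mul, ← mul_assoc]
    norm_num
    exact ENNReal.mul_div_cancel (by simp) (by simp)

/-- The Sobolev inequality for test functions, with exponent `p^* = Np/(N-p)`. -/
theorem exists_eLpNorm_le_gradient {p : ℝ} (hp : 1 < p) (hpN : p < N) :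
    ∃ C : ℝ≥0, ∀ φ : EuclideanSpace ℝ (Fin N) → ℝ, IsTestFunction Ω φ →
      eLpNorm φ (ENNReal.ofReal (N * p / (N - p))) (volume.restrict Ω) ≤
        C * eLpNorm (gradient φ) (ENNReal.ofReal p) (volume.restrict Ω) := by
  have hp0 : 0 < p := by linarith
  have hN : (0 : ℝ) < N := by linarith
  refine ⟨SNormLESNormFDerivOfEqConst ℝ (volume : Measure (EuclideanSpace ℝ (Fin N)))
    (p.toNNReal : ℝ), fun φ hφ => ?_⟩
  -- The function and its gradient vanish off Ω, so the inequality on the whole space applies.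
  rw [eLpNorm_restrict_eq_of_support_subset, eLpNorm_restrict_eq_of_support_subset]
  · rw [show eLpNorm (gradient φ) (ENNReal.ofReal p) volume
      = eLpNorm (fderiv ℝ φ) (ENNReal.ofReal p) volume from
      eLpNorm_congr_norm_ae (ae_of_all _ fun x => norm_gradient φ x)]
    refine eLpNorm_le_eLpNorm_fderiv_of_eq (volume : Measure (EuclideanSpace ℝ (Fin N)))
      (hφ.1.of_le (by simp)) hφ.2.1 (p := p.toNNReal) (p' := (N * p / (N - p)).toNNReal) ?_ ?_ ?_
    · simpa using hp.le
    · simpa using hN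
    · have : 0 < (N : ℝ) - p := by linarith
      rw [Real.coe_toNNReal _ (by positivity), NNReal.coe_inv, Real.coe_toNNReal _ hp0.le,
        finrank_euclideanSpace, Fintype.card_fin]
      field_simp
  · intro x hx
    by_contra h
    exact hx (hφ.gradient_eq_zero h)
  · intro x hx
    by_contra h
    exact hx (hφ.eq_zero h)

end

/-! ### The weighted measure, the space of limits of test functions, and its Sobolev inequality. -/

section

variable {N : ℕ} {Ω : Set (EuclideanSpace ℝ (Fin N))} {p q : ℝ}
  {μ : EuclideanSpace ℝ (Fin N) → ℝ}

/-- The standing assumptions on the domain, the exponents and the weight. -/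
structure Setting (Ω : Set (EuclideanSpace ℝ (Fin N))) (p q : ℝ)
    (μ : EuclideanSpace ℝ (Fin N) → ℝ) : Prop where
  isOpen : IsOpen Ω
  isBounded : Bornology.IsBounded Ω
  one_lt : 1 < p
  lt_dim : p < N
  lt : p < q
  lt_crit : q < N * p / (N - p)
  memLp : MemLp μ ⊤ (volume.restrict Ω)
  nonneg : ∀ᵐ x ∂(volume.restrict Ω), 0 ≤ μ x

/-- The measure `μ dx` on `Ω`. -/
def wt (Ω : Set (EuclideanSpace ℝ (Fin N))) (μ : EuclideanSpace ℝ (Fin N) → ℝ) :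
    Measure (EuclideanSpace ℝ (Fin N)) :=
  (volume.restrict Ω).withDensity fun x => ENNReal.ofReal (μ x)

lemma wt_ac : wt Ω μ ≪ volume.restrict Ω := withDensity_absolutelyContinuous _ _

namespace Setting

variable (S : Setting Ω p q μ)
include S

lemma p_pos : 0 < p := by linarith [S.one_lt]
lemma one_lt_q : 1 < q := S.one_lt.trans S.lt
lemma q_pos : 0 < q := by linarith [S.one_lt_q]
lemma one_lt_crit : 1 < N * p / (N - p) := S.one_lt_q.trans S.lt_crit
lemma one_le_ofReal_p : 1 ≤ ENNReal.ofReal p := by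
  simpa using ENNReal.ofReal_le_ofReal S.one_lt.le
lemma one_le_ofReal_q : 1 ≤ ENNReal.ofReal q := by
  simpa using ENNReal.ofReal_le_ofReal S.one_lt_q.le

lemma volume_ne_top : volume Ω ≠ ⊤ := S.isBounded.measure_lt_top.ne

lemma finite : IsFiniteMeasure (volume.restrict Ω) := ⟨by simpa using S.volume_ne_top.lt_top⟩

lemma aemeasurable : AEMeasurable μ (volume.restrict Ω) := S.memLp.1.aemeasurable

/-- Essential boundedness of μ. It makes the weighted measure finite and transfers membership in L^s
to it. -/
lemma exists_wt_le : ∃ c : ℝ≥0∞, c ≠ ⊤ ∧ wt Ω μ ≤ c • volume.restrict Ω := by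
  refine ⟨eLpNorm μ ⊤ (volume.restrict Ω), S.memLp.2.ne, ?_⟩
  rw [← withDensity_const]
  refine withDensity_mono ?_
  filter_upwards [ae_le_eLpNormEssSup (f := μ) (μ := volume.restrict Ω)] with x hx
  rw [eLpNorm_exponent_top]
  exact (Real.ofReal_le_enorm _).trans hx

lemma finite_wt : IsFiniteMeasure (wt Ω μ) := by
  obtain ⟨c, hc, h⟩ := S.exists_wt_le
  have := S.finite
  have : IsFiniteMeasure (c • volume.restrict Ω) := Measure.smul_finite _ hc
  exact isFiniteMeasure_of_le _ h

lemma memLp_wt {F : Type*} [NormedAddCommGroup F] {f : EuclideanSpace ℝ (Fin N) → F} {s : ℝ≥0∞}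
    (h : MemLp f s (volume.restrict Ω)) : MemLp f s (wt Ω μ) := by
  obtain ⟨c, hc, hle⟩ := S.exists_wt_le
  exact h.of_measure_le_smul hc hle

lemma integral_wt (f : EuclideanSpace ℝ (Fin N) → ℝ) :
    ∫ x, f x ∂(wt Ω μ) = ∫ x in Ω, μ x * f x := by
  unfold wt
  rw [integral_withDensity_eq_integral_toReal_smul₀ S.aemeasurable.ennreal_ofReal (by simp)]
  refine integral_congr_ae ?_
  filter_upwards [S.nonneg] with x hx
  rw [ENNReal.toReal_ofReal hx, smul_eq_mul]

lemma integrable_wt {f : EuclideanSpace ℝ (Fin N) → ℝ} :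
    Integrable f (wt Ω μ) ↔ Integrable (fun x => μ x * f x) (volume.restrict Ω) := by
  unfold wt
  rw [integrable_withDensity_iff_integrable_smul₀' S.aemeasurable.ennreal_ofReal (by simp)]
  refine integrable_congr ?_
  filter_upwards [S.nonneg] with x hx
  rw [ENNReal.toReal_ofReal hx, smul_eq_mul]

lemma lintegral_wt {f : EuclideanSpace ℝ (Fin N) → ℝ≥0∞}
    (hf : AEMeasurable f (volume.restrict Ω)) :
    ∫⁻ x, f x ∂(wt Ω μ) = ∫⁻ x in Ω, ENNReal.ofReal (μ x) * f x := by
  unfold wt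
  rw [lintegral_withDensity_eq_lintegral_mul₀ S.aemeasurable.ennreal_ofReal hf]
  rfl

end Setting

/-- `u` is the limit of test functions in the space `W_0^{1,H}(Ω)`, and `G` is the limit of their
gradients. -/
structure InV (Ω : Set (EuclideanSpace ℝ (Fin N))) (p q : ℝ) (μ : EuclideanSpace ℝ (Fin N) → ℝ)
    (u : EuclideanSpace ℝ (Fin N) → ℝ)
    (G : EuclideanSpace ℝ (Fin N) → EuclideanSpace ℝ (Fin N)) : Prop where
  aesm : AEStronglyMeasurable u (volume.restrict Ω)
  aesm_grad : AEStronglyMeasurable G (volume.restrict Ω)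
  approx : ∃ φ : ℕ → EuclideanSpace ℝ (Fin N) → ℝ, (∀ n, IsTestFunction Ω (φ n)) ∧
    Tendsto (fun n => eLpNorm (φ n - u) 1 (volume.restrict Ω)) atTop (𝓝 0) ∧
    Tendsto (fun n => eLpNorm (gradient (φ n) - G) (ENNReal.ofReal p) (volume.restrict Ω))
      atTop (𝓝 0) ∧
    Tendsto (fun n => eLpNorm (gradient (φ n) - G) (ENNReal.ofReal q) (wt Ω μ)) atTop (𝓝 0)

lemma memLp_of_tendsto {α F : Type*} [MeasurableSpace α] {m : Measure α} [NormedAddCommGroup F]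
    {s : ℝ≥0∞} {f : ℕ → α → F} {g : α → F} (hf : ∀ n, MemLp (f n) s m)
    (hg : AEStronglyMeasurable g m)
    (h : Tendsto (fun n => eLpNorm (f n - g) s m) atTop (𝓝 0)) : MemLp g s m := by
  obtain ⟨n, hn⟩ := (h.eventually (gt_mem_nhds ENNReal.zero_lt_top)).exists
  have h1 : MemLp (f n - g) s m := ⟨(hf n).1.sub hg, hn⟩
  simpa using (hf n).sub h1

lemma tendsto_eLpNorm_add {α F : Type*} [MeasurableSpace α] {m : Measure α} [NormedAddCommGroup F]
    {s : ℝ≥0∞} (hs : 1 ≤ s) {f f' : ℕ → α → F}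
    (hf : ∀ n, AEStronglyMeasurable (f n) m) (hf' : ∀ n, AEStronglyMeasurable (f' n) m)
    (h : Tendsto (fun n => eLpNorm (f n) s m) atTop (𝓝 0))
    (h' : Tendsto (fun n => eLpNorm (f' n) s m) atTop (𝓝 0)) :
    Tendsto (fun n => eLpNorm (f n + f' n) s m) atTop (𝓝 0) := by
  refine tendsto_of_tendsto_of_tendsto_of_le_of_le tendsto_const_nhds
    (by simpa using h.add h') (fun _ => zero_le) fun n => eLpNorm_add_le (hf n) (hf' n) hs

lemma tendsto_eLpNorm_smul {α F : Type*} [MeasurableSpace α] {m : Measure α}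
    [NormedAddCommGroup F] [NormedSpace ℝ F] (c : ℝ)
    {s : ℝ≥0∞} {f : ℕ → α → F} (h : Tendsto (fun n => eLpNorm (f n) s m) atTop (𝓝 0)) :
    Tendsto (fun n => eLpNorm (c • f n) s m) atTop (𝓝 0) := by
  simp_rw [eLpNorm_const_smul]
  simpa using ENNReal.Tendsto.const_mul h (Or.inr (enorm_ne_top (x := c)))

lemma IsTestFunction.inV {φ : EuclideanSpace ℝ (Fin N) → ℝ} (hφ : IsTestFunction Ω φ) :
    InV Ω p q μ φ (gradient φ) :=
  ⟨hφ.continuous.aestronglyMeasurable, hφ.continuous_gradient.aestronglyMeasurable,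
    fun _ => φ, fun _ => hφ, by simp, by simp, by simp⟩

namespace InV

variable {u v : EuclideanSpace ℝ (Fin N) → ℝ}
  {G H : EuclideanSpace ℝ (Fin N) → EuclideanSpace ℝ (Fin N)}

lemma aesm_wt (h : InV Ω p q μ u G) : AEStronglyMeasurable G (wt Ω μ) :=
  h.aesm_grad.mono_ac wt_ac

lemma memLp_one (h : InV Ω p q μ u G) : MemLp u 1 (volume.restrict Ω) := by
  obtain ⟨φ, h0, h1, -⟩ := h.approx
  exact memLp_of_tendsto (fun n => (h0 n).memLp _ _) h.aesm h1

lemma memLp_grad (h : InV Ω p q μ u G) : MemLp G (ENNReal.ofReal p) (volume.restrict Ω) := by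
  obtain ⟨φ, h0, -, h1, -⟩ := h.approx
  exact memLp_of_tendsto (fun n => (h0 n).memLp_gradient _ _) h.aesm_grad h1

lemma memLp_grad_wt (S : Setting Ω p q μ) (h : InV Ω p q μ u G) :
    MemLp G (ENNReal.ofReal q) (wt Ω μ) := by
  obtain ⟨φ, h0, -, -, h1⟩ := h.approx
  have := S.finite_wt
  exact memLp_of_tendsto (fun n => (h0 n).memLp_gradient _ _) h.aesm_wt h1

lemma add (S : Setting Ω p q μ) (hu : InV Ω p q μ u G) (hv : InV Ω p q μ v H) :
    InV Ω p q μ (u + v) (G + H) := by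
  obtain ⟨φ, h0, h1, h2, h3⟩ := hu.approx
  obtain ⟨ψ, k0, k1, k2, k3⟩ := hv.approx
  refine ⟨hu.aesm.add hv.aesm, hu.aesm_grad.add hv.aesm_grad, fun n x => φ n x + ψ n x,
    fun n => (h0 n).add (k0 n), ?_, ?_, ?_⟩
  · refine (tendsto_eLpNorm_add le_rfl
      (fun n => (h0 n).continuous.aestronglyMeasurable.sub hu.aesm)
      (fun n => (k0 n).continuous.aestronglyMeasurable.sub hv.aesm) h1 k1).congr fun n => ?_
    congr 1
    ext x
    simp; ring
  · refine (tendsto_eLpNorm_add S.one_le_ofReal_p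
      (fun n => (h0 n).continuous_gradient.aestronglyMeasurable.sub hu.aesm_grad)
      (fun n => (k0 n).continuous_gradient.aestronglyMeasurable.sub hv.aesm_grad)
      h2 k2).congr fun n => ?_
    rw [(h0 n).gradient_add (k0 n)]
    congr 1
    ext1 x
    simp only [Pi.add_apply, Pi.sub_apply]; abel
  · refine (tendsto_eLpNorm_add S.one_le_ofReal_q
      (fun n => (h0 n).continuous_gradient.aestronglyMeasurable.sub hu.aesm_wt)
      (fun n => (k0 n).continuous_gradient.aestronglyMeasurable.sub hv.aesm_wt)
      h3 k3).congr fun n => ?_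
    rw [(h0 n).gradient_add (k0 n)]
    congr 1
    ext1 x
    simp only [Pi.add_apply, Pi.sub_apply]; abel

lemma smul (c : ℝ) (hu : InV Ω p q μ u G) : InV Ω p q μ (c • u) (c • G) := by
  obtain ⟨φ, h0, h1, h2, h3⟩ := hu.approx
  refine ⟨hu.aesm.const_smul c, hu.aesm_grad.const_smul c, fun n x => c * φ n x,
    fun n => (h0 n).smul c, ?_, ?_, ?_⟩
  · refine (tendsto_eLpNorm_smul c h1).congr fun n => ?_
    congr 1
    ext x
    simp; ring
  · refine (tendsto_eLpNorm_smul c h2).congr fun n => ?_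
    rw [(h0 n).gradient_smul c, smul_sub]
    rfl
  · refine (tendsto_eLpNorm_smul c h3).congr fun n => ?_
    rw [(h0 n).gradient_smul c, smul_sub]
    rfl

lemma sub (S : Setting Ω p q μ) (hu : InV Ω p q μ u G) (hv : InV Ω p q μ v H) :
    InV Ω p q μ (u - v) (G - H) := by
  have := hu.add S (hv.smul (-1))
  rwa [neg_one_smul, neg_one_smul, ← sub_eq_add_neg, ← sub_eq_add_neg] at this

lemma congr (hu : InV Ω p q μ u G) (h1 : u =ᵐ[volume.restrict Ω] v)
    (h2 : G =ᵐ[volume.restrict Ω] H) : InV Ω p q μ v H := by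
  obtain ⟨φ, h0, k1, k2, k3⟩ := hu.approx
  refine ⟨hu.aesm.congr h1, hu.aesm_grad.congr h2, φ, h0, k1.congr fun n => ?_,
    k2.congr fun n => ?_, k3.congr fun n => ?_⟩
  · exact eLpNorm_congr_ae ((EventuallyEq.refl _ _).sub h1)
  · exact eLpNorm_congr_ae ((EventuallyEq.refl _ _).sub h2)
  · exact eLpNorm_congr_ae ((EventuallyEq.refl _ _).sub (wt_ac.ae_eq h2))

/-- The space is closed. -/
lemma of_tendsto (S : Setting Ω p q μ) {w : ℕ → EuclideanSpace ℝ (Fin N) → ℝ}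
    {K : ℕ → EuclideanSpace ℝ (Fin N) → EuclideanSpace ℝ (Fin N)}
    (hw : ∀ n, InV Ω p q μ (w n) (K n))
    (hu : AEStronglyMeasurable u (volume.restrict Ω))
    (hG : AEStronglyMeasurable G (volume.restrict Ω))
    (h1 : Tendsto (fun n => eLpNorm (w n - u) 1 (volume.restrict Ω)) atTop (𝓝 0))
    (h2 : Tendsto (fun n => eLpNorm (K n - G) (ENNReal.ofReal p) (volume.restrict Ω))
      atTop (𝓝 0))
    (h3 : Tendsto (fun n => eLpNorm (K n - G) (ENNReal.ofReal q) (wt Ω μ)) atTop (𝓝 0)) :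
    InV Ω p q μ u G := by
  -- Diagonal choice: a test function that is 1/(n+1)-close to the n-th element in all three norms
  -- at once.
  have hdiag : ∀ n : ℕ, ∃ φ, IsTestFunction Ω φ ∧
      eLpNorm (φ - w n) 1 (volume.restrict Ω) ≤ ENNReal.ofReal (1 / ((n : ℝ) + 1)) ∧
      eLpNorm (gradient φ - K n) (ENNReal.ofReal p) (volume.restrict Ω)
        ≤ ENNReal.ofReal (1 / ((n : ℝ) + 1)) ∧
      eLpNorm (gradient φ - K n) (ENNReal.ofReal q) (wt Ω μ)
        ≤ ENNReal.ofReal (1 / ((n : ℝ) + 1)) := by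
    intro n
    obtain ⟨φ, h0, k1, k2, k3⟩ := (hw n).approx
    have hpos : 0 < ENNReal.ofReal (1 / ((n : ℝ) + 1)) := ENNReal.ofReal_pos.2 (by positivity)
    obtain ⟨j, j1, j2, j3⟩ := ((k1.eventually (gt_mem_nhds hpos)).and
      ((k2.eventually (gt_mem_nhds hpos)).and (k3.eventually (gt_mem_nhds hpos)))).exists
    exact ⟨φ j, h0 j, j1.le, j2.le, j3.le⟩
  choose φ h0 k1 k2 k3 using hdiag
  have hlim : Tendsto (fun n : ℕ => ENNReal.ofReal (1 / ((n : ℝ) + 1))) atTop (𝓝 0) := by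
    have := ENNReal.tendsto_ofReal (tendsto_one_div_add_atTop_nhds_zero_nat (𝕜 := ℝ))
    rwa [ENNReal.ofReal_zero] at this
  have hz : ∀ {f : ℕ → ℝ≥0∞}, (∀ n, f n ≤ ENNReal.ofReal (1 / ((n : ℝ) + 1))) →
      Tendsto f atTop (𝓝 0) := fun hf =>
    tendsto_of_tendsto_of_tendsto_of_le_of_le tendsto_const_nhds hlim (fun _ => zero_le) hf
  refine ⟨hu, hG, φ, h0, ?_, ?_, ?_⟩
  · simpa using tendsto_eLpNorm_add le_rfl
      (fun n => (h0 n).continuous.aestronglyMeasurable.sub (hw n).aesm)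
      (fun n => (hw n).aesm.sub hu) (hz k1) h1
  · simpa using tendsto_eLpNorm_add S.one_le_ofReal_p
      (fun n => (h0 n).continuous_gradient.aestronglyMeasurable.sub (hw n).aesm_grad)
      (fun n => (hw n).aesm_grad.sub hG) (hz k2) h2
  · simpa using tendsto_eLpNorm_add S.one_le_ofReal_q
      (fun n => (h0 n).continuous_gradient.aestronglyMeasurable.sub (hw n).aesm_wt)
      (fun n => (hw n).aesm_wt.sub (hG.mono_ac wt_ac)) (hz k3) h3

end InV

namespace Setting

variable (S : Setting Ω p q μ)
include S

/-- The Sobolev inequality. -/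
lemma exists_sobolev : ∃ C : ℝ≥0, ∀ u G, InV Ω p q μ u G →
    eLpNorm u (ENNReal.ofReal (N * p / (N - p))) (volume.restrict Ω) ≤
      C * eLpNorm G (ENNReal.ofReal p) (volume.restrict Ω) := by
  obtain ⟨C, hC⟩ := exists_eLpNorm_le_gradient (Ω := Ω) S.one_lt S.lt_dim
  refine ⟨C, fun u G hu => ?_⟩
  obtain ⟨φ, h0, h1, h2, -⟩ := hu.approx
  obtain ⟨σ, hσ, hae⟩ := exists_subseq_ae_tendsto one_ne_zero
    (fun n => (h0 n).continuous.aestronglyMeasurable) hu.aesm h1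
  have hb : ∀ n, eLpNorm (φ (σ n)) (ENNReal.ofReal (N * p / (N - p))) (volume.restrict Ω) ≤
      C * (eLpNorm (gradient (φ (σ n)) - G) (ENNReal.ofReal p) (volume.restrict Ω) +
        eLpNorm G (ENNReal.ofReal p) (volume.restrict Ω)) := by
    intro n
    refine (hC _ (h0 _)).trans ?_
    gcongr
    have := eLpNorm_add_le (((h0 (σ n)).continuous_gradient.aestronglyMeasurable.sub
      hu.aesm_grad)) hu.aesm_grad S.one_le_ofReal_p
    simpa using this
  -- The approximation of u is only in L¹, so the critical norm passes to the limit by Fatou along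
  -- an a.e. convergent subsequence.
  refine (Lp.eLpNorm_lim_le_liminf_eLpNorm
    (fun n => (h0 (σ n)).continuous.aestronglyMeasurable) u hae).trans ?_
  have hlim : Tendsto (fun n =>
      C * (eLpNorm (gradient (φ (σ n)) - G) (ENNReal.ofReal p) (volume.restrict Ω) +
        eLpNorm G (ENNReal.ofReal p) (volume.restrict Ω))) atTop
      (𝓝 (C * (0 + eLpNorm G (ENNReal.ofReal p) (volume.restrict Ω)))) :=
    ENNReal.Tendsto.const_mul ((h2.comp hσ.tendsto_atTop).add tendsto_const_nhds)
      (Or.inr ENNReal.coe_ne_top)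
  rw [zero_add] at hlim
  rw [← hlim.liminf_eq]
  exact liminf_le_liminf (Eventually.of_forall hb)

lemma memLp_crit {u G} (hu : InV Ω p q μ u G) :
    MemLp u (ENNReal.ofReal (N * p / (N - p))) (volume.restrict Ω) := by
  obtain ⟨C, hC⟩ := S.exists_sobolev
  exact ⟨hu.aesm, (hC u G hu).trans_lt (ENNReal.mul_lt_top ENNReal.coe_lt_top hu.memLp_grad.2)⟩

lemma memLp_of_le {u G} (hu : InV Ω p q μ u G) {s : ℝ} (hs : s ≤ N * p / (N - p)) :
    MemLp u (ENNReal.ofReal s) (volume.restrict Ω) := by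
  have := S.finite
  exact (S.memLp_crit hu).mono_exponent (ENNReal.ofReal_le_ofReal hs)

end Setting

end

/-! ### Weak gradients, the Luxemburg norm, and the identification with W_0^{1,H}. -/

section

variable {N : ℕ} {Ω : Set (EuclideanSpace ℝ (Fin N))} {p q : ℝ}
  {μ : EuclideanSpace ℝ (Fin N) → ℝ}

lemma tendsto_eLpNorm_mono_exponent {α F : Type*} [MeasurableSpace α] {m : Measure α}
    [IsFiniteMeasure m] [NormedAddCommGroup F] {s t : ℝ≥0∞} (hst : s ≤ t) (hs : s ≠ 0)
    {f : ℕ → α → F} (hf : ∀ n, AEStronglyMeasurable (f n) m)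
    (h : Tendsto (fun n => eLpNorm (f n) t m) atTop (𝓝 0)) :
    Tendsto (fun n => eLpNorm (f n) s m) atTop (𝓝 0) := by
  have hpow : 0 ≤ 1 / s.toReal - 1 / t.toReal := by
    rcases eq_or_ne t ⊤ with rfl | ht
    · simp
    have hs' : s ≠ ⊤ := ne_top_of_le_ne_top ht hst
    have : 0 < s.toReal := ENNReal.toReal_pos hs hs'
    exact sub_nonneg.2 (one_div_le_one_div_of_le this (ENNReal.toReal_mono ht hst))
  have hlim := ENNReal.Tendsto.mul_const (b := m Set.univ ^ (1 / s.toReal - 1 / t.toReal)) h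
    (Or.inr (ENNReal.rpow_ne_top_of_nonneg hpow (measure_ne_top _ _)))
  rw [zero_mul] at hlim
  exact tendsto_of_tendsto_of_tendsto_of_le_of_le tendsto_const_nhds hlim (fun _ => zero_le)
    fun n => eLpNorm_le_eLpNorm_mul_rpow_measure_univ hst (hf n)

lemma IsTestFunction.inner_gradient {φ : EuclideanSpace ℝ (Fin N) → ℝ}
    (v x : EuclideanSpace ℝ (Fin N)) : inner ℝ v (gradient φ x) = fderiv ℝ φ x v := by
  rw [real_inner_comm, gradient, InnerProductSpace.toDual_symm_apply]

lemma IsTestFunction.integral_smul_gradient {φ ψ : EuclideanSpace ℝ (Fin N) → ℝ}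
    (hφ : IsTestFunction Ω φ) (hψ : IsTestFunction Ω ψ) :
    ∫ x in Ω, ψ x • gradient φ x = - ∫ x in Ω, φ x • gradient ψ x := by
  have e : ∀ {φ ψ : EuclideanSpace ℝ (Fin N) → ℝ}, IsTestFunction Ω ψ →
      ∫ x in Ω, ψ x • gradient φ x = ∫ x, ψ x • gradient φ x := fun {φ ψ} hψ =>
    setIntegral_eq_integral_of_forall_compl_eq_zero fun x hx => by simp [hψ.eq_zero hx]
  have hi : ∀ {φ ψ : EuclideanSpace ℝ (Fin N) → ℝ}, IsTestFunction Ω φ → IsTestFunction Ω ψ →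
      Integrable fun x => ψ x • gradient φ x := fun {φ ψ} hφ hψ =>
    (hψ.continuous.smul hφ.continuous_gradient).integrable_of_hasCompactSupport hψ.2.1.smul_right
  rw [e hψ, e hφ]
  -- Pairing with a fixed vector reduces the identity to scalar integration by parts for a
  -- directional derivative.
  refine ext_inner_left ℝ fun v => ?_
  rw [inner_neg_right, ← integral_inner (hi hφ hψ), ← integral_inner (hi hψ hφ)]
  simp only [inner_smul_right, IsTestFunction.inner_gradient]
  have hj : ∀ {φ ψ : EuclideanSpace ℝ (Fin N) → ℝ}, IsTestFunction Ω φ → IsTestFunction Ω ψ →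
      Integrable fun x => ψ x * fderiv ℝ φ x v := fun {φ ψ} hφ hψ =>
    (hψ.continuous.mul ((hφ.1.continuous_fderiv (by simp)).clm_apply
      continuous_const)).integrable_of_hasCompactSupport hψ.2.1.mul_right
  rw [integral_mul_fderiv_eq_neg_fderiv_mul_of_integrable (μ := volume) (v := v) ?_ (hj hφ hψ) ?_
    (fun x _ => hψ.differentiable x) (fun x _ => hφ.differentiable x)]
  · simp only [mul_comm]
  · simpa only [mul_comm] using hj hψ hφ
  · exact (hψ.continuous.mul hφ.continuous).integrable_of_hasCompactSupport hψ.2.1.mul_right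

lemma exists_bound_of_isTestFunction {ψ : EuclideanSpace ℝ (Fin N) → ℝ}
    (hψ : IsTestFunction Ω ψ) : ∃ C : ℝ, ∀ x, ‖ψ x‖ ≤ C ∧ ‖gradient ψ x‖ ≤ C := by
  obtain ⟨C, hC⟩ := hψ.2.1.exists_bound_of_continuous hψ.continuous
  obtain ⟨D, hD⟩ := hψ.hasCompactSupport_gradient.exists_bound_of_continuous hψ.continuous_gradient
  exact ⟨max C D, fun x => ⟨(hC x).trans (le_max_left _ _), (hD x).trans (le_max_right _ _)⟩⟩

lemma IsTestFunction.integrable_smul {F : Type*} [NormedAddCommGroup F] [NormedSpace ℝ F]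
    {ψ : EuclideanSpace ℝ (Fin N) → ℝ} (hψ : IsTestFunction Ω ψ)
    {G : EuclideanSpace ℝ (Fin N) → F} (hG : Integrable G (volume.restrict Ω)) :
    Integrable (fun x => ψ x • G x) (volume.restrict Ω) := by
  obtain ⟨C, hC⟩ := exists_bound_of_isTestFunction hψ
  exact hG.bdd_smul C hψ.continuous.aestronglyMeasurable (ae_of_all _ fun x => (hC x).1)

lemma IsTestFunction.integrable_smul_gradient
    {ψ : EuclideanSpace ℝ (Fin N) → ℝ} (hψ : IsTestFunction Ω ψ)
    {u : EuclideanSpace ℝ (Fin N) → ℝ} (hu : Integrable u (volume.restrict Ω)) :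
    Integrable (fun x => u x • gradient ψ x) (volume.restrict Ω) := by
  obtain ⟨C, hC⟩ := exists_bound_of_isTestFunction hψ
  exact hu.smul_bdd C hψ.continuous_gradient.aestronglyMeasurable (ae_of_all _ fun x => (hC x).2)

lemma HasWeakGradient.sub {u v : EuclideanSpace ℝ (Fin N) → ℝ}
    {G H : EuclideanSpace ℝ (Fin N) → EuclideanSpace ℝ (Fin N)}
    (hu : HasWeakGradient Ω u G) (hv : HasWeakGradient Ω v H)
    (hui : Integrable u (volume.restrict Ω)) (hGi : Integrable G (volume.restrict Ω))
    (hvi : Integrable v (volume.restrict Ω)) (hHi : Integrable H (volume.restrict Ω)) :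
    HasWeakGradient Ω (fun x => u x - v x) (fun x => G x - H x) := by
  refine ⟨hu.1.sub hv.1, hu.2.1.sub hv.2.1, fun ψ hψ => ?_⟩
  simp only [smul_sub, sub_smul]
  rw [integral_sub (hψ.integrable_smul hGi) (hψ.integrable_smul hHi),
    integral_sub (hψ.integrable_smul_gradient hui) (hψ.integrable_smul_gradient hvi),
    hu.2.2 ψ hψ, hv.2.2 ψ hψ]
  abel

namespace InV

variable {u v : EuclideanSpace ℝ (Fin N) → ℝ}
  {G H : EuclideanSpace ℝ (Fin N) → EuclideanSpace ℝ (Fin N)}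

lemma integrable (h : InV Ω p q μ u G) : Integrable u (volume.restrict Ω) :=
  memLp_one_iff_integrable.1 h.memLp_one

lemma integrable_grad (S : Setting Ω p q μ) (h : InV Ω p q μ u G) :
    Integrable G (volume.restrict Ω) := by
  have := S.finite
  exact memLp_one_iff_integrable.1 (h.memLp_grad.mono_exponent S.one_le_ofReal_p)

/-- Integration by parts holds for the approximating test functions and passes to the limit. Both
sides converge in L¹ because ψ and its gradient are bounded; the gradients converge in L¹ since Ω
has finite measure. -/
lemma hasWeakGradient (S : Setting Ω p q μ) (h : InV Ω p q μ u G) : HasWeakGradient Ω u G := by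
  have := S.finite
  have hui := h.integrable
  have hGi := h.integrable_grad S
  refine ⟨IntegrableOn.locallyIntegrableOn hui, IntegrableOn.locallyIntegrableOn hGi,
    fun ψ hψ => ?_⟩
  obtain ⟨φ, h0, h1, h2, -⟩ := h.approx
  have h2' := tendsto_eLpNorm_mono_exponent S.one_le_ofReal_p one_ne_zero
    (fun n => (h0 n).continuous_gradient.aestronglyMeasurable.sub h.aesm_grad) h2
  obtain ⟨C, hC⟩ := exists_bound_of_isTestFunction hψ
  have hφi : ∀ n, Integrable (φ n) (volume.restrict Ω) := fun n =>
    memLp_one_iff_integrable.1 ((h0 n).memLp _ _)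
  have hφgi : ∀ n, Integrable (gradient (φ n)) (volume.restrict Ω) := fun n =>
    memLp_one_iff_integrable.1 ((h0 n).memLp_gradient _ _)
  have lim1 : Tendsto (fun n => ∫ x in Ω, ψ x • gradient (φ n) x) atTop
      (𝓝 (∫ x in Ω, ψ x • G x)) := by
    refine tendsto_integral_of_L1' _ (hψ.integrable_smul hGi).1
      (Eventually.of_forall fun n => hψ.integrable_smul (hφgi n)) ?_
    have := ENNReal.Tendsto.const_mul (a := ENNReal.ofReal C) h2' (Or.inr ENNReal.ofReal_ne_top)
    rw [mul_zero] at this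
    refine tendsto_of_tendsto_of_tendsto_of_le_of_le tendsto_const_nhds this
      (fun _ => zero_le) fun n => eLpNorm_le_mul_eLpNorm_of_ae_le_mul (ae_of_all _ fun x => ?_) 1
    simp only [Pi.sub_apply, ← smul_sub, norm_smul]
    gcongr
    exact (hC x).1
  have lim2 : Tendsto (fun n => ∫ x in Ω, φ n x • gradient ψ x) atTop
      (𝓝 (∫ x in Ω, u x • gradient ψ x)) := by
    refine tendsto_integral_of_L1' _ (hψ.integrable_smul_gradient hui).1
      (Eventually.of_forall fun n => hψ.integrable_smul_gradient (hφi n)) ?_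
    have := ENNReal.Tendsto.const_mul (a := ENNReal.ofReal C) h1 (Or.inr ENNReal.ofReal_ne_top)
    rw [mul_zero] at this
    refine tendsto_of_tendsto_of_tendsto_of_le_of_le tendsto_const_nhds this
      (fun _ => zero_le) fun n => eLpNorm_le_mul_eLpNorm_of_ae_le_mul (ae_of_all _ fun x => ?_) 1
    simp only [Pi.sub_apply, ← sub_smul, norm_smul]
    rw [mul_comm]
    gcongr
    exact (hC x).2
  refine tendsto_nhds_unique lim1 (lim2.neg.congr fun n => ?_)
  rw [(h0 n).integral_smul_gradient hψ]

lemma weakGrad_ae_eq (S : Setting Ω p q μ) (h : InV Ω p q μ u G) :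
    weakGrad Ω u =ᵐ[volume.restrict Ω] G :=
  ((h.hasWeakGradient S).weakGrad).ae_eq S.isOpen (h.hasWeakGradient S)

lemma grad_ae_eq (S : Setting Ω p q μ) (hG : InV Ω p q μ u G) (hH : InV Ω p q μ v H)
    (huv : u =ᵐ[volume.restrict Ω] v) : G =ᵐ[volume.restrict Ω] H :=
  ((hG.congr huv (EventuallyEq.refl _ _)).hasWeakGradient S).ae_eq S.isOpen (hH.hasWeakGradient S)

end InV

lemma luxNorm_nonneg (p q : ℝ) (μ f : EuclideanSpace ℝ (Fin N) → ℝ) : 0 ≤ luxNorm Ω p q μ f :=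
  Real.sInf_nonneg fun _ hx => hx.1.le

namespace Setting

variable (S : Setting Ω p q μ)
include S

/-- Absorbing μ into the measure separates the two phases, so that statements about the modular
become statements about two Lebesgue norms. -/
lemma modular_eq {f : EuclideanSpace ℝ (Fin N) → ℝ}
    (hf : AEStronglyMeasurable f (volume.restrict Ω)) :
    modular Ω p q μ f = eLpNorm f (ENNReal.ofReal p) (volume.restrict Ω) ^ p +
      eLpNorm f (ENNReal.ofReal q) (wt Ω μ) ^ q := by
  rw [eLpNorm_rpow_eq_lintegral S.p_pos, eLpNorm_rpow_eq_lintegral S.q_pos,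
    S.lintegral_wt (hf.enorm.pow_const _), ← lintegral_add_left' (hf.enorm.pow_const _)]
  refine lintegral_congr_ae ?_
  filter_upwards [S.nonneg] with x hx
  have hp := S.p_pos
  have hq := S.q_pos
  rw [ENNReal.ofReal_add (by positivity) (by positivity), ENNReal.ofReal_mul hx,
    ← ENNReal.ofReal_rpow_of_nonneg (abs_nonneg _) hp.le,
    ← ENNReal.ofReal_rpow_of_nonneg (abs_nonneg _) hq.le, ← Real.norm_eq_abs, ofReal_norm]

lemma memLH_iff {f : EuclideanSpace ℝ (Fin N) → ℝ} :
    MemLH Ω p q μ f ↔ MemLp f (ENNReal.ofReal p) (volume.restrict Ω) ∧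
      MemLp f (ENNReal.ofReal q) (wt Ω μ) := by
  constructor
  · rintro ⟨h1, h2⟩
    rw [S.modular_eq h1, ENNReal.add_lt_top, ENNReal.rpow_lt_top_iff_of_pos S.p_pos,
      ENNReal.rpow_lt_top_iff_of_pos S.q_pos] at h2
    exact ⟨⟨h1, h2.1⟩, ⟨h1.mono_ac wt_ac, h2.2⟩⟩
  · rintro ⟨h1, h2⟩
    refine ⟨h1.1, ?_⟩
    rw [S.modular_eq h1.1, ENNReal.add_lt_top, ENNReal.rpow_lt_top_iff_of_pos S.p_pos,
      ENNReal.rpow_lt_top_iff_of_pos S.q_pos]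
    exact ⟨h1.2, h2.2⟩

lemma modular_div {f : EuclideanSpace ℝ (Fin N) → ℝ}
    (hf : AEStronglyMeasurable f (volume.restrict Ω)) {τ : ℝ} (hτ : 0 < τ) :
    modular Ω p q μ (fun x => f x / τ) =
      (eLpNorm f (ENNReal.ofReal p) (volume.restrict Ω) / ENNReal.ofReal τ) ^ p +
      (eLpNorm f (ENNReal.ofReal q) (wt Ω μ) / ENNReal.ofReal τ) ^ q := by
  have e : (fun x => f x / τ) = τ⁻¹ • f := by ext x; simp [div_eq_inv_mul]
  rw [e, S.modular_eq (hf.const_smul _), eLpNorm_const_smul, eLpNorm_const_smul,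
    Real.enorm_eq_ofReal (inv_nonneg.2 hτ.le), ENNReal.ofReal_inv_of_pos hτ, mul_comm,
    mul_comm _ (eLpNorm f (ENNReal.ofReal q) _), ← div_eq_mul_inv, ← div_eq_mul_inv]

/-- With norms at most τ/2, each phase contributes at most (1/2)^s ≤ 1/2, because both exponents
exceed 1. -/
lemma luxNorm_le {f : EuclideanSpace ℝ (Fin N) → ℝ}
    (hf : AEStronglyMeasurable f (volume.restrict Ω)) {τ : ℝ} (hτ : 0 < τ)
    (h1 : eLpNorm f (ENNReal.ofReal p) (volume.restrict Ω) ≤ ENNReal.ofReal (τ / 2))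
    (h2 : eLpNorm f (ENNReal.ofReal q) (wt Ω μ) ≤ ENNReal.ofReal (τ / 2)) :
    modular Ω p q μ (fun x => f x / τ) ≤ 1 := by
  rw [S.modular_div hf hτ]
  have hτ' : ENNReal.ofReal τ ≠ 0 := by simpa using hτ
  have key : ∀ {a : ℝ≥0∞} {s : ℝ}, 1 < s → a ≤ ENNReal.ofReal (τ / 2) →
      (a / ENNReal.ofReal τ) ^ s ≤ 2⁻¹ := by
    intro a s hs ha
    have h3 : a / ENNReal.ofReal τ ≤ 2⁻¹ := by
      rw [ENNReal.div_le_iff hτ' ENNReal.ofReal_ne_top]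
      refine ha.trans_eq ?_
      rw [ENNReal.ofReal_div_of_pos two_pos, ENNReal.ofReal_ofNat, mul_comm, div_eq_mul_inv]
    calc (a / ENNReal.ofReal τ) ^ s ≤ (2⁻¹ : ℝ≥0∞) ^ s := ENNReal.rpow_le_rpow h3 (by linarith)
      _ ≤ (2⁻¹ : ℝ≥0∞) ^ (1 : ℝ) :=
          ENNReal.rpow_le_rpow_of_exponent_ge (by simp) hs.le
      _ = 2⁻¹ := ENNReal.rpow_one _
  exact (add_le_add (key S.one_lt h1) (key S.one_lt_q h2)).trans_eq (ENNReal.inv_two_add_inv_two)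

lemma eLpNorm_le_of_luxNorm_lt {f : EuclideanSpace ℝ (Fin N) → ℝ}
    (h1 : MemLp f (ENNReal.ofReal p) (volume.restrict Ω))
    (h2 : MemLp f (ENNReal.ofReal q) (wt Ω μ)) {τ : ℝ}
    (h : luxNorm Ω p q μ f < τ) :
    eLpNorm f (ENNReal.ofReal p) (volume.restrict Ω) ≤ ENNReal.ofReal τ ∧
      eLpNorm f (ENNReal.ofReal q) (wt Ω μ) ≤ ENNReal.ofReal τ := by
  -- The infimum of the empty set of reals is 0, so an admissible τ must be exhibited before a
  -- smaller one can be extracted.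
  have hne : {τ : ℝ | 0 < τ ∧ modular Ω p q μ (fun x => f x / τ) ≤ 1}.Nonempty := by
    set T := (eLpNorm f (ENNReal.ofReal p) (volume.restrict Ω)).toReal +
      (eLpNorm f (ENNReal.ofReal q) (wt Ω μ)).toReal with hT
    have hT1 : 0 ≤ (eLpNorm f (ENNReal.ofReal p) (volume.restrict Ω)).toReal :=
      ENNReal.toReal_nonneg
    have hT2 : 0 ≤ (eLpNorm f (ENNReal.ofReal q) (wt Ω μ)).toReal := ENNReal.toReal_nonneg
    refine ⟨2 * T + 1, by positivity, S.luxNorm_le h1.1 (by positivity) ?_ ?_⟩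
    · rw [← ENNReal.ofReal_toReal h1.2.ne]
      exact ENNReal.ofReal_le_ofReal (by linarith)
    · rw [← ENNReal.ofReal_toReal h2.2.ne]
      exact ENNReal.ofReal_le_ofReal (by linarith)
  obtain ⟨t, ⟨ht0, ht⟩, htτ⟩ := exists_lt_of_csInf_lt hne h
  rw [S.modular_div h1.1 ht0] at ht
  have key : ∀ {a : ℝ≥0∞} {s : ℝ}, 1 < s → (a / ENNReal.ofReal t) ^ s ≤ 1 →
      a ≤ ENNReal.ofReal τ := by
    intro a s hs ha
    have h3 : a / ENNReal.ofReal t ≤ 1 := by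
      by_contra! h'
      exact absurd (ENNReal.one_lt_rpow h' (by linarith)) (not_lt.2 ha)
    rw [ENNReal.div_le_iff (by simpa using ht0) ENNReal.ofReal_ne_top, one_mul] at h3
    exact h3.trans (ENNReal.ofReal_le_ofReal htτ.le)
  exact ⟨key S.one_lt (le_self_add.trans ht), key S.one_lt_q (le_add_self.trans ht)⟩

/-- The Luxemburg norm dominates each of the two Lebesgue norms and is controlled by both together.
This converts convergence in W^{1,H} into the convergences that define `InV`. -/
lemma tendsto_luxNorm_iff {f : ℕ → EuclideanSpace ℝ (Fin N) → ℝ}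
    (h1 : ∀ n, MemLp (f n) (ENNReal.ofReal p) (volume.restrict Ω))
    (h2 : ∀ n, MemLp (f n) (ENNReal.ofReal q) (wt Ω μ)) :
    Tendsto (fun n => luxNorm Ω p q μ (f n)) atTop (𝓝 0) ↔
      Tendsto (fun n => eLpNorm (f n) (ENNReal.ofReal p) (volume.restrict Ω)) atTop (𝓝 0) ∧
      Tendsto (fun n => eLpNorm (f n) (ENNReal.ofReal q) (wt Ω μ)) atTop (𝓝 0) := by
  constructor
  · intro h
    have aux : ∀ ε : ℝ≥0∞, 0 < ε → ∀ᶠ n in atTop,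
        eLpNorm (f n) (ENNReal.ofReal p) (volume.restrict Ω) ≤ ε ∧
          eLpNorm (f n) (ENNReal.ofReal q) (wt Ω μ) ≤ ε := by
      intro ε hε
      obtain ⟨τ, hτ0, hτ⟩ : ∃ τ : ℝ, 0 < τ ∧ ENNReal.ofReal τ ≤ ε := by
        rcases eq_or_ne ε ⊤ with rfl | htop
        · exact ⟨1, one_pos, le_top⟩
        · exact ⟨ε.toReal, ENNReal.toReal_pos hε.ne' htop, ENNReal.ofReal_toReal_le⟩
      filter_upwards [h.eventually (gt_mem_nhds hτ0)] with n hn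
      have := S.eLpNorm_le_of_luxNorm_lt (h1 n) (h2 n) hn
      exact ⟨this.1.trans hτ, this.2.trans hτ⟩
    exact ⟨ENNReal.tendsto_nhds_zero.2 fun ε hε => (aux ε hε).mono fun _ h => h.1,
      ENNReal.tendsto_nhds_zero.2 fun ε hε => (aux ε hε).mono fun _ h => h.2⟩
  · rintro ⟨k1, k2⟩
    rw [Metric.tendsto_atTop']
    intro ε hε
    have hpos : 0 < ENNReal.ofReal (ε / 2 / 2) := ENNReal.ofReal_pos.2 (by positivity)
    obtain ⟨n, hn⟩ := eventually_atTop.1 ((k1.eventually (gt_mem_nhds hpos)).and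
      (k2.eventually (gt_mem_nhds hpos)))
    refine ⟨n, fun i hi => ?_⟩
    have h3 : luxNorm Ω p q μ (f i) ≤ ε / 2 := csInf_le ⟨0, fun x hx => hx.1.le⟩
      ⟨by positivity, S.luxNorm_le (h1 i).1 (by positivity) (hn i hi.le).1.le (hn i hi.le).2.le⟩
    rw [Real.dist_eq, sub_zero, abs_of_nonneg (luxNorm_nonneg _ _ _ _)]
    linarith

/-- The two descriptions of `W_0^{1,H}(Ω)` agree. -/
theorem inV_weakGrad {u : EuclideanSpace ℝ (Fin N) → ℝ} (hu : MemW1H0 Ω p q μ u) :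
    InV Ω p q μ u (weakGrad Ω u) := by
  have := S.finite
  have := S.finite_wt
  obtain ⟨⟨hu1, ⟨G, hG⟩, hu2⟩, φ, hφ, hlim⟩ := hu
  rw [S.memLH_iff] at hu1 hu2
  have hw := hG.weakGrad
  have hGm : AEStronglyMeasurable (weakGrad Ω u) (volume.restrict Ω) :=
    LocallyIntegrableOn.aestronglyMeasurable hw.2.1
  have hg1 : MemLp (weakGrad Ω u) (ENNReal.ofReal p) (volume.restrict Ω) :=
    (memLp_norm_iff hGm).1 hu2.1
  have hg2 : MemLp (weakGrad Ω u) (ENNReal.ofReal q) (wt Ω μ) :=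
    (memLp_norm_iff (hGm.mono_ac wt_ac)).1 hu2.2
  have hui : Integrable u (volume.restrict Ω) :=
    memLp_one_iff_integrable.1 (hu1.1.mono_exponent S.one_le_ofReal_p)
  have hgi : Integrable (weakGrad Ω u) (volume.restrict Ω) :=
    memLp_one_iff_integrable.1 (hg1.mono_exponent S.one_le_ofReal_p)
  -- `weakGrad` is an arbitrary choice of representative, so its additivity is only a.e. and rests
  -- on uniqueness of weak gradients.
  have hd : ∀ n, weakGrad Ω (fun x => u x - φ n x) =ᵐ[volume.restrict Ω]
      fun x => weakGrad Ω u x - gradient (φ n) x := fun n => by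
    have h1 := hw.sub ((hφ n).inV.hasWeakGradient S) hui hgi
      ((hφ n).inV (p := p) (q := q) (μ := μ)).integrable ((hφ n).inV.integrable_grad S)
    exact h1.weakGrad.ae_eq S.isOpen h1
  have hd1 : ∀ n, MemLp (weakGrad Ω (fun x => u x - φ n x)) (ENNReal.ofReal p)
      (volume.restrict Ω) := fun n =>
    (hg1.sub ((hφ n).memLp_gradient _ _)).ae_eq (hd n).symm
  have hd2 : ∀ n, MemLp (weakGrad Ω (fun x => u x - φ n x)) (ENNReal.ofReal q) (wt Ω μ) :=
    fun n => (hg2.sub ((hφ n).memLp_gradient _ _)).ae_eq (wt_ac.ae_eq (hd n)).symm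
  have l1 : Tendsto (fun n => luxNorm Ω p q μ (fun x => u x - φ n x)) atTop (𝓝 0) :=
    squeeze_zero (fun _ => luxNorm_nonneg _ _ _ _)
      (fun n => le_add_of_nonneg_left (luxNorm_nonneg _ _ _ _)) hlim
  have l2 : Tendsto (fun n => luxNorm Ω p q μ
      (fun x => ‖weakGrad Ω (fun x => u x - φ n x) x‖)) atTop (𝓝 0) :=
    squeeze_zero (fun _ => luxNorm_nonneg _ _ _ _)
      (fun n => le_add_of_nonneg_right (luxNorm_nonneg _ _ _ _)) hlim
  rw [S.tendsto_luxNorm_iff (f := fun n x => u x - φ n x) (fun n => hu1.1.sub ((hφ n).memLp _ _))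
    (fun n => hu1.2.sub ((hφ n).memLp _ _))] at l1
  rw [S.tendsto_luxNorm_iff (fun n => (hd1 n).norm) (fun n => (hd2 n).norm)] at l2
  simp only [eLpNorm_norm] at l2
  refine ⟨hui.1, hGm, φ, hφ, ?_, ?_, ?_⟩
  · refine (tendsto_eLpNorm_mono_exponent S.one_le_ofReal_p one_ne_zero
      (fun n => hui.1.sub (hφ n).continuous.aestronglyMeasurable) l1.1).congr fun n => ?_
    rw [eLpNorm_sub_comm]
  · refine l2.1.congr fun n => ?_
    rw [eLpNorm_congr_ae (hd n), eLpNorm_sub_comm]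
    rfl
  · refine l2.2.congr fun n => ?_
    rw [eLpNorm_congr_ae (wt_ac.ae_eq (hd n)), eLpNorm_sub_comm]
    rfl

/-- `InV` records only L¹ convergence of the functions themselves. The Sobolev inequality applied to
u - φ_n upgrades it to the critical exponent, and p < q < p^* with μ bounded then controls both
phases. -/
theorem memW1H0 {u : EuclideanSpace ℝ (Fin N) → ℝ}
    {G : EuclideanSpace ℝ (Fin N) → EuclideanSpace ℝ (Fin N)} (hu : InV Ω p q μ u G) :
    MemW1H0 Ω p q μ u := by
  have := S.finite
  have := S.finite_wt
  have mem : ∀ {u G}, InV Ω p q μ u G → MemW1H Ω p q μ u := fun {u G} hu => by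
    refine ⟨S.memLH_iff.2 ⟨S.memLp_of_le hu (S.lt.trans S.lt_crit).le,
      S.memLp_wt (S.memLp_of_le hu S.lt_crit.le)⟩, ⟨G, hu.hasWeakGradient S⟩, ?_⟩
    have hG := hu.weakGrad_ae_eq S
    exact S.memLH_iff.2 ⟨(hu.memLp_grad.ae_eq hG.symm).norm,
      ((hu.memLp_grad_wt S).ae_eq (wt_ac.ae_eq hG).symm).norm⟩
  refine ⟨mem hu, ?_⟩
  obtain ⟨φ, h0, h1, h2, h3⟩ := hu.approx
  refine ⟨φ, h0, ?_⟩
  have hdiff : ∀ n, InV Ω p q μ (u - φ n) (G - gradient (φ n)) := fun n => hu.sub S (h0 n).inV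
  obtain ⟨C, hC⟩ := S.exists_sobolev
  have hcrit : Tendsto (fun n => eLpNorm (u - φ n) (ENNReal.ofReal (N * p / (N - p)))
      (volume.restrict Ω)) atTop (𝓝 0) := by
    have := ENNReal.Tendsto.const_mul (a := (C : ℝ≥0∞)) h2 (Or.inr ENNReal.coe_ne_top)
    rw [mul_zero] at this
    refine tendsto_of_tendsto_of_tendsto_of_le_of_le tendsto_const_nhds this
      (fun _ => zero_le) fun n => (hC _ _ (hdiff n)).trans_eq ?_
    rw [eLpNorm_sub_comm]
  obtain ⟨c, hc, hle⟩ := S.exists_wt_le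
  have lp := tendsto_eLpNorm_mono_exponent (ENNReal.ofReal_le_ofReal (S.lt.trans S.lt_crit).le)
    (by simpa using S.p_pos) (fun n => (hdiff n).aesm) hcrit
  have lq := tendsto_eLpNorm_mono_exponent (ENNReal.ofReal_le_ofReal S.lt_crit.le)
    (by simpa using S.q_pos) (fun n => (hdiff n).aesm) hcrit
  have lq' : Tendsto (fun n => eLpNorm (u - φ n) (ENNReal.ofReal q) (wt Ω μ)) atTop (𝓝 0) := by
    have hx : c ^ (1 / ENNReal.ofReal q).toReal ≠ ⊤ :=
      ENNReal.rpow_ne_top_of_nonneg ENNReal.toReal_nonneg hc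
    have := ENNReal.Tendsto.const_mul lq (Or.inr hx)
    rw [mul_zero] at this
    refine tendsto_of_tendsto_of_tendsto_of_le_of_le tendsto_const_nhds this
      (fun _ => zero_le) fun n => (eLpNorm_mono_measure _ hle).trans_eq ?_
    rw [eLpNorm_smul_measure_of_ne_top (by simp), smul_eq_mul]
  have m1 : ∀ n, MemLp (u - φ n) (ENNReal.ofReal p) (volume.restrict Ω) := fun n =>
    S.memLp_of_le (hdiff n) (S.lt.trans S.lt_crit).le
  have m2 : ∀ n, MemLp (u - φ n) (ENNReal.ofReal q) (wt Ω μ) := fun n =>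
    S.memLp_wt (S.memLp_of_le (hdiff n) S.lt_crit.le)
  have hw := fun n => (hdiff n).weakGrad_ae_eq S
  have l1 := (S.tendsto_luxNorm_iff m1 m2).2 ⟨lp, lq'⟩
  have l2 : Tendsto (fun n => luxNorm Ω p q μ (fun x => ‖weakGrad Ω (u - φ n) x‖))
      atTop (𝓝 0) := by
    rw [S.tendsto_luxNorm_iff
      (fun n => ((hdiff n).memLp_grad.ae_eq (hw n).symm).norm)
      (fun n => (((hdiff n).memLp_grad_wt S).ae_eq (wt_ac.ae_eq (hw n)).symm).norm)]
    simp only [eLpNorm_norm]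
    constructor
    · refine h2.congr fun n => ?_
      rw [eLpNorm_congr_ae (hw n), eLpNorm_sub_comm]
    · refine h3.congr fun n => ?_
      rw [eLpNorm_congr_ae (wt_ac.ae_eq (hw n)), eLpNorm_sub_comm]
  have := l2.add l1
  rw [add_zero] at this
  exact this

end Setting

end

/-! ### Chain rule, absolute value and positive part. -/

section

variable {N : ℕ} {Ω : Set (EuclideanSpace ℝ (Fin N))} {p q : ℝ}
  {μ : EuclideanSpace ℝ (Fin N) → ℝ}

/-- Write c_n K_n - dG = c_n (K_n - G) + (c_n - d) G. The first term is small since c_n is bounded,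
the second by dominated convergence with majorant 2C‖G‖. -/
lemma tendsto_eLpNorm_smul_sub {α F : Type*} [MeasurableSpace α] {m : Measure α}
    [NormedAddCommGroup F] [NormedSpace ℝ F] {s : ℝ} (hs : 1 ≤ s) {C : ℝ}
    {c : ℕ → α → ℝ} {d : α → ℝ} {K : ℕ → α → F} {G : α → F}
    (hc : ∀ n, AEStronglyMeasurable (c n) m) (hd : AEStronglyMeasurable d m)
    (hcC : ∀ n x, |c n x| ≤ C) (hcd : ∀ᵐ x ∂m, Tendsto (fun n => c n x) atTop (𝓝 (d x)))
    (hK : ∀ n, AEStronglyMeasurable (K n) m) (hG : MemLp G (ENNReal.ofReal s) m)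
    (h : Tendsto (fun n => eLpNorm (K n - G) (ENNReal.ofReal s) m) atTop (𝓝 0)) :
    Tendsto (fun n => eLpNorm ((fun x => c n x • K n x) - fun x => d x • G x)
      (ENNReal.ofReal s) m) atTop (𝓝 0) := by
  have hs1 : 1 ≤ ENNReal.ofReal s := by simpa using ENNReal.ofReal_le_ofReal hs
  have h1 : Tendsto (fun n => eLpNorm (fun x => c n x • (K n - G) x) (ENNReal.ofReal s) m)
      atTop (𝓝 0) := by
    have := ENNReal.Tendsto.const_mul (a := ENNReal.ofReal C) h (Or.inr ENNReal.ofReal_ne_top)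
    rw [mul_zero] at this
    refine tendsto_of_tendsto_of_tendsto_of_le_of_le tendsto_const_nhds this
      (fun _ => zero_le) fun n => eLpNorm_le_mul_eLpNorm_of_ae_le_mul (ae_of_all _ fun x => ?_) _
    rw [norm_smul]
    gcongr
    exact hcC n x
  have h2 : Tendsto (fun n => eLpNorm (fun x => (c n x - d x) • G x) (ENNReal.ofReal s) m)
      atTop (𝓝 0) := by
    refine tendsto_eLpNorm_of_dominated (by linarith) (b := fun x => (2 * C) * ‖G x‖)
      (fun n => ((hc n).sub hd).smul hG.1) (hG.norm.const_mul _) (fun n => ?_) ?_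
    · filter_upwards [hcd] with x hx
      have e1 : |d x| ≤ C := le_of_tendsto hx.abs (Eventually.of_forall fun n => hcC n x)
      rw [norm_smul]
      gcongr
      exact (norm_sub_le _ _).trans (by rw [Real.norm_eq_abs, Real.norm_eq_abs]; linarith [hcC n x])
    · filter_upwards [hcd] with x hx
      simpa using (hx.sub_const (d x)).smul_const (G x)
  refine (tendsto_eLpNorm_add hs1 (fun n => (hc n).smul ((hK n).sub hG.1))
    (fun n => ((hc n).sub hd).smul hG.1) h1 h2).congr fun n => ?_
  congr 1
  ext1 x
  simp only [Pi.add_apply, Pi.sub_apply, smul_sub, sub_smul]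
  abel

namespace InV

variable {u v : EuclideanSpace ℝ (Fin N) → ℝ}
  {G H : EuclideanSpace ℝ (Fin N) → EuclideanSpace ℝ (Fin N)}

/-- The chain rule for smooth outer functions with bounded derivative. -/
lemma comp (S : Setting Ω p q μ) (hu : InV Ω p q μ u G) {T : ℝ → ℝ} (hT : ContDiff ℝ ∞ T)
    (hT0 : T 0 = 0) {C : ℝ} (hC : ∀ t, |deriv T t| ≤ C) :
    InV Ω p q μ (fun x => T (u x)) (fun x => deriv T (u x) • G x) := by
  obtain ⟨φ, h0, h1, h2, h3⟩ := hu.approx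
  obtain ⟨σ, hσ, hae⟩ := exists_subseq_ae_tendsto one_ne_zero
    (fun n => (h0 n).continuous.aestronglyMeasurable) hu.aesm h1
  have hTd : Continuous (deriv T) := hT.continuous_deriv (by simp)
  have hlip : ∀ a b, |T a - T b| ≤ C * |a - b| := fun a b => by
    simpa using convex_univ.norm_image_sub_le_of_norm_deriv_le
      (fun x _ => (hT.differentiable (by simp)).differentiableAt) (fun x _ => hC x)
      (Set.mem_univ b) (Set.mem_univ a)
  have hm : AEStronglyMeasurable (fun x => deriv T (u x)) (volume.restrict Ω) :=
    hTd.comp_aestronglyMeasurable hu.aesm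
  refine of_tendsto S (fun n => ((h0 (σ n)).comp hT hT0).inV)
    (hT.continuous.comp_aestronglyMeasurable hu.aesm) (hm.smul hu.aesm_grad) ?_ ?_ ?_
  · have := ENNReal.Tendsto.const_mul (a := ENNReal.ofReal C) (h1.comp hσ.tendsto_atTop)
      (Or.inr ENNReal.ofReal_ne_top)
    rw [mul_zero] at this
    refine tendsto_of_tendsto_of_tendsto_of_le_of_le tendsto_const_nhds this
      (fun _ => zero_le) fun n => eLpNorm_le_mul_eLpNorm_of_ae_le_mul (ae_of_all _ fun x => ?_) _
    exact hlip _ _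
  · simp only [(h0 _).gradient_comp hT]
    exact tendsto_eLpNorm_smul_sub S.one_lt.le
      (fun n => (hTd.comp (h0 _).continuous).aestronglyMeasurable) hm
      (fun n x => hC _) (hae.mono fun x hx => (hTd.tendsto _).comp hx)
      (fun n => (h0 _).continuous_gradient.aestronglyMeasurable) hu.memLp_grad
      (h2.comp hσ.tendsto_atTop)
  · simp only [(h0 _).gradient_comp hT]
    exact tendsto_eLpNorm_smul_sub S.one_lt_q.le
      (fun n => (hTd.comp (h0 _).continuous).aestronglyMeasurable) (hm.mono_ac wt_ac)
      (fun n x => hC _) (wt_ac.ae_le (hae.mono fun x hx => (hTd.tendsto _).comp hx))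
      (fun n => (h0 _).continuous_gradient.aestronglyMeasurable) (hu.memLp_grad_wt S)
      (h3.comp hσ.tendsto_atTop)

end InV

/-- A smooth approximation of the absolute value. -/
def smoothAbs (ε t : ℝ) : ℝ := √(t ^ 2 + ε ^ 2) - ε

section smoothAbs

variable {ε : ℝ} (hε : 0 < ε)
include hε

lemma contDiff_smoothAbs : ContDiff ℝ ∞ (smoothAbs ε) := by
  unfold smoothAbs
  refine ContDiff.sub (ContDiff.sqrt (by fun_prop) fun t => ?_) contDiff_const
  positivity

lemma smoothAbs_zero : smoothAbs ε 0 = 0 := by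
  simp [smoothAbs, Real.sqrt_sq hε.le]

lemma deriv_smoothAbs (t : ℝ) : deriv (smoothAbs ε) t = t / √(t ^ 2 + ε ^ 2) := by
  have h1 : HasDerivAt (fun t : ℝ => t ^ 2 + ε ^ 2) (2 * t) t := by
    simpa using (hasDerivAt_pow 2 t).add_const (ε ^ 2)
  have h2 := (h1.sqrt (by positivity)).sub_const ε
  rw [show deriv (smoothAbs ε) t = _ from h2.deriv]
  field_simp

lemma abs_deriv_smoothAbs_le (t : ℝ) : |deriv (smoothAbs ε) t| ≤ 1 := by
  rw [deriv_smoothAbs hε, abs_div, abs_of_nonneg (Real.sqrt_nonneg _)]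
  refine div_le_one_of_le₀ ?_ (Real.sqrt_nonneg _)
  rw [← Real.sqrt_sq_eq_abs]
  exact Real.sqrt_le_sqrt (by nlinarith)

lemma norm_smoothAbs_sub_le (t : ℝ) : ‖smoothAbs ε t - |t|‖ ≤ ε := by
  have h1 : |t| ≤ √(t ^ 2 + ε ^ 2) := by
    rw [← Real.sqrt_sq_eq_abs]; exact Real.sqrt_le_sqrt (by nlinarith)
  have h2 : √(t ^ 2 + ε ^ 2) ≤ |t| + ε := by
    rw [Real.sqrt_le_left (by positivity)]
    nlinarith [abs_nonneg t, sq_abs t]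
  unfold smoothAbs
  rw [Real.norm_eq_abs, abs_le]
  constructor <;> linarith

end smoothAbs

/-- The limit is the sign of t. At t = 0 both sides vanish, the right one by the convention 0/0 = 0.
-/
lemma tendsto_deriv_smoothAbs {ε : ℕ → ℝ} (hε0 : ∀ n, 0 < ε n)
    (hε : Tendsto ε atTop (𝓝 0)) (t : ℝ) :
    Tendsto (fun n => deriv (smoothAbs (ε n)) t) atTop (𝓝 (t / |t|)) := by
  simp_rw [fun n => deriv_smoothAbs (hε0 n) t]
  rcases eq_or_ne t 0 with rfl | ht
  · simp
  · have h1 : Tendsto (fun n => √(t ^ 2 + ε n ^ 2)) atTop (𝓝 |t|) := by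
      rw [← Real.sqrt_sq_eq_abs]
      have := (hε.pow 2).const_add (t ^ 2)
      simp only [ne_eq, OfNat.ofNat_ne_zero, not_false_eq_true, zero_pow, add_zero] at this
      exact this.sqrt
    exact tendsto_const_nhds.div h1 (abs_ne_zero.2 ht)

namespace InV

variable {u v : EuclideanSpace ℝ (Fin N) → ℝ}
  {G H : EuclideanSpace ℝ (Fin N) → EuclideanSpace ℝ (Fin N)}

/-- The smooth approximations converge uniformly to |t|, and their derivatives are bounded by 1 and
converge pointwise to the sign. Closedness of the space then gives the result. -/
lemma abs (S : Setting Ω p q μ) (hu : InV Ω p q μ u G) :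
    InV Ω p q μ (fun x => |u x|) (fun x => (u x / |u x|) • G x) := by
  have := S.finite
  set ε : ℕ → ℝ := fun n => 1 / ((n : ℝ) + 1) with hε
  have hε0 : ∀ n, 0 < ε n := fun n => by positivity
  have hεlim : Tendsto ε atTop (𝓝 0) := tendsto_one_div_add_atTop_nhds_zero_nat
  have hε1 : ∀ n, ε n ≤ 1 := fun n => by
    rw [hε]
    exact div_le_one_of_le₀ (by linarith [n.cast_nonneg (α := ℝ)]) (by positivity)
  have hm : AEStronglyMeasurable (fun x => u x / |u x|) (volume.restrict Ω) :=
    (hu.aesm.aemeasurable.div hu.aesm.norm.aemeasurable).aestronglyMeasurable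
  have hTd : ∀ n, Continuous (deriv (smoothAbs (ε n))) := fun n =>
    (contDiff_smoothAbs (hε0 n)).continuous_deriv (by simp)
  refine of_tendsto S (fun n => hu.comp S (contDiff_smoothAbs (hε0 n)) (smoothAbs_zero (hε0 n))
    (abs_deriv_smoothAbs_le (hε0 n))) hu.aesm.norm (hm.smul hu.aesm_grad) ?_ ?_ ?_
  · have := tendsto_eLpNorm_of_dominated (m := volume.restrict Ω) one_pos
      (f := fun n => (fun x => smoothAbs (ε n) (u x)) - fun x => |u x|) (b := fun _ => 1)
      (fun n => ((contDiff_smoothAbs (hε0 n)).continuous.comp_aestronglyMeasurable hu.aesm).sub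
        hu.aesm.norm) (memLp_const _)
      (fun n => ae_of_all _ fun x => (norm_smoothAbs_sub_le (hε0 n) _).trans (hε1 n))
      (ae_of_all _ fun x => squeeze_zero_norm (fun n => norm_smoothAbs_sub_le (hε0 n) _) hεlim)
    simpa using this
  · exact tendsto_eLpNorm_smul_sub S.one_lt.le
      (fun n => (hTd n).comp_aestronglyMeasurable hu.aesm) hm
      (fun n x => abs_deriv_smoothAbs_le (hε0 n) _)
      (ae_of_all _ fun x => tendsto_deriv_smoothAbs hε0 hεlim _)
      (fun n => hu.aesm_grad) hu.memLp_grad (by simp)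
  · exact tendsto_eLpNorm_smul_sub S.one_lt_q.le
      (fun n => (hTd n).comp_aestronglyMeasurable (hu.aesm.mono_ac wt_ac)) (hm.mono_ac wt_ac)
      (fun n x => abs_deriv_smoothAbs_le (hε0 n) _)
      (ae_of_all _ fun x => tendsto_deriv_smoothAbs hε0 hεlim _)
      (fun n => hu.aesm_wt) (hu.memLp_grad_wt S) (by simp)

/-- Half the sum of u and |u|. The gradient factor is 1 where u > 0, 0 where u < 0 and 1/2 where u =
0. -/
lemma posPart (S : Setting Ω p q μ) (hu : InV Ω p q μ u G) :
    InV Ω p q μ (fun x => max (u x) 0) (fun x => ((1 + u x / |u x|) / 2) • G x) := by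
  have := (hu.add S (hu.abs S)).smul 2⁻¹
  convert this using 1
  · ext x
    simp only [Pi.smul_apply, Pi.add_apply, smul_eq_mul]
    rcases le_total (u x) 0 with h | h
    · rw [max_eq_right h, abs_of_nonpos h]; ring
    · rw [max_eq_left h, abs_of_nonneg h]; ring
  · ext1 x
    simp only [Pi.smul_apply, Pi.add_apply]
    module

end InV

end

/-! ### Compactness and lower semicontinuity through uniform convexity. -/

section

section PowerIntegralConvergence

variable {α : Type*} [MeasurableSpace α] {m : Measure α}
  {F : Type*} [NormedAddCommGroup F]

lemma exists_tendsto_of_powInt_cauchy [CompleteSpace F] {s : ℝ} (hs : 1 ≤ s) {f : ℕ → α → F}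
    (hf : ∀ n, MemLp (f n) (ENNReal.ofReal s) m)
    (hc : ∀ η : ℝ, 0 < η → ∃ K, ∀ i ≥ K, ∀ j ≥ K, powInt s m (f i - f j) ≤ η) :
    ∃ g, MemLp g (ENNReal.ofReal s) m ∧
      Tendsto (fun n => eLpNorm (f n - g) (ENNReal.ofReal s) m) atTop (𝓝 0) := by
  have hs0 : 0 < s := by linarith
  refine exists_tendsto_eLpNorm_of_cauchy (by simpa using ENNReal.ofReal_le_ofReal hs) hf
    fun ε hε => ?_
  obtain ⟨τ, hτ0, hτ⟩ : ∃ τ : ℝ, 0 < τ ∧ ENNReal.ofReal τ ≤ ε := by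
    rcases eq_or_ne ε ⊤ with rfl | htop
    · exact ⟨1, one_pos, le_top⟩
    · exact ⟨ε.toReal, ENNReal.toReal_pos hε.ne' htop, ENNReal.ofReal_toReal_le⟩
  obtain ⟨K, hK⟩ := hc (τ ^ s) (Real.rpow_pos_of_pos hτ0 s)
  refine ⟨K, fun i hi j hj => le_trans ?_ hτ⟩
  rw [← ENNReal.rpow_le_rpow_iff hs0, eLpNorm_rpow_eq_lintegral hs0,
    lintegral_enorm_rpow_eq hs0 ((hf i).sub (hf j)), ENNReal.ofReal_rpow_of_nonneg hτ0.le hs0.le]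
  exact ENNReal.ofReal_le_ofReal (hK i hi j hj)

/-- The defect of convexity of `powInt` at the midpoint. -/
def midGap [NormedSpace ℝ F] (s : ℝ) (m : Measure α) (f g : α → F) : ℝ :=
  2⁻¹ * (powInt s m f + powInt s m g) - powInt s m ((2⁻¹ : ℝ) • (f + g))

lemma midGap_nonneg {F : Type*} [NormedAddCommGroup F] [InnerProductSpace ℝ F] {s : ℝ}
    (hs : 1 < s) {f g : α → F}
    (hf : MemLp f (ENNReal.ofReal s) m) (hg : MemLp g (ENNReal.ofReal s) m) :
    0 ≤ midGap s m f g := by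
  have hs0 : 0 < s := by linarith
  unfold midGap powInt
  rw [← integral_add (integrable_norm_rpow_of_memLp hs0 hf) (integrable_norm_rpow_of_memLp hs0 hg),
    ← integral_const_mul, sub_nonneg]
  refine integral_mono (integrable_norm_rpow_of_memLp hs0 ((hf.add hg).const_smul _))
    (((integrable_norm_rpow_of_memLp hs0 hf).add (integrable_norm_rpow_of_memLp hs0 hg)).const_mul
      _) fun x => midpoint_norm_rpow_le hs _ _

/-- The pointwise convexity inequality, integrated. As δ is arbitrary, bounded power integrals and
vanishing midpoint gaps together force a Cauchy sequence. -/
lemma exists_powInt_sub_le {F : Type*} [NormedAddCommGroup F] [InnerProductSpace ℝ F]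
    [FiniteDimensional ℝ F] {s δ : ℝ} (hs : 1 < s) (hδ : 0 < δ) :
    ∃ C : ℝ, 0 ≤ C ∧ ∀ f g : α → F, MemLp f (ENNReal.ofReal s) m → MemLp g (ENNReal.ofReal s) m →
      powInt s m (f - g) ≤ δ * (powInt s m f + powInt s m g) + C * midGap s m f g := by
  have hs0 : 0 < s := by linarith
  obtain ⟨C, hC0, hC⟩ := exists_norm_sub_rpow_le (F := F) hs hδ
  refine ⟨C, hC0, fun f g hf hg => ?_⟩
  have h1 := integrable_norm_rpow_of_memLp hs0 hf
  have h2 := integrable_norm_rpow_of_memLp hs0 hg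
  have h3 := integrable_norm_rpow_of_memLp hs0 ((hf.add hg).const_smul (2⁻¹ : ℝ))
  have h12 : Integrable (fun x => ‖f x‖ ^ s + ‖g x‖ ^ s) m := h1.add h2
  have h4 : Integrable (fun x => 2⁻¹ * (‖f x‖ ^ s + ‖g x‖ ^ s)) m := h12.const_mul _
  have h5 : Integrable (fun x => 2⁻¹ * (‖f x‖ ^ s + ‖g x‖ ^ s) -
      ‖((2⁻¹ : ℝ) • (f + g)) x‖ ^ s) m := h4.sub h3
  unfold midGap powInt
  rw [← integral_add h1 h2, ← integral_const_mul, ← integral_const_mul, ← integral_sub h4 h3,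
    ← integral_const_mul, ← integral_add (h12.const_mul _) (h5.const_mul _)]
  exact integral_mono (integrable_norm_rpow_of_memLp hs0 (hf.sub hg))
    ((h12.const_mul _).add (h5.const_mul _)) fun x => hC _ _

/-- For s < 1 the term Cx fails near 0, where the constant ε takes over. For s ≥ 1 it may fail at
infinity, where εx^t takes over. The threshold T solves T^s = ε in the first case and T^(s-t) = ε in
the second. -/
lemma exists_rpow_le {s t ε : ℝ} (hs : 0 < s) (hst : s < t) (hε : 0 < ε) :
    ∃ C : ℝ, 0 ≤ C ∧ ∀ x : ℝ, 0 ≤ x → x ^ s ≤ ε * (1 + x ^ t) + C * x := by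
  rcases lt_or_ge s 1 with h1 | h1
  · set T := ε ^ s⁻¹ with hT
    have hT0 : 0 < T := Real.rpow_pos_of_pos hε _
    refine ⟨T ^ (s - 1), by positivity, fun x hx => ?_⟩
    have hxt : 0 ≤ ε * x ^ t := by positivity
    rcases le_total x T with h | h
    · have : x ^ s ≤ ε := by
        calc x ^ s ≤ T ^ s := by gcongr
          _ = ε := by rw [hT, Real.rpow_inv_rpow hε.le hs.ne']
      have : 0 ≤ T ^ (s - 1) * x := by positivity
      linarith
    · have hx0 : 0 < x := hT0.trans_le h
      have : x ^ s ≤ T ^ (s - 1) * x := by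
        calc x ^ s = x ^ (s - 1) * x := by rw [← Real.rpow_add_one hx0.ne']; congr 1; ring
          _ ≤ T ^ (s - 1) * x := by
            gcongr ?_ * _
            exact Real.rpow_le_rpow_of_nonpos hT0 h (by linarith)
      linarith
  · set T := ε ^ (s - t)⁻¹ with hT
    have hT0 : 0 < T := Real.rpow_pos_of_pos hε _
    refine ⟨T ^ (s - 1), by positivity, fun x hx => ?_⟩
    have hxt : 0 ≤ ε * x ^ t := by positivity
    have hTx : 0 ≤ T ^ (s - 1) * x := by positivity
    rcases le_total x T with h | h
    · have : x ^ s ≤ T ^ (s - 1) * x := by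
        rcases hx.eq_or_lt with rfl | hx0
        · simp [Real.zero_rpow hs.ne']
        calc x ^ s = x ^ (s - 1) * x := by rw [← Real.rpow_add_one hx0.ne']; congr 1; ring
          _ ≤ T ^ (s - 1) * x := by
            gcongr ?_ * _
            exact Real.rpow_le_rpow hx h (by linarith)
      linarith
    · have hx0 : 0 < x := hT0.trans_le h
      have : x ^ s ≤ ε * x ^ t := by
        calc x ^ s = x ^ (s - t) * x ^ t := by rw [← Real.rpow_add hx0]; congr 1; ring
          _ ≤ T ^ (s - t) * x ^ t := by
            gcongr ?_ * _
            exact Real.rpow_le_rpow_of_nonpos hT0 h (by linarith)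
          _ = ε * x ^ t := by rw [hT, Real.rpow_inv_rpow hε.le (by linarith)]
      linarith

/-- Interpolation: convergence in `L¹` and boundedness in `Lᵗ` give convergence in `Lˢ`,
`0 < s < t`. -/
lemma tendsto_powInt_zero_of_bounded [IsFiniteMeasure m] {s t M : ℝ} (hs : 0 < s) (hst : s < t)
    (ht : 1 ≤ t) {f : ℕ → α → F} (hf : ∀ n, MemLp (f n) (ENNReal.ofReal t) m)
    (hM : ∀ n, powInt t m (f n) ≤ M)
    (h : Tendsto (fun n => eLpNorm (f n) 1 m) atTop (𝓝 0)) :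
    Tendsto (fun n => powInt s m (f n)) atTop (𝓝 0) := by
  have ht0 : 0 < t := by linarith
  have hf1 : ∀ n, MemLp (f n) 1 m := fun n =>
    (hf n).mono_exponent (by simpa using ENNReal.ofReal_le_ofReal ht)
  have h1 : Tendsto (fun n => ∫ x, ‖f n x‖ ∂m) atTop (𝓝 0) := by
    refine (tendsto_lpNorm_zero (fun n => (hf n).1) h).congr fun n => ?_
    rw [lpNorm_one_eq_integral_norm (hf n).1]
  have hM0 : 0 ≤ M := (powInt_nonneg _ _).trans (hM 0)
  rw [Metric.tendsto_atTop]
  intro η hη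
  set V := m.real Set.univ with hV
  have hV0 : 0 ≤ V := measureReal_nonneg
  -- The coefficient makes the contribution of the total mass and of the L^t bound at most η/2; the
  -- L¹ norm then only has to beat the fixed C.
  obtain ⟨C, hC0, hC⟩ := exists_rpow_le hs hst (show 0 < η / 2 / (V + M + 1) by positivity)
  obtain ⟨K, hK⟩ := Metric.tendsto_atTop.1 h1 (η / 2 / (C + 1)) (by positivity)
  refine ⟨K, fun n hn => ?_⟩
  have hI := hK n hn
  have hI0 : 0 ≤ ∫ x, ‖f n x‖ ∂m := integral_nonneg fun _ => norm_nonneg _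
  rw [Real.dist_eq, sub_zero, abs_of_nonneg hI0, lt_div_iff₀ (by positivity)] at hI
  have it := integrable_norm_rpow_of_memLp ht0 (hf n)
  have i1 : Integrable (fun x => ‖f n x‖) m := (memLp_one_iff_integrable.1 (hf1 n)).norm
  have i2 : Integrable (fun x => 1 + ‖f n x‖ ^ t) m := (integrable_const 1).add it
  have key : powInt s m (f n) ≤ η / 2 / (V + M + 1) * (V + powInt t m (f n)) +
      C * ∫ x, ‖f n x‖ ∂m := by
    have e : η / 2 / (V + M + 1) * (V + powInt t m (f n)) + C * ∫ x, ‖f n x‖ ∂m =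
        ∫ x, (η / 2 / (V + M + 1) * (1 + ‖f n x‖ ^ t) + C * ‖f n x‖) ∂m := by
      rw [integral_add (i2.const_mul _) (i1.const_mul _), integral_const_mul, integral_const_mul,
        integral_add (integrable_const 1) it]
      simp [powInt, hV]
    rw [e]
    exact integral_mono_of_nonneg (ae_of_all _ fun x => Real.rpow_nonneg (norm_nonneg _) _)
      ((i2.const_mul _).add (i1.const_mul _)) (ae_of_all _ fun x => hC _ (norm_nonneg _))
  rw [Real.dist_eq, sub_zero, abs_of_nonneg (powInt_nonneg _ _)]
  have h3 : η / 2 / (V + M + 1) * (V + powInt t m (f n)) ≤ η / 2 / (V + M + 1) * (V + M + 1) :=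
    mul_le_mul_of_nonneg_left (by linarith [hM n]) (by positivity)
  rw [div_mul_cancel₀ _ (by positivity)] at h3
  nlinarith

end PowerIntegralConvergence

variable {N : ℕ} {Ω : Set (EuclideanSpace ℝ (Fin N))} {p q : ℝ}
  {μ : EuclideanSpace ℝ (Fin N) → ℝ}

/-- The weighted energy `α ∫ |G|^p + β ∫ μ |G|^q`. -/
def gradEnergy (Ω : Set (EuclideanSpace ℝ (Fin N))) (p q : ℝ) (μ : EuclideanSpace ℝ (Fin N) → ℝ)
    (α β : ℝ) (G : EuclideanSpace ℝ (Fin N) → EuclideanSpace ℝ (Fin N)) : ℝ :=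
  α * powInt p (volume.restrict Ω) G + β * powInt q (wt Ω μ) G

lemma gradEnergy_nonneg {α β : ℝ} (hα : 0 ≤ α) (hβ : 0 ≤ β)
    (G : EuclideanSpace ℝ (Fin N) → EuclideanSpace ℝ (Fin N)) : 0 ≤ gradEnergy Ω p q μ α β G :=
  add_nonneg (mul_nonneg hα (powInt_nonneg _ _)) (mul_nonneg hβ (powInt_nonneg _ _))

namespace Setting

variable (S : Setting Ω p q μ)
include S

/-- Sequences that are Cauchy for both power integrals of the gradients converge. -/
lemma exists_tendsto_grad {H : ℕ → EuclideanSpace ℝ (Fin N) → EuclideanSpace ℝ (Fin N)}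
    (hm : ∀ n, MemLp (H n) (ENNReal.ofReal p) (volume.restrict Ω))
    (hm' : ∀ n, MemLp (H n) (ENNReal.ofReal q) (wt Ω μ))
    (hp : ∀ η : ℝ, 0 < η → ∃ K, ∀ i ≥ K, ∀ j ≥ K, powInt p (volume.restrict Ω) (H i - H j) ≤ η)
    (hq : ∀ η : ℝ, 0 < η → ∃ K, ∀ i ≥ K, ∀ j ≥ K, powInt q (wt Ω μ) (H i - H j) ≤ η) :
    ∃ G, AEStronglyMeasurable G (volume.restrict Ω) ∧
      Tendsto (fun n => eLpNorm (H n - G) (ENNReal.ofReal p) (volume.restrict Ω)) atTop (𝓝 0) ∧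
      Tendsto (fun n => eLpNorm (H n - G) (ENNReal.ofReal q) (wt Ω μ)) atTop (𝓝 0) := by
  obtain ⟨G, hG, h1⟩ := exists_tendsto_of_powInt_cauchy S.one_lt.le hm hp
  obtain ⟨G', hG', h2⟩ := exists_tendsto_of_powInt_cauchy S.one_lt_q.le hm' hq
  refine ⟨G, hG.1, h1, ?_⟩
  obtain ⟨σ, hσ, hae⟩ := exists_subseq_ae_tendsto (by simpa using S.p_pos)
    (fun n => (hm n).1) hG.1 h1
  obtain ⟨τ, hτ, hae'⟩ := exists_subseq_ae_tendsto (by simpa using S.q_pos)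
    (fun n => (hm' (σ n)).1) hG'.1 (h2.comp hσ.tendsto_atTop)
  -- The limits for the two measures agree, since a common subsequence converges to both almost
  -- everywhere for the weighted measure.
  have heq : G' =ᵐ[wt Ω μ] G := by
    filter_upwards [wt_ac.ae_le hae, hae'] with x hx hx'
    exact tendsto_nhds_unique hx' (hx.comp hτ.tendsto_atTop)
  refine h2.congr fun n => eLpNorm_congr_ae ((EventuallyEq.refl _ _).sub heq)

/-- Sublevel sets of the energy are closed with respect to `L¹` convergence. -/
theorem exists_inV_of_tendsto {α β c : ℝ} (hα : 0 < α) (hβ : 0 < β)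
    {u : ℕ → EuclideanSpace ℝ (Fin N) → ℝ}
    {G : ℕ → EuclideanSpace ℝ (Fin N) → EuclideanSpace ℝ (Fin N)}
    (hu : ∀ n, InV Ω p q μ (u n) (G n)) (hc : ∀ n, gradEnergy Ω p q μ α β (G n) ≤ c)
    {v : EuclideanSpace ℝ (Fin N) → ℝ} (hv : AEStronglyMeasurable v (volume.restrict Ω))
    (h : Tendsto (fun n => eLpNorm (u n - v) 1 (volume.restrict Ω)) atTop (𝓝 0)) :
    ∃ K, InV Ω p q μ v K ∧ gradEnergy Ω p q μ α β K ≤ c := by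
  -- Energies of elements within 1/(n+1) of v in L¹. Their infima d_n increase to some l ≤ c, and
  -- near-minimizers will be shown to have convergent gradients.
  set A : ℕ → Set ℝ := fun n => {e | ∃ w H, InV Ω p q μ w H ∧
    eLpNorm (w - v) 1 (volume.restrict Ω) ≤ ENNReal.ofReal (1 / ((n : ℝ) + 1)) ∧
    gradEnergy Ω p q μ α β H = e} with hA
  have hAbdd : ∀ n, BddBelow (A n) := fun n => ⟨0, by
    rintro _ ⟨w, H, -, -, rfl⟩
    exact gradEnergy_nonneg hα.le hβ.le H⟩
  have hne : ∀ n, ∃ e ∈ A n, e ≤ c := fun n => by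
    have hpos : 0 < ENNReal.ofReal (1 / ((n : ℝ) + 1)) := ENNReal.ofReal_pos.2 (by positivity)
    obtain ⟨k, hk⟩ := (h.eventually (gt_mem_nhds hpos)).exists
    exact ⟨_, ⟨u k, G k, hu k, hk.le, rfl⟩, hc k⟩
  have hanti : ∀ {i j : ℕ}, i ≤ j → A j ⊆ A i := by
    rintro i j hij _ ⟨w, H, h1, h2, rfl⟩
    refine ⟨w, H, h1, h2.trans (ENNReal.ofReal_le_ofReal ?_), rfl⟩
    exact one_div_le_one_div_of_le (by positivity) (by simpa using hij)
  set d : ℕ → ℝ := fun n => sInf (A n) with hd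
  have hdc : ∀ n, d n ≤ c := fun n => by
    obtain ⟨e, he, hec⟩ := hne n
    exact (csInf_le (hAbdd n) he).trans hec
  have hdm : Monotone d := fun i j hij =>
    csInf_le_csInf (hAbdd i) ⟨_, (hne j).choose_spec.1⟩ (hanti hij)
  have hdlim := tendsto_atTop_ciSup hdm ⟨c, by rintro _ ⟨n, rfl⟩; exact hdc n⟩
  set l := ⨆ n, d n with hl
  have hdl : ∀ n, d n ≤ l := fun n => le_ciSup ⟨c, by rintro _ ⟨n, rfl⟩; exact hdc n⟩ n
  have hchoose : ∀ n : ℕ, ∃ w H, InV Ω p q μ w H ∧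
      eLpNorm (w - v) 1 (volume.restrict Ω) ≤ ENNReal.ofReal (1 / ((n : ℝ) + 1)) ∧
      gradEnergy Ω p q μ α β H < d n + 1 / ((n : ℝ) + 1) := fun n => by
    obtain ⟨_, ⟨w, H, h1, h2, rfl⟩, h3⟩ := exists_lt_of_csInf_lt ⟨_, (hne n).choose_spec.1⟩
      (show sInf (A n) < d n + 1 / ((n : ℝ) + 1) from lt_add_of_pos_right _ (by positivity))
    exact ⟨w, H, h1, h2, h3⟩
  choose w H hw hwv hH using hchoose
  have hinv : ∀ {i j : ℕ}, i ≤ j → (1 : ℝ) / ((j : ℝ) + 1) ≤ 1 / ((i : ℝ) + 1) := fun hij =>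
    one_div_le_one_div_of_le (by positivity) (by simpa using hij)
  -- The L¹ ball is convex, so the midpoint competes for d_K, while both endpoints have energy at
  -- most l + 1/(K+1). The midpoint gap is therefore at most the difference, which tends to 0.
  have hgap : ∀ K i j : ℕ, K ≤ i → K ≤ j →
      α * midGap p (volume.restrict Ω) (H i) (H j) + β * midGap q (wt Ω μ) (H i) (H j) ≤
        l + 1 / ((K : ℝ) + 1) - d K := by
    intro K i j hi hj
    have hmid : d K ≤ gradEnergy Ω p q μ α β ((2⁻¹ : ℝ) • (H i + H j)) := by
      refine csInf_le (hAbdd K) ⟨(2⁻¹ : ℝ) • (w i + w j), _, ((hw i).add S (hw j)).smul _, ?_, rfl⟩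
      have e : (2⁻¹ : ℝ) • (w i + w j) - v = (2⁻¹ : ℝ) • ((w i - v) + (w j - v)) := by
        ext x; simp; ring
      rw [e, eLpNorm_const_smul]
      have h1 := eLpNorm_add_le ((hw i).aesm.sub hv) ((hw j).aesm.sub hv) (p := 1) le_rfl
      have h2 : ∀ i, K ≤ i → eLpNorm (w i - v) 1 (volume.restrict Ω) ≤
          ENNReal.ofReal (1 / ((K : ℝ) + 1)) := fun i hi =>
        (hwv i).trans (ENNReal.ofReal_le_ofReal (hinv hi))
      calc ‖(2⁻¹ : ℝ)‖ₑ * eLpNorm ((w i - v) + (w j - v)) 1 (volume.restrict Ω)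
          ≤ 2⁻¹ * (ENNReal.ofReal (1 / ((K : ℝ) + 1)) + ENNReal.ofReal (1 / ((K : ℝ) + 1))) := by
            gcongr
            · rw [Real.enorm_eq_ofReal (by norm_num), ENNReal.ofReal_inv_of_pos two_pos,
                ENNReal.ofReal_ofNat]
            · exact h1.trans (add_le_add (h2 i hi) (h2 j hj))
        _ = ENNReal.ofReal (1 / ((K : ℝ) + 1)) := by
            rw [← two_mul, ← mul_assoc, ENNReal.inv_mul_cancel (by simp) (by simp), one_mul]
    have hi' := (hH i).le.trans (add_le_add (hdl i) (hinv hi))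
    have hj' := (hH j).le.trans (add_le_add (hdl j) (hinv hj))
    unfold midGap
    unfold gradEnergy at hmid hi' hj'
    linarith
  have hgaplim : Tendsto (fun K : ℕ => l + 1 / ((K : ℝ) + 1) - d K) atTop (𝓝 0) := by
    have := (tendsto_one_div_add_atTop_nhds_zero_nat (𝕜 := ℝ)).const_add l |>.sub hdlim
    simpa using this
  have hHc : ∀ n, gradEnergy Ω p q μ α β (H n) ≤ c + 1 := fun n => by
    have h1 := hinv (Nat.zero_le n)
    simp only [Nat.cast_zero, zero_add, div_one] at h1
    linarith [hH n, hdc n]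
  -- Used for each phase separately, with κ its coefficient: gap and energy of the other phase are
  -- nonnegative and can be dropped. The shift to c + 2 keeps the denominator positive.
  have cauchy : ∀ {s κ : ℝ} {m : Measure (EuclideanSpace ℝ (Fin N))}, 1 < s → 0 < κ →
      (∀ n, MemLp (H n) (ENNReal.ofReal s) m) → (∀ n, κ * powInt s m (H n) ≤ c + 1) →
      (∀ K i j : ℕ, K ≤ i → K ≤ j → κ * midGap s m (H i) (H j) ≤ l + 1 / ((K : ℝ) + 1) - d K) →
      ∀ η : ℝ, 0 < η → ∃ K, ∀ i ≥ K, ∀ j ≥ K, powInt s m (H i - H j) ≤ η := by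
    intro s κ m hs hκ hm hb hg η hη
    have hc1 : 0 ≤ c + 1 := (mul_nonneg hκ.le (powInt_nonneg _ _)).trans (hb 0)
    have hc2 : 0 < c + 2 := by linarith
    obtain ⟨C, hC0, hC⟩ := exists_powInt_sub_le (m := m) (F := EuclideanSpace ℝ (Fin N)) hs
      (show 0 < η / 4 * κ / (c + 2) by positivity)
    obtain ⟨K, hK⟩ := (hgaplim.eventually (gt_mem_nhds
      (show 0 < η / 2 * κ / (C + 1) by positivity))).exists
    refine ⟨K, fun i hi j hj => (hC _ _ (hm i) (hm j)).trans ?_⟩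
    have h1 : η / 4 * κ / (c + 2) * (powInt s m (H i) + powInt s m (H j)) ≤ η / 2 := by
      have h2 := hb i
      have h3 := hb j
      rw [div_mul_eq_mul_div, div_le_iff₀ (by linarith)]
      nlinarith
    have h4 : C * midGap s m (H i) (H j) ≤ η / 2 := by
      have h5 := hg K i j hi hj
      have h6 := midGap_nonneg hs (hm i) (hm j)
      have h7 := (lt_div_iff₀ (by positivity)).1 (h5.trans_lt hK)
      have h8 : κ * (midGap s m (H i) (H j) * (C + 1)) ≤ κ * (η / 2) := by nlinarith
      have h9 := le_of_mul_le_mul_left h8 hκ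
      nlinarith
    linarith
  obtain ⟨L, hL, hL1, hL2⟩ := S.exists_tendsto_grad (fun n => (hw n).memLp_grad)
    (fun n => (hw n).memLp_grad_wt S)
    (cauchy S.one_lt hα (fun n => (hw n).memLp_grad)
      (fun n => (le_add_of_nonneg_right (mul_nonneg hβ.le (powInt_nonneg _ _))).trans (hHc n))
      fun K i j hi hj => (le_add_of_nonneg_right (mul_nonneg hβ.le
        (midGap_nonneg S.one_lt_q ((hw i).memLp_grad_wt S) ((hw j).memLp_grad_wt S)))).trans
          (hgap K i j hi hj))
    (cauchy S.one_lt_q hβ (fun n => (hw n).memLp_grad_wt S)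
      (fun n => (le_add_of_nonneg_left (mul_nonneg hα.le (powInt_nonneg _ _))).trans (hHc n))
      fun K i j hi hj => (le_add_of_nonneg_left (mul_nonneg hα.le
        (midGap_nonneg S.one_lt (hw i).memLp_grad (hw j).memLp_grad))).trans
          (hgap K i j hi hj))
  have hlim0 : Tendsto (fun n : ℕ => ENNReal.ofReal (1 / ((n : ℝ) + 1))) atTop (𝓝 0) := by
    have := ENNReal.tendsto_ofReal (tendsto_one_div_add_atTop_nhds_zero_nat (𝕜 := ℝ))
    rwa [ENNReal.ofReal_zero] at this
  have hInV : InV Ω p q μ v L := InV.of_tendsto S hw hv hL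
    (tendsto_of_tendsto_of_tendsto_of_le_of_le tendsto_const_nhds hlim0 (fun _ => zero_le) hwv)
    hL1 hL2
  refine ⟨L, hInV, ?_⟩
  have hElim : Tendsto (fun n => gradEnergy Ω p q μ α β (H n)) atTop
      (𝓝 (gradEnergy Ω p q μ α β L)) :=
    ((tendsto_powInt S.one_lt.le (fun n => (hw n).memLp_grad) hInV.memLp_grad hL1).const_mul _).add
      ((tendsto_powInt S.one_lt_q.le (fun n => (hw n).memLp_grad_wt S)
        (hInV.memLp_grad_wt S) hL2).const_mul _)
  have hclim : Tendsto (fun n : ℕ => c + 1 / ((n : ℝ) + 1)) atTop (𝓝 (c + 0)) :=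
    (tendsto_one_div_add_atTop_nhds_zero_nat (𝕜 := ℝ)).const_add c
  rw [add_zero] at hclim
  exact le_of_tendsto_of_tendsto' hElim hclim fun n => by linarith [hH n, hdc n]

/-- Rellich compactness. -/
lemma exists_subseq_tendsto {u : ℕ → EuclideanSpace ℝ (Fin N) → ℝ}
    {G : ℕ → EuclideanSpace ℝ (Fin N) → EuclideanSpace ℝ (Fin N)}
    (hu : ∀ n, InV Ω p q μ (u n) (G n)) {M : ℝ≥0∞} (hMtop : M ≠ ⊤)
    (hM : ∀ n, eLpNorm (G n) (ENNReal.ofReal p) (volume.restrict Ω) ≤ M) :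
    ∃ σ : ℕ → ℕ, StrictMono σ ∧ ∃ v, AEStronglyMeasurable v (volume.restrict Ω) ∧
      Tendsto (fun n => eLpNorm (u (σ n) - v) 1 (volume.restrict Ω)) atTop (𝓝 0) := by
  have := S.finite
  have hchoose : ∀ n : ℕ, ∃ φ, IsTestFunction Ω φ ∧
      eLpNorm (φ - u n) 1 (volume.restrict Ω) ≤ ENNReal.ofReal (1 / ((n : ℝ) + 1)) ∧
      eLpNorm (gradient φ - G n) (ENNReal.ofReal p) (volume.restrict Ω) ≤ 1 := fun n => by
    obtain ⟨φ, h0, h1, h2, -⟩ := (hu n).approx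
    have hpos : 0 < ENNReal.ofReal (1 / ((n : ℝ) + 1)) := ENNReal.ofReal_pos.2 (by positivity)
    obtain ⟨k, k1, k2⟩ := ((h1.eventually (gt_mem_nhds hpos)).and
      (h2.eventually (gt_mem_nhds one_pos))).exists
    exact ⟨φ k, h0 k, k1.le, k2.le⟩
  choose φ h0 h1 h2 using hchoose
  obtain ⟨C, hC⟩ := S.exists_sobolev
  have hg : ∀ n, eLpNorm (gradient (φ n)) (ENNReal.ofReal p) (volume.restrict Ω) ≤ 1 + M :=
    fun n => by
      have := eLpNorm_add_le ((h0 n).continuous_gradient.aestronglyMeasurable.sub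
        (hu n).aesm_grad) (hu n).aesm_grad S.one_le_ofReal_p
      rw [sub_add_cancel] at this
      exact this.trans (add_le_add (h2 n) (hM n))
  have hp1 : 1 ≤ ENNReal.ofReal (N * p / (N - p)) := by
    simpa using ENNReal.ofReal_le_ofReal S.one_lt_crit.le
  -- Hölder's inequality on Ω bounds the L¹ norms on the whole space, as test functions and their
  -- gradients vanish off Ω.
  have bound : ∀ {F : Type} [NormedAddCommGroup F] {f : EuclideanSpace ℝ (Fin N) → F} {s : ℝ}
      {B : ℝ≥0∞}, 1 ≤ s → Function.support f ⊆ Ω → AEStronglyMeasurable f (volume.restrict Ω) →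
      eLpNorm f (ENNReal.ofReal s) (volume.restrict Ω) ≤ B →
      ∫⁻ x, ‖f x‖ₑ ≤ B * volume Ω ^ (1 - 1 / s) := by
    intro F _ f s B hs hsupp hm hB
    rw [← eLpNorm_one_eq_lintegral_enorm, ← eLpNorm_restrict_eq_of_support_subset hsupp]
    refine (eLpNorm_le_eLpNorm_mul_rpow_measure_univ (q := ENNReal.ofReal s)
      (by simpa using ENNReal.ofReal_le_ofReal hs) hm).trans ?_
    rw [ENNReal.toReal_ofReal (by linarith)]
    simp only [ENNReal.toReal_one, div_one, Measure.restrict_apply_univ, one_div]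
    gcongr
  have hfin : ∀ {s : ℝ}, 1 ≤ s → volume Ω ^ (1 - 1 / s) ≠ ⊤ := fun hs =>
    ENNReal.rpow_ne_top_of_nonneg (sub_nonneg.2 (div_le_one_of_le₀ hs (by linarith)))
      S.volume_ne_top
  have b1 := fun n => bound (f := φ n) S.one_lt_crit.le
    (fun x hx => by by_contra h; exact hx ((h0 n).eq_zero h))
    (h0 n).continuous.aestronglyMeasurable
    ((hC _ _ (h0 n).inV).trans (mul_le_mul' le_rfl (hg n)))
  have b2 := fun n => bound (f := gradient (φ n)) S.one_lt.le
    (fun x hx => by by_contra h; exact hx ((h0 n).gradient_eq_zero h))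
    (h0 n).continuous_gradient.aestronglyMeasurable (hg n)
  have hM1 : 1 + M ≠ ⊤ := ENNReal.add_ne_top.2 ⟨by simp, hMtop⟩
  obtain ⟨σ, hσ, v, hv, hlim⟩ := IsTestFunction.exists_subseq_tendsto S.volume_ne_top h0
    (C := C * (1 + M) * volume Ω ^ (1 - 1 / (N * p / (N - p))) +
      (1 + M) * volume Ω ^ (1 - 1 / p))
    (ENNReal.add_ne_top.2 ⟨ENNReal.mul_ne_top (ENNReal.mul_ne_top ENNReal.coe_ne_top hM1)
      (hfin S.one_lt_crit.le), ENNReal.mul_ne_top hM1 (hfin S.one_lt.le)⟩)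
    (fun n => (b1 n).trans le_self_add) (fun n => (b2 n).trans le_add_self)
  refine ⟨σ, hσ, v, hv.1, ?_⟩
  have hlim0 : Tendsto (fun n : ℕ => ENNReal.ofReal (1 / ((n : ℝ) + 1))) atTop (𝓝 0) := by
    have := ENNReal.tendsto_ofReal (tendsto_one_div_add_atTop_nhds_zero_nat (𝕜 := ℝ))
    rwa [ENNReal.ofReal_zero] at this
  have h3 : Tendsto (fun n => eLpNorm (u n - φ n) 1 (volume.restrict Ω)) atTop (𝓝 0) := by
    simp_rw [fun n => eLpNorm_sub_comm (u n) (φ n)]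
    exact tendsto_of_tendsto_of_tendsto_of_le_of_le tendsto_const_nhds hlim0
      (fun _ => zero_le) h1
  simpa using tendsto_eLpNorm_add le_rfl
    (fun n => (hu (σ n)).aesm.sub (h0 (σ n)).continuous.aestronglyMeasurable)
    (fun n => (h0 (σ n)).continuous.aestronglyMeasurable.sub hv.1)
    (h3.comp hσ.tendsto_atTop) hlim

lemma powInt_crit_le : ∃ C : ℝ, 0 ≤ C ∧ ∀ u G, InV Ω p q μ u G →
    powInt (N * p / (N - p)) (volume.restrict Ω) u ≤
      C * powInt p (volume.restrict Ω) G ^ (N * p / (N - p) / p) := by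
  obtain ⟨C, hC⟩ := S.exists_sobolev
  have hc : 0 < N * p / (N - p) := by linarith [S.one_lt_crit]
  refine ⟨(C : ℝ) ^ (N * p / (N - p)), by positivity, fun u G hu => ?_⟩
  have h1 := ENNReal.toReal_mono (ENNReal.mul_ne_top ENNReal.coe_ne_top hu.memLp_grad.2.ne)
    (hC u G hu)
  rw [ENNReal.toReal_mul, toReal_eLpNorm hu.aesm, toReal_eLpNorm hu.aesm_grad,
    ENNReal.coe_toReal] at h1
  rw [powInt_eq_lpNorm hc hu.aesm, div_eq_inv_mul _ p, Real.rpow_mul (powInt_nonneg _ _),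
    ← lpNorm_eq_powInt S.p_pos hu.aesm_grad, ← Real.mul_rpow (by positivity) lpNorm_nonneg]
  exact Real.rpow_le_rpow lpNorm_nonneg h1 hc.le

/-- Compactness of energy-bounded sequences. -/
theorem compactness {u : ℕ → EuclideanSpace ℝ (Fin N) → ℝ}
    {G : ℕ → EuclideanSpace ℝ (Fin N) → EuclideanSpace ℝ (Fin N)}
    (hu : ∀ n, InV Ω p q μ (u n) (G n)) {M : ℝ}
    (hM : ∀ n, gradEnergy Ω p q μ 1 1 (G n) ≤ M) :
    ∃ σ : ℕ → ℕ, StrictMono σ ∧ ∃ v K, InV Ω p q μ v K ∧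
      (∀ s, 0 < s → s < N * p / (N - p) →
        Tendsto (fun n => powInt s (volume.restrict Ω) (u (σ n) - v)) atTop (𝓝 0)) ∧
      ∀ α β c, 0 < α → 0 < β → (∀ᶠ n in atTop, gradEnergy Ω p q μ α β (G (σ n)) ≤ c) →
        gradEnergy Ω p q μ α β K ≤ c := by
  have := S.finite
  have hMp : ∀ n, powInt p (volume.restrict Ω) (G n) ≤ M := fun n => by
    have := hM n
    unfold gradEnergy at this
    linarith [powInt_nonneg (m := wt Ω μ) q (G n)]
  have hM0 : 0 ≤ M := (powInt_nonneg _ _).trans (hMp 0)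
  have hMe : ∀ n, eLpNorm (G n) (ENNReal.ofReal p) (volume.restrict Ω) ≤
      ENNReal.ofReal (M ^ p⁻¹) := fun n => by
    rw [← ENNReal.rpow_le_rpow_iff S.p_pos, eLpNorm_rpow_eq_lintegral S.p_pos,
      lintegral_enorm_rpow_eq S.p_pos (hu n).memLp_grad,
      ENNReal.ofReal_rpow_of_nonneg (by positivity) S.p_pos.le,
      Real.rpow_inv_rpow hM0 S.p_pos.ne']
    exact ENNReal.ofReal_le_ofReal (hMp n)
  obtain ⟨σ, hσ, v, hv, hlim⟩ := S.exists_subseq_tendsto hu ENNReal.ofReal_ne_top hMe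
  obtain ⟨K, hK, -⟩ := S.exists_inV_of_tendsto one_pos one_pos (fun n => hu (σ n))
    (fun n => hM (σ n)) hv hlim
  refine ⟨σ, hσ, v, K, hK, fun s hs hsc => ?_, fun α β c hα hβ hc => ?_⟩
  · obtain ⟨C, hC⟩ := S.exists_sobolev
    have hd : ∀ n, InV Ω p q μ (u (σ n) - v) (G (σ n) - K) := fun n => (hu _).sub S hK
    have hc0 : 0 < N * p / (N - p) := by linarith [S.one_lt_crit]
    set B : ℝ≥0∞ := (C * (ENNReal.ofReal (M ^ p⁻¹) +
      eLpNorm K (ENNReal.ofReal p) (volume.restrict Ω))) ^ (N * p / (N - p)) with hB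
    have hBtop : B ≠ ⊤ := ENNReal.rpow_ne_top_of_nonneg hc0.le
      (ENNReal.mul_ne_top ENNReal.coe_ne_top
        (ENNReal.add_ne_top.2 ⟨ENNReal.ofReal_ne_top, hK.memLp_grad.2.ne⟩))
    refine tendsto_powInt_zero_of_bounded (M := B.toReal) hs hsc S.one_lt_crit.le
      (fun n => S.memLp_crit (hd n)) (fun n => ?_) hlim
    rw [← ENNReal.ofReal_le_iff_le_toReal hBtop, ← lintegral_enorm_rpow_eq hc0
      (S.memLp_crit (hd n)), ← eLpNorm_rpow_eq_lintegral hc0]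
    refine ENNReal.rpow_le_rpow ((hC _ _ (hd n)).trans ?_) hc0.le
    gcongr
    exact (eLpNorm_sub_le (hu _).aesm_grad hK.aesm_grad S.one_le_ofReal_p).trans
      (add_le_add (hMe _) le_rfl)
  · obtain ⟨n₀, hn₀⟩ := eventually_atTop.1 hc
    -- Closedness for the new weights is applied to a tail and yields a possibly different gradient,
    -- which uniqueness identifies with K almost everywhere.
    obtain ⟨K', hK', hE⟩ := S.exists_inV_of_tendsto hα hβ (fun n => hu (σ (n + n₀)))
      (fun n => hn₀ _ (Nat.le_add_left _ _)) hv (hlim.comp (tendsto_add_atTop_nat n₀))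
    have heq := hK.grad_ae_eq S hK' (EventuallyEq.refl _ _)
    unfold gradEnergy at hE ⊢
    rwa [powInt_congr_ae heq, powInt_congr_ae (wt_ac.ae_eq heq)]

end Setting

end

/-! ### The energy functional and its difference quotients. -/

section

variable {N : ℕ} {Ω : Set (EuclideanSpace ℝ (Fin N))} {p q r γ lam : ℝ}
  {μ a : EuclideanSpace ℝ (Fin N) → ℝ}

/-- The assumptions on the problem. -/
structure Data (Ω : Set (EuclideanSpace ℝ (Fin N))) (p q r γ : ℝ)
    (μ a : EuclideanSpace ℝ (Fin N) → ℝ) : Prop extends Setting Ω p q μ where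
  γ_pos : 0 < γ
  γ_lt : γ < 1
  q_lt_r : q < r
  r_lt_crit : r < N * p / (N - p)
  memLp_a : MemLp a ⊤ (volume.restrict Ω)
  a_pos : ∀ᵐ x ∂(volume.restrict Ω), 0 < a x

/-- The singular part `∫ a |u|^(1-γ)` of the energy. -/
def singInt (Ω : Set (EuclideanSpace ℝ (Fin N))) (γ : ℝ) (a u : EuclideanSpace ℝ (Fin N) → ℝ) :
    ℝ := ∫ x in Ω, a x * |u x| ^ (1 - γ)

/-- The energy functional on pairs `(u, ∇u)`. -/
def functional (Ω : Set (EuclideanSpace ℝ (Fin N))) (p q r γ lam : ℝ)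
    (μ a u : EuclideanSpace ℝ (Fin N) → ℝ)
    (G : EuclideanSpace ℝ (Fin N) → EuclideanSpace ℝ (Fin N)) : ℝ :=
  gradEnergy Ω p q μ (1 / p) (1 / q) G - 1 / (1 - γ) * singInt Ω γ a u
    - lam / r * powInt r (volume.restrict Ω) u

lemma gradEnergy_congr {α β : ℝ} {G H : EuclideanSpace ℝ (Fin N) → EuclideanSpace ℝ (Fin N)}
    (h : G =ᵐ[volume.restrict Ω] H) : gradEnergy Ω p q μ α β G = gradEnergy Ω p q μ α β H := by
  unfold gradEnergy
  rw [powInt_congr_ae h, powInt_congr_ae (wt_ac.ae_eq h)]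

lemma Setting.energy_eq (S : Setting Ω p q μ) {u : EuclideanSpace ℝ (Fin N) → ℝ}
    {G : EuclideanSpace ℝ (Fin N) → EuclideanSpace ℝ (Fin N)} (hu : InV Ω p q μ u G) :
    energy Ω p q r γ lam μ a u = functional Ω p q r γ lam μ a u G := by
  unfold functional
  rw [← gradEnergy_congr (hu.weakGrad_ae_eq S)]
  unfold energy gradEnergy powInt singInt
  rw [S.integral_wt]
  rfl

lemma tendsto_slope_seq {f : ℝ → ℝ} {f' : ℝ} (hf : HasDerivAt f f' 0) {ε : ℕ → ℝ}
    (hε0 : ∀ n, ε n ≠ 0) (hε : Tendsto ε atTop (𝓝 0)) :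
    Tendsto (fun n => (f (ε n) - f 0) / ε n) atTop (𝓝 f') := by
  have h1 : Tendsto ε atTop (𝓝[≠] 0) :=
    tendsto_nhdsWithin_iff.2 ⟨hε, Eventually.of_forall hε0⟩
  refine ((hasDerivAt_iff_tendsto_slope.1 hf).comp h1).congr fun n => ?_
  simp [slope_def_field]

lemma gradEnergy_smul {α β t : ℝ} (ht : 0 ≤ t)
    (G : EuclideanSpace ℝ (Fin N) → EuclideanSpace ℝ (Fin N)) :
    gradEnergy Ω p q μ α β (t • G) = gradEnergy Ω p q μ (α * t ^ p) (β * t ^ q) G := by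
  unfold gradEnergy
  have h1 := powInt_smul (m := volume.restrict Ω) (s := p) ht G
  have h2 := powInt_smul (m := wt Ω μ) (s := q) ht G
  rw [show t • G = fun x => t • G x from rfl, h1, h2]
  ring

lemma singInt_smul {t : ℝ} (ht : 0 ≤ t) (u : EuclideanSpace ℝ (Fin N) → ℝ) :
    singInt Ω γ a (t • u) = t ^ (1 - γ) * singInt Ω γ a u := by
  unfold singInt
  rw [← integral_const_mul]
  congr 1 with x
  rw [Pi.smul_apply, smul_eq_mul, abs_mul, abs_of_nonneg ht, Real.mul_rpow ht (abs_nonneg _)]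
  ring

lemma functional_smul {t : ℝ} (ht : 0 ≤ t) (u : EuclideanSpace ℝ (Fin N) → ℝ)
    (G : EuclideanSpace ℝ (Fin N) → EuclideanSpace ℝ (Fin N)) :
    functional Ω p q r γ lam μ a (t • u) (t • G) =
      1 / p * t ^ p * powInt p (volume.restrict Ω) G + 1 / q * t ^ q * powInt q (wt Ω μ) G
        - 1 / (1 - γ) * (t ^ (1 - γ) * singInt Ω γ a u)
        - lam / r * (t ^ r * powInt r (volume.restrict Ω) u) := by
  unfold functional
  rw [gradEnergy_smul ht, singInt_smul ht, show t • u = fun x => t • u x from rfl,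
    powInt_smul ht]
  rfl

/-- The pairing of the double phase operator at `G` with `H`. -/
def pairing (Ω : Set (EuclideanSpace ℝ (Fin N))) (p q : ℝ)
    (μ : EuclideanSpace ℝ (Fin N) → ℝ)
    (G H : EuclideanSpace ℝ (Fin N) → EuclideanSpace ℝ (Fin N)) : ℝ :=
  (∫ x in Ω, ‖G x‖ ^ (p - 2) * inner ℝ (G x) (H x)) +
    ∫ x, ‖G x‖ ^ (q - 2) * inner ℝ (G x) (H x) ∂(wt Ω μ)

namespace Data

variable (D : Data Ω p q r γ μ a)
include D

lemma one_lt_r : 1 < r := D.one_lt_q.trans D.q_lt_r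
lemma r_pos : 0 < r := by linarith [D.one_lt_r]
lemma one_sub_γ_pos : 0 < 1 - γ := by linarith [D.γ_lt]

lemma one_sub_γ_lt_p : 1 - γ < p := by linarith [D.γ_pos, D.one_lt]

variable {u v : EuclideanSpace ℝ (Fin N) → ℝ}
  {G H : EuclideanSpace ℝ (Fin N) → EuclideanSpace ℝ (Fin N)}

lemma memLp_r (hu : InV Ω p q μ u G) : MemLp u (ENNReal.ofReal r) (volume.restrict Ω) :=
  D.memLp_of_le hu D.r_lt_crit.le

lemma exists_a_bound : ∃ C : ℝ, 0 < C ∧ ∀ᵐ x ∂(volume.restrict Ω), |a x| ≤ C := by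
  have h0 : 0 ≤ lpNorm a ⊤ (volume.restrict Ω) := lpNorm_nonneg
  refine ⟨lpNorm a ⊤ (volume.restrict Ω) + 1, by linarith, ?_⟩
  filter_upwards [ae_le_lpNorm_exponent_top D.memLp_a] with x hx
  exact (hx.trans (by linarith))

lemma integrable_a_mul {f : EuclideanSpace ℝ (Fin N) → ℝ} (hf : Integrable f (volume.restrict Ω)) :
    Integrable (fun x => a x * f x) (volume.restrict Ω) := by
  obtain ⟨C, -, hC⟩ := D.exists_a_bound
  exact hf.bdd_mul D.memLp_a.1 hC

lemma integrable_rpow_one_sub (hu : InV Ω p q μ u G) :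
    Integrable (fun x => |u x| ^ (1 - γ)) (volume.restrict Ω) :=
  integrable_norm_rpow_of_memLp D.one_sub_γ_pos (D.memLp_of_le hu
    (by linarith [D.one_lt_crit, D.γ_pos]))

lemma integrable_sing (hu : InV Ω p q μ u G) :
    Integrable (fun x => a x * |u x| ^ (1 - γ)) (volume.restrict Ω) :=
  D.integrable_a_mul (D.integrable_rpow_one_sub hu)

lemma singInt_nonneg (u : EuclideanSpace ℝ (Fin N) → ℝ) : 0 ≤ singInt Ω γ a u :=
  integral_nonneg_of_ae (D.a_pos.mono fun _ hx => mul_nonneg hx.le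
    (Real.rpow_nonneg (abs_nonneg _) _))

/-- A sequence of difference quotients of the smooth part of the energy. -/
lemma tendsto_quotient (hu : InV Ω p q μ u G) (hv : InV Ω p q μ v H) {ε t : ℕ → ℝ}
    (hε0 : ∀ n, 0 < ε n) (hε : Tendsto ε atTop (𝓝 0)) (ht : Tendsto t atTop (𝓝 1)) :
    Tendsto (fun n => (gradEnergy Ω p q μ (1 / p * t n ^ p) (1 / q * t n ^ q) (G + ε n • H)
      - gradEnergy Ω p q μ (1 / p * t n ^ p) (1 / q * t n ^ q) G) / ε n
      - lam / r * (t n ^ r * ((powInt r (volume.restrict Ω) (u + ε n • v)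
        - powInt r (volume.restrict Ω) u) / ε n))) atTop
      (𝓝 (pairing Ω p q μ G H - lam * ∫ x in Ω, ‖u x‖ ^ (r - 2) * inner ℝ (u x) (v x))) := by
  have hp := D.p_pos
  have hq := D.q_pos
  have hr := D.r_pos
  have hne : ∀ n, ε n ≠ 0 := fun n => (hε0 n).ne'
  have k1 := tendsto_slope_seq (hasDerivAt_powInt D.one_lt hu.memLp_grad hv.memLp_grad).2 hne hε
  have k2 := tendsto_slope_seq (hasDerivAt_powInt D.one_lt_q (hu.memLp_grad_wt D.toSetting)
    (hv.memLp_grad_wt D.toSetting)).2 hne hε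
  have k3 := tendsto_slope_seq (hasDerivAt_powInt D.one_lt_r (D.memLp_r hu)
    (D.memLp_r hv)).2 hne hε
  -- The rescaling contributes only factors that tend to 1.
  have tp : ∀ s : ℝ, Tendsto (fun n => t n ^ s) atTop (𝓝 1) := fun s => by
    simpa using ht.rpow_const (p := s) (Or.inl one_ne_zero)
  simp only [zero_smul, add_zero] at k1 k2 k3
  have key := ((((tp p).const_mul (1 / p)).mul k1).add (((tp q).const_mul (1 / q)).mul k2)).sub
    (((tp r).mul k3).const_mul (lam / r))
  convert key using 1
  · ext n
    unfold gradEnergy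
    simp only [show ∀ n, G + ε n • H = fun x => G x + ε n • H x from fun _ => rfl,
      show ∀ n, u + ε n • v = fun x => u x + ε n • v x from fun _ => rfl]
    ring
  · unfold pairing
    congr 1
    field_simp

end Data

end

/-! ### One-sided minimality, the singular inequality, and positivity. -/

section

variable {N : ℕ} {Ω : Set (EuclideanSpace ℝ (Fin N))} {p q r γ lam : ℝ}
  {μ a : EuclideanSpace ℝ (Fin N) → ℝ}

/-- A one-sided minimality property of `u`: it does not decrease the energy to move from `u` in
a nonnegative direction, after a suitable rescaling that tends to `1`. -/
def IsDirMin (Ω : Set (EuclideanSpace ℝ (Fin N))) (p q r γ lam : ℝ)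
    (μ a u : EuclideanSpace ℝ (Fin N) → ℝ)
    (G : EuclideanSpace ℝ (Fin N) → EuclideanSpace ℝ (Fin N)) : Prop :=
  ∀ h H, InV Ω p q μ h H → (∀ᵐ x ∂(volume.restrict Ω), 0 ≤ h x) →
    ∃ ε t : ℕ → ℝ, (∀ n, 0 < ε n) ∧ Tendsto ε atTop (𝓝 0) ∧ (∀ n, 0 < t n) ∧
      Tendsto t atTop (𝓝 1) ∧ ∀ n, functional Ω p q r γ lam μ a (t n • u) (t n • G) ≤
        functional Ω p q r γ lam μ a (t n • (u + ε n • h)) (t n • (G + ε n • H))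

/-- The derivative of the smooth part of the energy. -/
def smoothDeriv (Ω : Set (EuclideanSpace ℝ (Fin N))) (p q r lam : ℝ)
    (μ u : EuclideanSpace ℝ (Fin N) → ℝ)
    (G : EuclideanSpace ℝ (Fin N) → EuclideanSpace ℝ (Fin N))
    (h : EuclideanSpace ℝ (Fin N) → ℝ)
    (H : EuclideanSpace ℝ (Fin N) → EuclideanSpace ℝ (Fin N)) : ℝ :=
  pairing Ω p q μ G H - lam * ∫ x in Ω, ‖u x‖ ^ (r - 2) * inner ℝ (u x) (h x)

lemma tendsto_sing_quotient {γ b c : ℝ} (hb : 0 < b) (hc : 0 ≤ c) (hγ : γ < 1)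
    {ε : ℕ → ℝ} (hε0 : ∀ n, 0 < ε n) (hε : Tendsto ε atTop (𝓝 0)) :
    Tendsto (fun n => (|b + ε n * c| ^ (1 - γ) - |b| ^ (1 - γ)) / ((1 - γ) * ε n)) atTop
      (𝓝 (b ^ (-γ) * c)) := by
  have h1 : HasDerivAt (fun s : ℝ => b + s * c) c 0 := by
    simpa using ((hasDerivAt_id (0 : ℝ)).mul_const c).const_add b
  have h2 := h1.rpow_const (p := 1 - γ) (Or.inl (by simpa using hb.ne'))
  have h3 := (tendsto_slope_seq h2 (fun n => (hε0 n).ne') hε).div_const (1 - γ)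
  have hγ' : 1 - γ ≠ 0 := by linarith
  convert h3 using 1
  · ext n
    have : 0 ≤ ε n * c := mul_nonneg (hε0 n).le hc
    rw [abs_of_nonneg (by linarith), abs_of_pos hb, zero_mul, add_zero, div_div, mul_comm (ε n) (1 - γ)]
  · congr 1
    rw [zero_mul, add_zero, show 1 - γ - 1 = -γ by ring]
    field_simp

/-- The quotient is a positive constant times ε^(-γ). This blow-up is what excludes zeros of the
solutions. -/
lemma tendsto_sing_quotient_zero {γ c : ℝ} (hc : 0 < c) (hγ0 : 0 < γ) (hγ : γ < 1)
    {ε : ℕ → ℝ} (hε0 : ∀ n, 0 < ε n) (hε : Tendsto ε atTop (𝓝 0)) :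
    Tendsto (fun n => (|ε n * c| ^ (1 - γ)) / ((1 - γ) * ε n)) atTop atTop := by
  have hγ' : 0 < 1 - γ := by linarith
  have e : ∀ n, (|ε n * c| ^ (1 - γ)) / ((1 - γ) * ε n) =
      (c ^ (1 - γ) / (1 - γ)) * ((ε n) ^ γ)⁻¹ := fun n => by
    have h := hε0 n
    rw [abs_of_pos (mul_pos h hc), Real.mul_rpow h.le hc.le, Real.rpow_sub h, Real.rpow_one]
    have := Real.rpow_pos_of_pos h γ
    field_simp
  simp_rw [e]
  refine Tendsto.const_mul_atTop (by positivity) (Tendsto.inv_tendsto_nhdsGT_zero ?_)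
  refine tendsto_nhdsWithin_iff.2 ⟨?_, Eventually.of_forall fun n => Real.rpow_pos_of_pos (hε0 n) _⟩
  have := hε.rpow_const (p := γ) (Or.inr hγ0.le)
  rwa [Real.zero_rpow hγ0.ne'] at this

namespace Data

variable (D : Data Ω p q r γ μ a)
include D

variable {u h : EuclideanSpace ℝ (Fin N) → ℝ}
  {G H : EuclideanSpace ℝ (Fin N) → EuclideanSpace ℝ (Fin N)}

/-- Dividing the minimality inequality by ε_n bounds the integrals of the nonnegative singular
quotients by quotients of the smooth part, which converge. Fatou's lemma gives both integrability
and the inequality. Where u = 0 < h the quotients tend to infinity, so finiteness of the Fatou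
integral makes that set null. -/
theorem sing_le (hu : InV Ω p q μ u G) (hu0 : ∀ᵐ x ∂(volume.restrict Ω), 0 ≤ u x)
    (hmin : IsDirMin Ω p q r γ lam μ a u G) (hh : InV Ω p q μ h H)
    (hh0 : ∀ᵐ x ∂(volume.restrict Ω), 0 ≤ h x) :
    (∀ᵐ x ∂(volume.restrict Ω), u x = 0 → h x = 0) ∧
    Integrable (fun x => a x * u x ^ (-γ) * h x) (volume.restrict Ω) ∧
    ∫ x in Ω, a x * u x ^ (-γ) * h x ≤ smoothDeriv Ω p q r lam μ u G h H := by
  obtain ⟨ε, t, hε0, hε, ht0, ht, hle⟩ := hmin h H hh hh0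
  have hγ' := D.one_sub_γ_pos
  have hw : ∀ n, InV Ω p q μ (u + ε n • h) (G + ε n • H) := fun n =>
    hu.add D.toSetting (hh.smul (ε n))
  have hquot := D.tendsto_quotient (lam := lam) hu hh hε0 hε ht
  set Q : ℕ → ℝ := fun n =>
    (gradEnergy Ω p q μ (1 / p * t n ^ p) (1 / q * t n ^ q) (G + ε n • H)
      - gradEnergy Ω p q μ (1 / p * t n ^ p) (1 / q * t n ^ q) G) / ε n
      - lam / r * (t n ^ r * ((powInt r (volume.restrict Ω) (u + ε n • h)
        - powInt r (volume.restrict Ω) u) / ε n)) with hQ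
  set g : ℕ → EuclideanSpace ℝ (Fin N) → ℝ := fun n x =>
    a x * ((|u x + ε n * h x| ^ (1 - γ) - |u x| ^ (1 - γ)) / ((1 - γ) * ε n)) with hg
  have hgi : ∀ n, Integrable (g n) (volume.restrict Ω) := fun n => by
    refine D.integrable_a_mul (Integrable.div_const ?_ _)
    exact (D.integrable_rpow_one_sub (hw n)).sub (D.integrable_rpow_one_sub hu)
  have hgI : ∀ n, ∫ x in Ω, g n x =
      (singInt Ω γ a (u + ε n • h) - singInt Ω γ a u) / ((1 - γ) * ε n) := fun n => by
    unfold singInt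
    rw [← integral_sub (D.integrable_sing (hw n)) (D.integrable_sing hu), ← integral_div]
    congr 1 with x
    simp only [hg, Pi.add_apply, Pi.smul_apply, smul_eq_mul]
    ring
  -- Minimality along the rescaled directions; t_n^(1-γ) is the factor that the singular term
  -- acquires.
  have hgle : ∀ n, t n ^ (1 - γ) * ∫ x in Ω, g n x ≤ Q n := fun n => by
    have h1 := hle n
    have hr := D.r_pos
    unfold functional at h1
    rw [gradEnergy_smul (ht0 n).le, gradEnergy_smul (ht0 n).le, singInt_smul (ht0 n).le,
      singInt_smul (ht0 n).le, show t n • u = fun x => t n • u x from rfl,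
      show t n • (u + ε n • h) = fun x => t n • (u + ε n • h) x from rfl,
      powInt_smul (ht0 n).le, powInt_smul (ht0 n).le] at h1
    rw [hgI, hQ]
    have e1 : t n ^ (1 - γ) * ((singInt Ω γ a (u + ε n • h) - singInt Ω γ a u) /
        ((1 - γ) * ε n)) = (1 / (1 - γ) * (t n ^ (1 - γ) * singInt Ω γ a (u + ε n • h)) -
          1 / (1 - γ) * (t n ^ (1 - γ) * singInt Ω γ a u)) / ε n := by
      have := (hε0 n).ne'
      field_simp
    rw [e1]
    simp only
    rw [← mul_div_assoc, ← mul_div_assoc, ← sub_div]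
    refine div_le_div_of_nonneg_right ?_ (hε0 n).le
    linarith
  have hg0 : ∀ᵐ x ∂(volume.restrict Ω), ∀ n, 0 ≤ g n x := by
    filter_upwards [hu0, hh0, D.a_pos] with x hx hx' hax n
    have h1 : 0 ≤ ε n * h x := mul_nonneg (hε0 n).le hx'
    refine mul_nonneg hax.le (div_nonneg (sub_nonneg.2 ?_) (mul_pos hγ' (hε0 n)).le)
    rw [abs_of_nonneg hx, abs_of_nonneg (add_nonneg hx h1)]
    exact Real.rpow_le_rpow hx (by linarith) hγ'.le
  have hgI0 : ∀ n, 0 ≤ ∫ x in Ω, g n x := fun n =>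
    integral_nonneg_of_ae (hg0.mono fun x hx => hx n)
  have htp : Tendsto (fun n => t n ^ (1 - γ)) atTop (𝓝 1) := by
    simpa using ht.rpow_const (p := 1 - γ) (Or.inl one_ne_zero)
  have hD0 : 0 ≤ smoothDeriv Ω p q r lam μ u G h H :=
    ge_of_tendsto' hquot fun n =>
      (mul_nonneg (Real.rpow_nonneg (ht0 n).le _) (hgI0 n)).trans (hgle n)
  have hlim : Tendsto (fun n => ENNReal.ofReal (Q n / t n ^ (1 - γ))) atTop
      (𝓝 (ENNReal.ofReal (smoothDeriv Ω p q r lam μ u G h H))) := by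
    refine ENNReal.tendsto_ofReal ?_
    have := hquot.div htp one_ne_zero
    rw [div_one] at this
    exact this
  have hFatou : ∫⁻ x in Ω, liminf (fun n => ENNReal.ofReal (g n x)) atTop ≤
      ENNReal.ofReal (smoothDeriv Ω p q r lam μ u G h H) := by
    refine (lintegral_liminf_le' fun n => (hgi n).1.aemeasurable.ennreal_ofReal).trans ?_
    rw [← hlim.liminf_eq]
    refine liminf_le_liminf (Eventually.of_forall fun n => ?_)
    rw [← ofReal_integral_eq_lintegral_ofReal (hgi n) (hg0.mono fun x hx => hx n)]
    refine ENNReal.ofReal_le_ofReal ?_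
    rw [le_div_iff₀ (Real.rpow_pos_of_pos (ht0 n) _), mul_comm]
    exact hgle n
  have hzero : ∀ᵐ x ∂(volume.restrict Ω), u x = 0 → h x = 0 := by
    have hfin := ae_lt_top' (f := fun x => liminf (fun n => ENNReal.ofReal (g n x)) atTop) (by
      simp_rw [liminf_eq_iSup_iInf_of_nat']
      exact AEMeasurable.iSup fun n => AEMeasurable.iInf fun i =>
        (hgi (i + n)).1.aemeasurable.ennreal_ofReal)
      (hFatou.trans_lt ENNReal.ofReal_lt_top).ne
    filter_upwards [hfin, hh0, D.a_pos] with x hx hx' hax hux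
    by_contra hne
    have hpos : 0 < h x := lt_of_le_of_ne hx' (Ne.symm hne)
    refine hx.ne (Tendsto.liminf_eq (ENNReal.tendsto_ofReal_atTop.comp ?_))
    have := (tendsto_sing_quotient_zero hpos D.γ_pos D.γ_lt hε0 hε).const_mul_atTop hax
    refine this.congr fun n => ?_
    simp [hg, hux, Real.zero_rpow hγ'.ne']
  have hm : AEStronglyMeasurable (fun x => a x * u x ^ (-γ) * h x) (volume.restrict Ω) :=
    (D.memLp_a.1.mul (hu.aesm.aemeasurable.pow_const _).aestronglyMeasurable).mul hh.aesm
  have hnn : ∀ᵐ x ∂(volume.restrict Ω), 0 ≤ a x * u x ^ (-γ) * h x := by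
    filter_upwards [hu0, hh0, D.a_pos] with x h1 h2 h3
    exact mul_nonneg (mul_nonneg h3.le (Real.rpow_nonneg h1 _)) h2
  have hle2 : ∫⁻ x in Ω, ENNReal.ofReal (a x * u x ^ (-γ) * h x) ≤
      ENNReal.ofReal (smoothDeriv Ω p q r lam μ u G h H) := by
    refine le_trans (lintegral_mono_ae ?_) hFatou
    -- Where u > 0 the quotient converges to the integrand. Where u = 0 also h = 0, and the
    -- integrand vanishes.
    filter_upwards [hu0, hh0, hzero] with x h1 h2 h3
    rcases h1.eq_or_lt with h4 | h4
    · simp [h3 h4.symm]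
    · refine (Tendsto.liminf_eq (ENNReal.tendsto_ofReal ?_)).ge
      have := (tendsto_sing_quotient h4 h2 D.γ_lt hε0 hε).const_mul (a x)
      rwa [← mul_assoc] at this
  refine ⟨hzero, ⟨hm, ?_⟩, ?_⟩
  · rw [hasFiniteIntegral_iff_ofReal hnn]
    exact hle2.trans_lt ENNReal.ofReal_lt_top
  · rw [integral_eq_lintegral_of_nonneg_ae hnn hm]
    exact ENNReal.toReal_le_of_le_ofReal hD0 hle2

/-- Testing with a bump function that is positive near a given point shows that the zero set is null
near that point, and a locally null set is null. -/
lemma ae_pos (hu : InV Ω p q μ u G) (hu0 : ∀ᵐ x ∂(volume.restrict Ω), 0 ≤ u x)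
    (hmin : IsDirMin Ω p q r γ lam μ a u G) : ∀ᵐ x ∂(volume.restrict Ω), 0 < u x := by
  rw [ae_restrict_iff' D.isOpen.measurableSet] at hu0 ⊢
  have hnull : volume {x | x ∈ Ω ∧ u x = 0} = 0 := by
    refine measure_null_of_locally_null _ fun x hx => ?_
    obtain ⟨δ, hδ, hball⟩ := Metric.isOpen_iff.1 D.isOpen x hx.1
    set f : ContDiffBump x := ⟨δ / 4, δ / 2, by positivity, by linarith⟩ with hf
    have htest : IsTestFunction Ω f := by
      refine ⟨f.contDiff, f.hasCompactSupport, ?_⟩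
      rw [f.tsupport_eq]
      exact (Metric.closedBall_subset_ball (by simp [hf]; linarith)).trans hball
    have h1 := (D.sing_le hu ((ae_restrict_iff' D.isOpen.measurableSet).2 hu0) hmin
      (htest.inV (p := p) (q := q) (μ := μ)) (ae_of_all _ fun _ => f.nonneg)).1
    rw [ae_restrict_iff' D.isOpen.measurableSet] at h1
    refine ⟨{y | y ∈ Ω ∧ u y = 0} ∩ Metric.ball x (δ / 2),
      inter_mem_nhdsWithin _ (Metric.ball_mem_nhds x (by positivity)), ?_⟩
    refine measure_mono_null (fun y hy => ?_) h1
    intro hcon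
    exact (f.pos_of_mem_ball hy.2).ne' (hcon hy.1.1 hy.1.2)
  filter_upwards [hu0, compl_mem_ae_iff.2 hnull] with x h1 h2 hx
  exact lt_of_le_of_ne (h1 hx) fun h3 => h2 ⟨hx, h3.symm⟩

end Data

end

/-! ### From the one-sided inequality to the weak formulation. -/

section

variable {N : ℕ} {Ω : Set (EuclideanSpace ℝ (Fin N))} {p q r γ lam : ℝ}
  {μ a : EuclideanSpace ℝ (Fin N) → ℝ}

/-- The defect of the weak formulation at `u`, tested with `h`. -/
def defect (Ω : Set (EuclideanSpace ℝ (Fin N))) (p q r γ lam : ℝ)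
    (μ a u : EuclideanSpace ℝ (Fin N) → ℝ)
    (G : EuclideanSpace ℝ (Fin N) → EuclideanSpace ℝ (Fin N))
    (h : EuclideanSpace ℝ (Fin N) → ℝ)
    (H : EuclideanSpace ℝ (Fin N) → EuclideanSpace ℝ (Fin N)) : ℝ :=
  smoothDeriv Ω p q r lam μ u G h H - ∫ x in Ω, a x * u x ^ (-γ) * h x

lemma half_one_add_div_abs_mem (t : ℝ) : 0 ≤ (1 + t / |t|) / 2 ∧ (1 + t / |t|) / 2 ≤ 1 := by
  rcases lt_trichotomy t 0 with h | rfl | h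
  · rw [abs_of_neg h, div_neg, div_self h.ne]; norm_num
  · norm_num
  · rw [abs_of_pos h, div_self h.ne']; norm_num

/-- The part of a power pairing in which the test function exceeds `k u` is asymptotically
nonpositive. -/
lemma exists_tendsto_truncated_pairing {s : ℝ} (hs : 1 < s)
    {m : Measure (EuclideanSpace ℝ (Fin N))}
    {u h : EuclideanSpace ℝ (Fin N) → ℝ}
    {G H : EuclideanSpace ℝ (Fin N) → EuclideanSpace ℝ (Fin N)}
    (hum : AEStronglyMeasurable u m) (hhm : AEStronglyMeasurable h m)
    (hG : MemLp G (ENNReal.ofReal s) m) (hH : MemLp H (ENNReal.ofReal s) m)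
    (hpos : ∀ᵐ x ∂m, 0 < u x) :
    ∃ b : ℕ → ℝ, Tendsto b atTop (𝓝 0) ∧ ∀ k : ℕ,
      ∫ x, ‖G x‖ ^ (s - 2) * inner ℝ (G x)
        (((1 + (h x - k * u x) / |h x - k * u x|) / 2) • (H x - (k : ℝ) • G x)) ∂m ≤ b k := by
  have hI := (hasDerivAt_powInt hs hG hH).1
  have hII := (hasDerivAt_powInt hs hG hG).1
  -- Essentially the indicator of {h > ku}, with value 1/2 on {h = ku}, as it occurs in the gradient
  -- of the positive part of h - ku.
  set κ : ℕ → EuclideanSpace ℝ (Fin N) → ℝ := fun k x =>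
    (1 + (h x - k * u x) / |h x - k * u x|) / 2 with hκ
  have hκ0 : ∀ k x, 0 ≤ κ k x := fun k x => (half_one_add_div_abs_mem _).1
  have hκ1 : ∀ k x, κ k x ≤ 1 := fun k x => (half_one_add_div_abs_mem _).2
  have hκn : ∀ k x, ‖κ k x‖ ≤ 1 := fun k x => by
    rw [Real.norm_of_nonneg (hκ0 k x)]; exact hκ1 k x
  have hκm : ∀ k, AEStronglyMeasurable (κ k) m := fun k => by
    have h1 : AEStronglyMeasurable (fun x => h x - k * u x) m :=
      hhm.sub (hum.const_mul (k : ℝ))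
    exact (((h1.aemeasurable.div h1.norm.aemeasurable).const_add 1).div_const 2).aestronglyMeasurable
  -- The part of the pairing along -kG has a favourable sign and is dropped. The rest tends to 0 by
  -- dominated convergence: since u > 0, each point eventually leaves {h ≥ ku}.
  refine ⟨fun k => ∫ x, κ k x * (‖G x‖ ^ (s - 2) * inner ℝ (G x) (H x)) ∂m, ?_, fun k => ?_⟩
  · have := tendsto_integral_of_dominated_convergence (μ := m)
      (F := fun k x => κ k x * (‖G x‖ ^ (s - 2) * inner ℝ (G x) (H x))) (f := fun _ => 0)
      (fun x => ‖‖G x‖ ^ (s - 2) * inner ℝ (G x) (H x)‖) (fun k => (hκm k).mul hI.1) hI.norm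
      (fun k => ae_of_all _ fun x => ?_) ?_
    · simpa using this
    · rw [norm_mul]
      exact mul_le_of_le_one_left (norm_nonneg _) (hκn k x)
    · filter_upwards [hpos] with x hx
      obtain ⟨k₀, hk₀⟩ := exists_nat_gt (h x / u x)
      refine tendsto_const_nhds.congr' ?_
      filter_upwards [eventually_ge_atTop k₀] with k hk
      have h1 : h x - k * u x < 0 := by
        rw [div_lt_iff₀ hx] at hk₀
        have : (k₀ : ℝ) * u x ≤ k * u x := by gcongr
        linarith
      have : κ k x = 0 := by
        simp only [hκ]
        rw [abs_of_neg h1, div_neg, div_self h1.ne]; norm_num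
      rw [this, zero_mul]
  · have e : ∀ x, ‖G x‖ ^ (s - 2) * inner ℝ (G x) (κ k x • (H x - (k : ℝ) • G x)) =
        κ k x * (‖G x‖ ^ (s - 2) * inner ℝ (G x) (H x)) -
          k * (κ k x * (‖G x‖ ^ (s - 2) * inner ℝ (G x) (G x))) := fun x => by
      rw [inner_smul_right, inner_sub_right, inner_smul_right]; ring
    have i1 := hI.bdd_mul (hκm k) (ae_of_all _ (hκn k))
    have i2 := (hII.bdd_mul (hκm k) (ae_of_all _ (hκn k))).const_mul (k : ℝ)
    refine integral_mono_ae ((i1.sub i2).congr (ae_of_all _ fun x => (e x).symm)) i1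
      (ae_of_all _ fun x => ?_)
    change ‖G x‖ ^ (s - 2) * inner ℝ (G x) (κ k x • (H x - (k : ℝ) • G x)) ≤ _
    rw [e x]
    have : 0 ≤ k * (κ k x * (‖G x‖ ^ (s - 2) * inner ℝ (G x) (G x))) :=
      mul_nonneg (Nat.cast_nonneg _) (mul_nonneg (hκ0 k x)
        (mul_nonneg (Real.rpow_nonneg (norm_nonneg _) _) real_inner_self_nonneg))
    linarith

lemma integral_norm_rpow_inner_self {F : Type*} [NormedAddCommGroup F] [InnerProductSpace ℝ F]
    {α : Type*} [MeasurableSpace α] {m : Measure α} {s : ℝ} (hs : 1 < s) (f : α → F) :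
    ∫ x, ‖f x‖ ^ (s - 2) * inner ℝ (f x) (f x) ∂m = powInt s m f := by
  unfold powInt
  congr 1 with x
  rcases eq_or_ne (f x) 0 with h | h
  · simp [h, Real.zero_rpow (show s ≠ 0 by linarith)]
  · rw [real_inner_self_eq_norm_sq, ← Real.rpow_natCast,
      ← Real.rpow_add (norm_pos_iff.2 h)]
    congr 1; push_cast; ring

namespace Data

variable (D : Data Ω p q r γ μ a)
include D

variable {u h h' : EuclideanSpace ℝ (Fin N) → ℝ}
  {G H H' : EuclideanSpace ℝ (Fin N) → EuclideanSpace ℝ (Fin N)}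

lemma smoothDeriv_sub (hu : InV Ω p q μ u G) (hh : InV Ω p q μ h H) (hh' : InV Ω p q μ h' H') :
    smoothDeriv Ω p q r lam μ u G (h - h') (H - H') =
      smoothDeriv Ω p q r lam μ u G h H - smoothDeriv Ω p q r lam μ u G h' H' := by
  have i1 := fun {h H} (hh : InV Ω p q μ h H) =>
    (hasDerivAt_powInt D.one_lt hu.memLp_grad hh.memLp_grad).1
  have i2 := fun {h H} (hh : InV Ω p q μ h H) =>
    (hasDerivAt_powInt D.one_lt_q (hu.memLp_grad_wt D.toSetting)
      (hh.memLp_grad_wt D.toSetting)).1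
  have i3 := fun {h H} (hh : InV Ω p q μ h H) =>
    (hasDerivAt_powInt D.one_lt_r (D.memLp_r hu) (D.memLp_r hh)).1
  unfold smoothDeriv pairing
  simp only [Pi.sub_apply, inner_sub_right, mul_sub]
  rw [integral_sub (i1 hh) (i1 hh'), integral_sub (i2 hh) (i2 hh'),
    integral_sub (i3 hh) (i3 hh')]
  ring

/-- A signed test function is dominated by its absolute value, which is an admissible nonnegative
one. -/
lemma integrable_sing_test (hu : InV Ω p q μ u G) (hu0 : ∀ᵐ x ∂(volume.restrict Ω), 0 ≤ u x)
    (hmin : IsDirMin Ω p q r γ lam μ a u G) (hh : InV Ω p q μ h H) :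
    Integrable (fun x => a x * u x ^ (-γ) * h x) (volume.restrict Ω) := by
  have h1 := (D.sing_le hu hu0 hmin (hh.abs D.toSetting) (ae_of_all _ fun _ => abs_nonneg _)).2.1
  refine h1.mono ((D.memLp_a.1.mul
    (hu.aesm.aemeasurable.pow_const _).aestronglyMeasurable).mul hh.aesm) (ae_of_all _ fun x => ?_)
  simp only [norm_mul, Real.norm_eq_abs, abs_abs, le_refl]

lemma defect_sub (hu : InV Ω p q μ u G) (hu0 : ∀ᵐ x ∂(volume.restrict Ω), 0 ≤ u x)
    (hmin : IsDirMin Ω p q r γ lam μ a u G) (hh : InV Ω p q μ h H) (hh' : InV Ω p q μ h' H') :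
    defect Ω p q r γ lam μ a u G (h - h') (H - H') =
      defect Ω p q r γ lam μ a u G h H - defect Ω p q r γ lam μ a u G h' H' := by
  unfold defect
  rw [D.smoothDeriv_sub hu hh hh']
  simp only [Pi.sub_apply, mul_sub]
  rw [integral_sub (D.integrable_sing_test hu hu0 hmin hh)
    (D.integrable_sing_test hu hu0 hmin hh')]
  ring

lemma defect_nonneg (hu : InV Ω p q μ u G) (hu0 : ∀ᵐ x ∂(volume.restrict Ω), 0 ≤ u x)
    (hmin : IsDirMin Ω p q r γ lam μ a u G) (hh : InV Ω p q μ h H)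
    (hh0 : ∀ᵐ x ∂(volume.restrict Ω), 0 ≤ h x) :
    0 ≤ defect Ω p q r γ lam μ a u G h H :=
  sub_nonneg.2 (D.sing_le hu hu0 hmin hh hh0).2.2

/-- Since u > 0, testing with u turns every term into its power integral, and the defect becomes c
times the difference of the two sides of the balance identity. -/
lemma defect_smul_self (hu0 : ∀ᵐ x ∂(volume.restrict Ω), 0 < u x)
    (hbal : powInt p (volume.restrict Ω) G + powInt q (wt Ω μ) G =
      singInt Ω γ a u + lam * powInt r (volume.restrict Ω) u) (c : ℝ) :
    defect Ω p q r γ lam μ a u G (c • u) (c • G) = 0 := by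
  have e1 : ∫ x in Ω, a x * u x ^ (-γ) * u x = singInt Ω γ a u := by
    refine integral_congr_ae ?_
    filter_upwards [hu0] with x hx
    rw [abs_of_pos hx, mul_assoc, ← Real.rpow_add_one hx.ne']
    congr 2; ring
  have e2 := integral_norm_rpow_inner_self (m := volume.restrict Ω) D.one_lt G
  have e3 := integral_norm_rpow_inner_self (m := wt Ω μ) D.one_lt_q G
  have e4 := integral_norm_rpow_inner_self (m := volume.restrict Ω) D.one_lt_r u
  unfold defect smoothDeriv pairing
  simp only [Pi.smul_apply, inner_smul_right, mul_left_comm _ c]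
  simp only [smul_eq_mul, mul_left_comm _ c]
  rw [integral_const_mul, integral_const_mul, integral_const_mul, integral_const_mul, e1, e2, e3, e4]
  linear_combination c * hbal

/-- The defect is additive, nonnegative on nonnegative functions and zero on multiples of u. As 0 ≤
min(h, ku) ≤ ku, it vanishes on min(h, ku), so h has the same defect as (h - ku)⁺. The latter is
bounded above by a null sequence in k. -/
lemma defect_eq_zero_of_nonneg (hlam : 0 ≤ lam) (hu : InV Ω p q μ u G)
    (hu0 : ∀ᵐ x ∂(volume.restrict Ω), 0 ≤ u x)
    (hmin : IsDirMin Ω p q r γ lam μ a u G)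
    (hbal : powInt p (volume.restrict Ω) G + powInt q (wt Ω μ) G =
      singInt Ω γ a u + lam * powInt r (volume.restrict Ω) u)
    (hh : InV Ω p q μ h H) (hh0 : ∀ᵐ x ∂(volume.restrict Ω), 0 ≤ h x) :
    defect Ω p q r γ lam μ a u G h H = 0 := by
  have hpos := D.ae_pos hu hu0 hmin
  refine le_antisymm ?_ (D.defect_nonneg hu hu0 hmin hh hh0)
  have hku : ∀ k : ℕ, InV Ω p q μ ((k : ℝ) • u) ((k : ℝ) • G) := fun k => hu.smul (k : ℝ)
  have hd : ∀ k : ℕ, InV Ω p q μ (h - (k : ℝ) • u) (H - (k : ℝ) • G) := fun k =>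
    hh.sub D.toSetting (hku k)
  have hpp := fun k => (hd k).posPart D.toSetting
  have key : ∀ k : ℕ, defect Ω p q r γ lam μ a u G h H =
      defect Ω p q r γ lam μ a u G (fun x => max ((h - (k : ℝ) • u) x) 0)
        (fun x => ((1 + (h - (k : ℝ) • u) x / |(h - (k : ℝ) • u) x|) / 2) •
          (H - (k : ℝ) • G) x) := fun k => by
    -- This is min(h, ku), written as h minus the positive part of h - ku. Both it and its
    -- complement in ku are nonnegative.
    have hmn := hh.sub D.toSetting (hpp k)
    have h1 := D.defect_nonneg hu hu0 hmin hmn (by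
      filter_upwards [hu0, hh0] with x hx hx'
      have : 0 ≤ (k : ℝ) * u x := mul_nonneg (Nat.cast_nonneg _) hx
      simp only [Pi.sub_apply, Pi.smul_apply, smul_eq_mul, sub_nonneg]
      exact max_le (by linarith) hx')
    have h2 := D.defect_nonneg hu hu0 hmin ((hku k).sub D.toSetting hmn) (by
      refine ae_of_all _ fun x => ?_
      simp only [Pi.sub_apply, Pi.smul_apply, smul_eq_mul]
      linarith [le_max_left (h x - k * u x) 0])
    rw [D.defect_sub hu hu0 hmin (hku k) hmn, D.defect_smul_self hpos hbal] at h2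
    rw [D.defect_sub hu hu0 hmin hh (hpp k)] at h1 h2
    linarith
  obtain ⟨b₁, hb₁, hle₁⟩ := exists_tendsto_truncated_pairing D.one_lt hu.aesm hh.aesm
    hu.memLp_grad hh.memLp_grad hpos
  obtain ⟨b₂, hb₂, hle₂⟩ := exists_tendsto_truncated_pairing D.one_lt_q
    (hu.aesm.mono_ac wt_ac) (hh.aesm.mono_ac wt_ac)
    (hu.memLp_grad_wt D.toSetting) (hh.memLp_grad_wt D.toSetting) (wt_ac.ae_le hpos)
  have hb := hb₁.add hb₂
  rw [add_zero] at hb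
  refine ge_of_tendsto' hb fun k => ?_
  rw [key k]
  -- The singular and power terms enter the defect with a minus sign, so an upper bound only needs
  -- the gradient pairings.
  have n1 : 0 ≤ ∫ x in Ω, a x * u x ^ (-γ) * max ((h - (k : ℝ) • u) x) 0 := by
    refine integral_nonneg_of_ae ?_
    filter_upwards [hu0, D.a_pos] with x hx hax
    exact mul_nonneg (mul_nonneg hax.le (Real.rpow_nonneg hx _)) (le_max_right _ _)
  have n2 : 0 ≤ ∫ x in Ω, ‖u x‖ ^ (r - 2) * inner ℝ (u x) (max ((h - (k : ℝ) • u) x) 0) := by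
    refine integral_nonneg_of_ae ?_
    filter_upwards [hu0] with x hx
    refine mul_nonneg (Real.rpow_nonneg (norm_nonneg _) _) ?_
    exact mul_nonneg (le_max_right _ _) hx
  unfold defect smoothDeriv pairing
  have := hle₁ k
  have := hle₂ k
  have := mul_nonneg hlam n2
  simp only [Pi.sub_apply, Pi.smul_apply, smul_eq_mul] at *
  linarith

/-- A general h equals h⁺ - (h⁺ - h), a difference of two nonnegative elements of the space on each
of which the defect vanishes. -/
theorem isWeakSolution (hlam : 0 ≤ lam) (hu : InV Ω p q μ u G)
    (hu0 : ∀ᵐ x ∂(volume.restrict Ω), 0 ≤ u x)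
    (hmin : IsDirMin Ω p q r γ lam μ a u G)
    (hbal : powInt p (volume.restrict Ω) G + powInt q (wt Ω μ) G =
      singInt Ω γ a u + lam * powInt r (volume.restrict Ω) u) :
    IsWeakSolution Ω p q r γ lam μ a u := by
  have hpos := D.ae_pos hu hu0 hmin
  refine ⟨D.memW1H0 hu, hpos, fun h hh => ?_⟩
  have hh' := D.inV_weakGrad hh
  refine ⟨D.integrable_sing_test hu hu0 hmin hh', ?_⟩
  have hp := hh'.posPart D.toSetting
  have z1 := D.defect_eq_zero_of_nonneg hlam hu hu0 hmin hbal hp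
    (ae_of_all _ fun _ => le_max_right _ _)
  have z2 := D.defect_eq_zero_of_nonneg hlam hu hu0 hmin hbal (hp.sub D.toSetting hh')
    (ae_of_all _ fun x => sub_nonneg.2 (le_max_left _ _))
  rw [D.defect_sub hu hu0 hmin hp hh', z1, zero_sub, neg_eq_zero] at z2
  have hG := hu.weakGrad_ae_eq D.toSetting
  have e1 : ∫ x in Ω, u x ^ (r - 1) * h x =
      ∫ x in Ω, ‖u x‖ ^ (r - 2) * inner ℝ (u x) (h x) := by
    refine integral_congr_ae ?_
    filter_upwards [hpos] with x hx
    rw [Real.norm_of_nonneg hx.le, show inner ℝ (u x) (h x) = h x * u x from rfl,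
      show r - 1 = (r - 2) + 1 by ring, Real.rpow_add_one hx.ne']
    ring
  have i1 := (hasDerivAt_powInt D.one_lt hu.memLp_grad hh'.memLp_grad).1
  have i2 := (hasDerivAt_powInt D.one_lt_q (hu.memLp_grad_wt D.toSetting)
      (hh'.memLp_grad_wt D.toSetting)).1
  rw [D.integrable_wt] at i2
  have e2 : ∫ x in Ω, inner ℝ
          (‖weakGrad Ω u x‖ ^ (p - 2) • weakGrad Ω u x
            + (μ x * ‖weakGrad Ω u x‖ ^ (q - 2)) • weakGrad Ω u x)
          (weakGrad Ω h x) = pairing Ω p q μ G (weakGrad Ω h) := by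
    unfold pairing
    rw [D.integral_wt, ← integral_add i1 i2]
    refine integral_congr_ae ?_
    filter_upwards [hG] with x hx
    rw [hx, inner_add_left, real_inner_smul_left, real_inner_smul_left, mul_assoc]
  rw [e1, e2]
  unfold defect smoothDeriv at z2
  linarith

end Data

end

/-! ### The energy along a ray as a function of one variable. -/

section Fiber

/-- The energy along a ray, `P t^p / p + Q t^q / q - A t^k / k - L t^r / r`. -/
def fiber (p q r k P Q A L t : ℝ) : ℝ :=
  1 / p * t ^ p * P + 1 / q * t ^ q * Q - 1 / k * t ^ k * A - 1 / r * t ^ r * L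

variable {p q r k P Q A L : ℝ}

lemma hasDerivAt_rpow_mul_const {s c t : ℝ} (hs : s ≠ 0) (ht : 0 < t) :
    HasDerivAt (fun t : ℝ => 1 / s * t ^ s * c) (t ^ (s - 1) * c) t := by
  have h := ((Real.hasDerivAt_rpow_const (p := s) (Or.inl ht.ne')).const_mul (1 / s)).mul_const c
  rwa [one_div, inv_mul_cancel_left₀ hs, ← one_div] at h

lemma hasDerivAt_fiber (hp : p ≠ 0) (hq : q ≠ 0) (hr : r ≠ 0) (hk : k ≠ 0) {t : ℝ} (ht : 0 < t) :
    HasDerivAt (fiber p q r k P Q A L)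
      (t ^ (p - 1) * P + t ^ (q - 1) * Q - t ^ (k - 1) * A - t ^ (r - 1) * L) t :=
  (((hasDerivAt_rpow_mul_const hp ht).add (hasDerivAt_rpow_mul_const hq ht)).sub
    (hasDerivAt_rpow_mul_const hk ht)).sub (hasDerivAt_rpow_mul_const hr ht)

/-- A fiber that has a local extremum at `1` satisfies the balance identity. -/
lemma fiber_balance (hp : p ≠ 0) (hq : q ≠ 0) (hr : r ≠ 0) (hk : k ≠ 0)
    (h : IsLocalExtr (fiber p q r k P Q A L) 1) : P + Q = A + L := by
  have := h.hasDerivAt_eq_zero (hasDerivAt_fiber hp hq hr hk one_pos)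
  simp only [Real.one_rpow, one_mul] at this
  linarith

/-- A fiber has at most one global maximum point. -/
lemma fiber_max_unique (hk : 0 < k) (hkp : k < p) (hpq : p < q) (hqr : q < r)
    (hP : 0 < P) (hQ : 0 ≤ Q) {t₁ t₂ : ℝ} (h₁ : 0 < t₁) (h₁₂ : t₁ < t₂)
    (hm₁ : ∀ t, 0 < t → fiber p q r k P Q A L t ≤ fiber p q r k P Q A L t₁)
    (hm₂ : ∀ t, 0 < t → fiber p q r k P Q A L t ≤ fiber p q r k P Q A L t₂) : False := by
  have hp : 0 < p := hk.trans hkp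
  have hq : 0 < q := hp.trans hpq
  have hr : 0 < r := hq.trans hqr
  have h₂ := h₁.trans h₁₂
  set f' : ℝ → ℝ := fun t =>
    t ^ (p - 1) * P + t ^ (q - 1) * Q - t ^ (k - 1) * A - t ^ (r - 1) * L with hf'
  have hd : ∀ t, 0 < t → HasDerivAt (fiber p q r k P Q A L) (f' t) t := fun t ht =>
    hasDerivAt_fiber hp.ne' hq.ne' hr.ne' hk.ne' ht
  have hz : ∀ t, 0 < t → (∀ s, 0 < s → fiber p q r k P Q A L s ≤ fiber p q r k P Q A L t) →
      f' t = 0 := fun t ht hm => by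
    refine IsLocalMax.hasDerivAt_eq_zero (f := fiber p q r k P Q A L) (a := t) ?_ (hd t ht)
    filter_upwards [lt_mem_nhds ht] with s hs using hm s hs
  -- Two maxima have equal values, so Rolle's theorem supplies a third critical point between them.
  obtain ⟨t₃, ht₃, hz₃⟩ := exists_hasDerivAt_eq_zero h₁₂
    (fun t ht => (hd t (h₁.trans_le ht.1)).continuousAt.continuousWithinAt)
    (le_antisymm (hm₂ _ h₁) (hm₁ _ h₂)) (fun t ht => hd t (h₁.trans ht.1))
  -- The derivative of the fiber divided by t^(k-1), so that A becomes a constant. Three zeros of g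
  -- give two zeros of g', where A no longer occurs.
  set g : ℝ → ℝ := fun t => t ^ (p - k) * P + t ^ (q - k) * Q - A - t ^ (r - k) * L with hg
  have hgf : ∀ t, 0 < t → f' t = 0 → g t = 0 := fun t ht h => by
    have e : g t = t ^ (1 - k) * f' t := by
      simp only [hg, hf', mul_sub, mul_add, ← mul_assoc, ← Real.rpow_add ht]
      rw [show 1 - k + (p - 1) = p - k by ring, show 1 - k + (q - 1) = q - k by ring,
        show 1 - k + (k - 1) = 0 by ring, show 1 - k + (r - 1) = r - k by ring, Real.rpow_zero,
        one_mul]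
    rw [e, h, mul_zero]
  have hgd : ∀ t, 0 < t → HasDerivAt g ((p - k) * t ^ (p - k - 1) * P +
      (q - k) * t ^ (q - k - 1) * Q - (r - k) * t ^ (r - k - 1) * L) t := fun t ht => by
    have h1 := (Real.hasDerivAt_rpow_const (p := p - k) (Or.inl ht.ne')).mul_const P
    have h2 := (Real.hasDerivAt_rpow_const (p := q - k) (Or.inl ht.ne')).mul_const Q
    have h3 := (Real.hasDerivAt_rpow_const (p := r - k) (Or.inl ht.ne')).mul_const L
    exact ((h1.add h2).sub_const A).sub h3
  have h13 := h₁.trans ht₃.1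
  have z₁ := hgf _ h₁ (hz _ h₁ hm₁)
  have z₂ := hgf _ h₂ (hz _ h₂ hm₂)
  have z₃ := hgf _ h13 hz₃
  obtain ⟨s₁, hs₁, e₁⟩ := exists_hasDerivAt_eq_zero ht₃.1
    (fun t ht => (hgd t (h₁.trans_le ht.1)).continuousAt.continuousWithinAt)
    (z₁.trans z₃.symm) (fun t ht => hgd t (h₁.trans ht.1))
  obtain ⟨s₂, hs₂, e₂⟩ := exists_hasDerivAt_eq_zero ht₃.2
    (fun t ht => (hgd t (h13.trans_le ht.1)).continuousAt.continuousWithinAt)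
    (z₃.trans z₂.symm) (fun t ht => hgd t (h13.trans ht.1))
  have p₁ : 0 < s₁ := h₁.trans hs₁.1
  have p₁₂ : s₁ < s₂ := hs₁.2.trans hs₂.1
  -- Multiplying g' by s^(1+k-r) isolates the constant (r-k)L against a strictly decreasing function
  -- of s, so g' has at most one zero.
  have key : ∀ s, 0 < s → (p - k) * s ^ (p - k - 1) * P + (q - k) * s ^ (q - k - 1) * Q -
      (r - k) * s ^ (r - k - 1) * L = 0 →
      (p - k) * s ^ (p - r) * P + (q - k) * s ^ (q - r) * Q = (r - k) * L := fun s hs h => by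
    have e : (p - k) * s ^ (p - r) * P + (q - k) * s ^ (q - r) * Q - (r - k) * L =
        s ^ (1 + k - r) * ((p - k) * s ^ (p - k - 1) * P + (q - k) * s ^ (q - k - 1) * Q -
          (r - k) * s ^ (r - k - 1) * L) := by
      rw [show p - r = (1 + k - r) + (p - k - 1) by ring,
        show q - r = (1 + k - r) + (q - k - 1) by ring, Real.rpow_add hs, Real.rpow_add hs]
      have : s ^ (1 + k - r) * s ^ (r - k - 1) = 1 := by
        rw [← Real.rpow_add hs, show 1 + k - r + (r - k - 1) = 0 by ring, Real.rpow_zero]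
      linear_combination (r - k) * L * this
    rw [h, mul_zero] at e
    linarith
  have k₁ := key s₁ p₁ e₁
  have k₂ := key s₂ (p₁.trans p₁₂) e₂
  have l1 : s₂ ^ (p - r) < s₁ ^ (p - r) := Real.rpow_lt_rpow_of_neg p₁ p₁₂ (by linarith)
  have l2 : s₂ ^ (q - r) < s₁ ^ (q - r) := Real.rpow_lt_rpow_of_neg p₁ p₁₂ (by linarith)
  have m1 : (p - k) * s₂ ^ (p - r) * P < (p - k) * s₁ ^ (p - r) * P :=
    mul_lt_mul_of_pos_right (mul_lt_mul_of_pos_left l1 (by linarith)) hP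
  have m2 : (q - k) * s₂ ^ (q - r) * Q ≤ (q - k) * s₁ ^ (q - r) * Q :=
    mul_le_mul_of_nonneg_right (mul_le_mul_of_nonneg_left l2.le (by linarith)) hQ
  linarith

lemma continuous_fiber (hp : 0 ≤ p) (hq : 0 ≤ q) (hr : 0 ≤ r) (hk : 0 ≤ k) :
    Continuous (fiber p q r k P Q A L) := by
  unfold fiber
  have h : ∀ {s : ℝ}, 0 ≤ s → Continuous fun t : ℝ => t ^ s := fun hs =>
    Real.continuous_rpow_const hs
  exact ((((continuous_const.mul (h hp)).mul continuous_const).add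
    ((continuous_const.mul (h hq)).mul continuous_const)).sub
    ((continuous_const.mul (h hk)).mul continuous_const)).sub
    ((continuous_const.mul (h hr)).mul continuous_const)

lemma tendsto_fiber (hp : 0 ≤ p) (hq : 0 ≤ q) (hr : 0 ≤ r) (hk : 0 ≤ k) {P' Q' A' L' t' : ℕ → ℝ}
    {t : ℝ} (hP : Tendsto P' atTop (𝓝 P)) (hQ : Tendsto Q' atTop (𝓝 Q))
    (hA : Tendsto A' atTop (𝓝 A)) (hL : Tendsto L' atTop (𝓝 L)) (ht : Tendsto t' atTop (𝓝 t)) :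
    Tendsto (fun n => fiber p q r k (P' n) (Q' n) (A' n) (L' n) (t' n)) atTop
      (𝓝 (fiber p q r k P Q A L t)) := by
  unfold fiber
  have h : ∀ {s : ℝ}, 0 ≤ s → Tendsto (fun n => t' n ^ s) atTop (𝓝 (t ^ s)) := fun hs =>
    ht.rpow_const (Or.inr hs)
  exact (((((h hp).const_mul _).mul hP).add (((h hq).const_mul _).mul hQ)).sub
    (((h hk).const_mul _).mul hA)).sub (((h hr).const_mul _).mul hL)

/-- Fibers with bounded coefficients become negative at a uniform rate. -/
lemma exists_fiber_nonpos (hp : 0 < p) (hpq : p < q) (hqr : q < r) (hk : 0 < k) (hL : 0 < L)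
    (B : ℝ) : ∃ T : ℝ, 0 < T ∧ ∀ P Q A L' : ℝ, 0 ≤ P → 0 ≤ Q → 0 ≤ A → L ≤ L' →
      1 / p * P + 1 / q * Q ≤ B → ∀ t, T ≤ t → fiber p q r k P Q A L' t ≤ 0 := by
  have hq := hp.trans hpq
  have hr := hq.trans hqr
  -- For t ≥ 1 the positive terms are at most B t^q, and the last term outweighs this once t^(r-q) ≥
  -- Br/L.
  obtain ⟨T, hT, hT1⟩ := (((tendsto_rpow_atTop (show 0 < r - q by linarith)).eventually
    (eventually_ge_atTop (B * r / L))).and (eventually_ge_atTop 1)).exists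
  refine ⟨T, by linarith, fun P Q A L' hP hQ hA hLL hB t ht => ?_⟩
  have ht1 : 1 ≤ t := hT1.trans ht
  have ht0 : 0 < t := by linarith
  have h1 : B * r / L ≤ t ^ (r - q) :=
    hT.trans (Real.rpow_le_rpow (by linarith) ht (by linarith))
  have h2 : t ^ p ≤ t ^ q := Real.rpow_le_rpow_of_exponent_le ht1 hpq.le
  have h3 : t ^ r = t ^ q * t ^ (r - q) := by rw [← Real.rpow_add ht0]; congr 1; ring
  have hq0 : 0 < t ^ q := Real.rpow_pos_of_pos ht0 q
  have h4 : 1 / p * t ^ p * P ≤ 1 / p * t ^ q * P := by gcongr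
  have h5 : 0 ≤ 1 / k * t ^ k * A := by positivity
  have h6 : B ≤ 1 / r * t ^ (r - q) * L' := by
    rw [div_le_iff₀ hL] at h1
    have : t ^ (r - q) * L ≤ t ^ (r - q) * L' :=
      mul_le_mul_of_nonneg_left hLL (Real.rpow_nonneg ht0.le _)
    calc B = 1 / r * (B * r) := by field_simp
      _ ≤ 1 / r * (t ^ (r - q) * L') :=
        mul_le_mul_of_nonneg_left (h1.trans this) (by positivity)
      _ = _ := by ring
  have h7 : t ^ q * (1 / p * P + 1 / q * Q) ≤ t ^ q * (1 / r * t ^ (r - q) * L') :=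
    mul_le_mul_of_nonneg_left (hB.trans h6) hq0.le
  unfold fiber
  rw [h3]
  nlinarith

lemma fiber_zero (hp : p ≠ 0) (hq : q ≠ 0) (hr : r ≠ 0) (hk : k ≠ 0) :
    fiber p q r k P Q A L 0 = 0 := by
  simp [fiber, Real.zero_rpow hp, Real.zero_rpow hq, Real.zero_rpow hr, Real.zero_rpow hk]

/-- A fiber that is positive somewhere attains its maximum. -/
lemma exists_fiber_max (hp : 0 < p) (hpq : p < q) (hqr : q < r) (hk : 0 < k) (hP : 0 ≤ P)
    (hQ : 0 ≤ Q) (hA : 0 ≤ A) (hL : 0 < L) {t₀ : ℝ} (ht₀ : 0 < t₀)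
    (h : 0 < fiber p q r k P Q A L t₀) :
    ∃ t, 0 < t ∧ ∀ s, 0 < s → fiber p q r k P Q A L s ≤ fiber p q r k P Q A L t := by
  have hq := hp.trans hpq
  have hr := hq.trans hqr
  obtain ⟨T, hT0, hT⟩ := exists_fiber_nonpos hp hpq hqr hk hL (1 / p * P + 1 / q * Q)
  have hT' := hT P Q A L hP hQ hA le_rfl le_rfl
  obtain ⟨t, ht, hmax⟩ := (isCompact_Icc (a := (0 : ℝ)) (b := T)).exists_isMaxOn
    (Set.nonempty_Icc.2 hT0.le)
    (continuous_fiber (P := P) (Q := Q) (A := A) (L := L) hp.le hq.le hr.le hk.le).continuousOn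
  have hle : ∀ s, 0 ≤ s → s ≤ T → fiber p q r k P Q A L s ≤ fiber p q r k P Q A L t :=
    fun s h1 h2 => hmax (Set.mem_Icc.2 ⟨h1, h2⟩)
  have hpos : 0 < fiber p q r k P Q A L t := by
    rcases le_total t₀ T with h1 | h1
    · exact h.trans_le (hle _ ht₀.le h1)
    · exact absurd (hT' _ h1) (not_le.2 h)
  -- The maximum over [0, T] is positive. This excludes t = 0 and makes it global, since the fiber
  -- is nonpositive beyond T.
  refine ⟨t, lt_of_le_of_ne ht.1 fun h0 => ?_, fun s hs => ?_⟩
  · rw [← h0, fiber_zero hp.ne' hq.ne' hr.ne' hk.ne'] at hpos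
    exact lt_irrefl _ hpos
  · rcases le_total s T with h1 | h1
    · exact hle _ hs.le h1
    · exact (hT' _ h1).trans hpos.le

end Fiber

/-! ### Estimates, continuity and nontriviality of the energy terms. -/

section

/-- Subadditivity of the concave power. It yields continuity of the singular term without
differentiating it. -/
lemma abs_rpow_sub_rpow_le {k x y : ℝ} (hk : 0 < k) (hk1 : k ≤ 1) (hx : 0 ≤ x) (hy : 0 ≤ y) :
    |x ^ k - y ^ k| ≤ |x - y| ^ k := by
  wlog h : y ≤ x generalizing x y
  · rw [abs_sub_comm, abs_sub_comm x]
    exact this hy hx (le_of_not_ge h)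
  have h1 : y ^ k ≤ x ^ k := Real.rpow_le_rpow hy h hk.le
  rw [abs_of_nonneg (by linarith), abs_of_nonneg (by linarith)]
  have h2 := Real.rpow_add_le_add_rpow (p := k) hy (sub_nonneg.2 h) hk.le hk1
  rw [add_sub_cancel] at h2
  linarith

lemma ae_eq_zero_of_powInt_eq_zero {α F : Type*} [MeasurableSpace α] {m : Measure α}
    [NormedAddCommGroup F] {s : ℝ} (hs : 0 < s) {f : α → F}
    (hf : MemLp f (ENNReal.ofReal s) m) (h : powInt s m f = 0) : f =ᵐ[m] 0 := by
  have := (integral_eq_zero_iff_of_nonneg (fun x => Real.rpow_nonneg (norm_nonneg _) _)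
    (integrable_norm_rpow_of_memLp hs hf)).1 h
  filter_upwards [this] with x hx
  exact norm_eq_zero.1 ((Real.rpow_eq_zero (norm_nonneg _) hs.ne').1 hx)

lemma powInt_mono_norm {α F : Type*} [MeasurableSpace α] {m : Measure α}
    [NormedAddCommGroup F] {s : ℝ} (hs : 0 < s) {f g : α → F}
    (hg : MemLp g (ENNReal.ofReal s) m) (h : ∀ x, ‖f x‖ ≤ ‖g x‖) :
    powInt s m f ≤ powInt s m g :=
  integral_mono_of_nonneg (ae_of_all _ fun _ => Real.rpow_nonneg (norm_nonneg _) _)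
    (integrable_norm_rpow_of_memLp hs hg)
    (ae_of_all _ fun x => Real.rpow_le_rpow (norm_nonneg _) (h x) hs.le)

variable {N : ℕ} {Ω : Set (EuclideanSpace ℝ (Fin N))} {p q r γ lam : ℝ}
  {μ a : EuclideanSpace ℝ (Fin N) → ℝ}

/-- Power integrals of `u` are controlled by a bound on the gradient. -/
lemma Setting.powInt_le (S : Setting Ω p q μ) : ∃ C : ℝ, 0 ≤ C ∧ ∀ s, 0 < s →
    s ≤ N * p / (N - p) → ∀ ρ, 0 < ρ → ∀ u G, InV Ω p q μ u G →
    powInt p (volume.restrict Ω) G ≤ ρ → powInt s (volume.restrict Ω) u ≤ C * ρ ^ (s / p) := by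
  have := S.finite
  obtain ⟨C, hC0, hC⟩ := S.powInt_crit_le
  set c := N * p / (N - p) with hc
  have hc0 : 0 < c := by linarith [S.one_lt_crit]
  set V := (volume.restrict Ω).real Set.univ with hV
  have hV0 : 0 ≤ V := measureReal_nonneg
  refine ⟨V + C, by positivity, fun s hs hsc ρ hρ u G hu hG => ?_⟩
  have hp := S.p_pos
  -- The natural size of u under the gradient bound: after division by T the critical power integral
  -- is bounded independently of ρ, so one constant serves all ρ and all s.
  set T := ρ ^ (1 / p) with hT
  have hT0 : 0 < T := Real.rpow_pos_of_pos hρ _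
  have hTs : ∀ s : ℝ, T ^ s = ρ ^ (s / p) := fun s => by
    rw [hT, ← Real.rpow_mul hρ.le, one_div_mul_eq_div]
  have hi := integrable_norm_rpow_of_memLp hc0 (S.memLp_crit hu)
  have hpt : ∀ y : ℝ, 0 ≤ y → y ^ s ≤ T ^ s * (1 + T ^ (-c) * y ^ c) := fun y hy => by
    have h1 : y ^ s = T ^ s * (y / T) ^ s := by
      rw [← Real.mul_rpow hT0.le (by positivity), mul_div_cancel₀ _ hT0.ne']
    have h2 : T ^ (-c) * y ^ c = (y / T) ^ c := by
      rw [Real.div_rpow hy hT0.le, Real.rpow_neg hT0.le]; ring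
    rw [h1, h2]
    refine mul_le_mul_of_nonneg_left ?_ (by positivity)
    have hz : 0 ≤ y / T := by positivity
    rcases le_total (y / T) 1 with h | h
    · exact (Real.rpow_le_one hz h hs.le).trans (le_add_of_nonneg_right (by positivity))
    · exact (Real.rpow_le_rpow_of_exponent_le h hsc).trans (le_add_of_nonneg_left zero_le_one)
  have h3 : powInt s (volume.restrict Ω) u ≤
      T ^ s * (V + T ^ (-c) * powInt c (volume.restrict Ω) u) := by
    have e : T ^ s * (V + T ^ (-c) * powInt c (volume.restrict Ω) u) =
        ∫ x in Ω, T ^ s * (1 + T ^ (-c) * ‖u x‖ ^ c) := by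
      rw [integral_const_mul, integral_add (integrable_const 1) (hi.const_mul _),
        integral_const_mul]
      simp [powInt, hV]
    rw [e]
    exact integral_mono_of_nonneg (ae_of_all _ fun x => Real.rpow_nonneg (norm_nonneg _) _)
      (((integrable_const 1).add (hi.const_mul _)).const_mul _)
      (ae_of_all _ fun x => hpt _ (norm_nonneg _))
  have h4 : powInt c (volume.restrict Ω) u ≤ C * T ^ c := by
    rw [hTs]
    exact (hC u G hu).trans (mul_le_mul_of_nonneg_left
      (Real.rpow_le_rpow (powInt_nonneg _ _) hG (by positivity)) hC0)
  rw [← hTs, mul_comm (V + C)]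
  refine h3.trans (mul_le_mul_of_nonneg_left ?_ (by positivity))
  calc V + T ^ (-c) * powInt c (volume.restrict Ω) u ≤ V + T ^ (-c) * (C * T ^ c) := by gcongr
    _ = V + C := by
      have : T ^ (-c) * T ^ c = 1 := by
        rw [← Real.rpow_add hT0, neg_add_cancel, Real.rpow_zero]
      linear_combination C * this

lemma functional_eq_fiber {t : ℝ} (ht : 0 ≤ t) (u : EuclideanSpace ℝ (Fin N) → ℝ)
    (G : EuclideanSpace ℝ (Fin N) → EuclideanSpace ℝ (Fin N)) :
    functional Ω p q r γ lam μ a (t • u) (t • G) =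
      fiber p q r (1 - γ) (powInt p (volume.restrict Ω) G) (powInt q (wt Ω μ) G)
        (singInt Ω γ a u) (lam * powInt r (volume.restrict Ω) u) t := by
  rw [functional_smul ht, fiber]
  ring

lemma functional_eq_fiber_one (u : EuclideanSpace ℝ (Fin N) → ℝ)
    (G : EuclideanSpace ℝ (Fin N) → EuclideanSpace ℝ (Fin N)) :
    functional Ω p q r γ lam μ a u G =
      fiber p q r (1 - γ) (powInt p (volume.restrict Ω) G) (powInt q (wt Ω μ) G)
        (singInt Ω γ a u) (lam * powInt r (volume.restrict Ω) u) 1 := by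
  rw [← functional_eq_fiber zero_le_one, one_smul, one_smul]

namespace Setting

variable (S : Setting Ω p q μ)
include S

variable {u : EuclideanSpace ℝ (Fin N) → ℝ}
  {G : EuclideanSpace ℝ (Fin N) → EuclideanSpace ℝ (Fin N)}

/-- Passing to the absolute value does not increase the energy. -/
lemma exists_abs (hu : InV Ω p q μ u G) : ∃ G', InV Ω p q μ (fun x => |u x|) G' ∧
    powInt p (volume.restrict Ω) G' ≤ powInt p (volume.restrict Ω) G ∧
    powInt q (wt Ω μ) G' ≤ powInt q (wt Ω μ) G := by
  have h : ∀ x, ‖(u x / |u x|) • G x‖ ≤ ‖G x‖ := fun x => by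
    rw [norm_smul, norm_div, Real.norm_eq_abs, Real.norm_eq_abs, abs_abs]
    exact mul_le_of_le_one_left (norm_nonneg _) (div_self_le_one _)
  exact ⟨_, hu.abs S, powInt_mono_norm S.p_pos hu.memLp_grad h,
    powInt_mono_norm S.q_pos (hu.memLp_grad_wt S) h⟩

/-- Intermediate value theorem along the ray: the energy starts at 0 and reaches ρ through its
p-term alone. -/
lemma exists_smul_gradEnergy_eq {α β ρ : ℝ} (hα : 0 < α) (hβ : 0 ≤ β) (hρ : 0 < ρ)
    (hG : 0 < powInt p (volume.restrict Ω) G) :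
    ∃ t : ℝ, 0 < t ∧ gradEnergy Ω p q μ α β (t • G) = ρ := by
  have hp := S.p_pos
  have hq := S.q_pos
  set P := powInt p (volume.restrict Ω) G with hP
  set Q := powInt q (wt Ω μ) G with hQ
  have hQ0 : 0 ≤ Q := powInt_nonneg _ _
  obtain ⟨T, hT, hT0⟩ := (((tendsto_rpow_atTop hp).eventually
    (eventually_ge_atTop (ρ / (α * P)))).and (eventually_gt_atTop 0)).exists
  have hc : Continuous fun t : ℝ => α * t ^ p * P + β * t ^ q * Q :=
    ((continuous_const.mul (Real.continuous_rpow_const hp.le)).mul continuous_const).add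
    ((continuous_const.mul (Real.continuous_rpow_const hq.le)).mul continuous_const)
  obtain ⟨t, ht, hte⟩ := intermediate_value_Icc hT0.le hc.continuousOn
    (show ρ ∈ Set.Icc _ _ from ⟨by simp [Real.zero_rpow hp.ne', Real.zero_rpow hq.ne', hρ.le], by
      rw [div_le_iff₀ (by positivity)] at hT
      have : 0 ≤ β * T ^ q * Q := by positivity
      show ρ ≤ α * T ^ p * P + β * T ^ q * Q
      nlinarith⟩)
  refine ⟨t, lt_of_le_of_ne ht.1 fun h0 => ?_, ?_⟩
  · rw [← h0] at hte
    simp [Real.zero_rpow hp.ne', Real.zero_rpow hq.ne'] at hte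
    exact hρ.ne hte
  · rw [gradEnergy_smul ht.1]
    exact hte

lemma continuousAt_gradEnergy {α β : ℝ} {h : EuclideanSpace ℝ (Fin N) → ℝ}
    {H : EuclideanSpace ℝ (Fin N) → EuclideanSpace ℝ (Fin N)}
    (hu : InV Ω p q μ u G) (hh : InV Ω p q μ h H) :
    ContinuousAt (fun t : ℝ => gradEnergy Ω p q μ α β (G + t • H)) 0 :=
  ((hasDerivAt_powInt S.one_lt hu.memLp_grad hh.memLp_grad).2.continuousAt.const_mul α).add
    ((hasDerivAt_powInt S.one_lt_q (hu.memLp_grad_wt S)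
      (hh.memLp_grad_wt S)).2.continuousAt.const_mul β)

end Setting

namespace Data

variable (D : Data Ω p q r γ μ a)
include D

variable {u v : EuclideanSpace ℝ (Fin N) → ℝ}
  {G H : EuclideanSpace ℝ (Fin N) → EuclideanSpace ℝ (Fin N)}

lemma singInt_le : ∃ C : ℝ, 0 ≤ C ∧ ∀ u G, InV Ω p q μ u G →
    singInt Ω γ a u ≤ C * powInt (1 - γ) (volume.restrict Ω) u := by
  obtain ⟨C, hC0, hC⟩ := D.exists_a_bound
  refine ⟨C, hC0.le, fun u G hu => ?_⟩
  unfold singInt powInt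
  rw [← integral_const_mul]
  refine integral_mono_ae (D.integrable_sing hu) ((D.integrable_rpow_one_sub hu).const_mul C) ?_
  filter_upwards [hC] with x hx
  exact mul_le_mul_of_nonneg_right ((le_abs_self _).trans hx) (Real.rpow_nonneg (abs_nonneg _) _)

lemma tendsto_singInt {u : ℕ → EuclideanSpace ℝ (Fin N) → ℝ}
    {G : ℕ → EuclideanSpace ℝ (Fin N) → EuclideanSpace ℝ (Fin N)}
    (hu : ∀ n, InV Ω p q μ (u n) (G n)) (hv : InV Ω p q μ v H)
    (h : Tendsto (fun n => powInt (1 - γ) (volume.restrict Ω) (u n - v)) atTop (𝓝 0)) :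
    Tendsto (fun n => singInt Ω γ a (u n)) atTop (𝓝 (singInt Ω γ a v)) := by
  obtain ⟨C, hC0, hC⟩ := D.exists_a_bound
  rw [tendsto_iff_norm_sub_tendsto_zero]
  refine squeeze_zero (fun _ => norm_nonneg _) (fun n => ?_) (by simpa using h.const_mul C)
  have hd := (hu n).sub D.toSetting hv
  unfold singInt powInt
  rw [← integral_sub (D.integrable_sing (hu n)) (D.integrable_sing hv), ← integral_const_mul]
  refine norm_integral_le_of_norm_le ((D.integrable_rpow_one_sub hd).const_mul C) ?_
  filter_upwards [hC] with x hx
  rw [← mul_sub, norm_mul]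
  refine mul_le_mul hx ?_ (norm_nonneg _) hC0.le
  refine (abs_rpow_sub_rpow_le D.one_sub_γ_pos (by linarith [D.γ_pos]) (abs_nonneg _)
    (abs_nonneg _)).trans ?_
  exact Real.rpow_le_rpow (abs_nonneg _) (abs_abs_sub_abs_le_abs_sub _ _) D.one_sub_γ_pos.le

lemma tendsto_powInt_r {u : ℕ → EuclideanSpace ℝ (Fin N) → ℝ}
    {G : ℕ → EuclideanSpace ℝ (Fin N) → EuclideanSpace ℝ (Fin N)}
    (hu : ∀ n, InV Ω p q μ (u n) (G n)) (hv : InV Ω p q μ v H)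
    (h : Tendsto (fun n => powInt r (volume.restrict Ω) (u n - v)) atTop (𝓝 0)) :
    Tendsto (fun n => powInt r (volume.restrict Ω) (u n)) atTop
      (𝓝 (powInt r (volume.restrict Ω) v)) :=
  tendsto_powInt D.one_lt_r.le (fun n => D.memLp_r (hu n)) (D.memLp_r hv)
    ((tendsto_eLpNorm_zero_iff_powInt D.r_pos
      fun n => D.memLp_r ((hu n).sub D.toSetting hv)).2 h)

lemma singInt_pos (hu : InV Ω p q μ u G) (h : 0 < powInt r (volume.restrict Ω) u) :
    0 < singInt Ω γ a u := by
  refine lt_of_le_of_ne (D.singInt_nonneg u) fun h0 => h.ne' ?_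
  have := (integral_eq_zero_iff_of_nonneg_ae (D.a_pos.mono fun x hx => mul_nonneg hx.le
    (Real.rpow_nonneg (abs_nonneg (u x)) _)) (D.integrable_sing hu)).1 h0.symm
  have hz : u =ᵐ[volume.restrict Ω] 0 := by
    filter_upwards [this, D.a_pos] with x hx hax
    have h1 := (mul_eq_zero.1 hx).resolve_left hax.ne'
    exact abs_eq_zero.1 ((Real.rpow_eq_zero (abs_nonneg _) D.one_sub_γ_pos.ne').1 h1)
  rw [powInt_congr_ae hz]
  simp [powInt, Real.zero_rpow D.r_pos.ne']

/-- By the Sobolev inequality, a vanishing gradient would force u = 0 almost everywhere. -/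
lemma powInt_grad_pos (hu : InV Ω p q μ u G) (h : 0 < powInt r (volume.restrict Ω) u) :
    0 < powInt p (volume.restrict Ω) G := by
  refine lt_of_le_of_ne (powInt_nonneg _ _) fun h0 => h.ne' ?_
  obtain ⟨C, -, hC⟩ := D.powInt_crit_le
  have hc : 0 < N * p / (N - p) := by linarith [D.one_lt_crit]
  have h1 := hC u G hu
  rw [← h0, Real.zero_rpow (div_pos hc D.p_pos).ne', mul_zero] at h1
  have hz := ae_eq_zero_of_powInt_eq_zero hc (D.memLp_crit hu)
    (le_antisymm h1 (powInt_nonneg _ _))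
  rw [powInt_congr_ae hz]
  simp [powInt, Real.zero_rpow D.r_pos.ne']

lemma exists_powInt_pos (hne : Ω.Nonempty) :
    ∃ u G, InV Ω p q μ u G ∧ 0 < powInt r (volume.restrict Ω) u := by
  obtain ⟨x, hx⟩ := hne
  obtain ⟨δ, hδ, hball⟩ := Metric.isOpen_iff.1 D.isOpen x hx
  set f : ContDiffBump x := ⟨δ / 4, δ / 2, by positivity, by linarith⟩ with hf
  have htest : IsTestFunction Ω f := by
    refine ⟨f.contDiff, f.hasCompactSupport, ?_⟩
    rw [f.tsupport_eq]
    exact (Metric.closedBall_subset_ball (by simp [hf]; linarith)).trans hball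
  refine ⟨f, _, htest.inV, lt_of_le_of_ne (powInt_nonneg _ _) fun h0 => ?_⟩
  have hz := ae_eq_zero_of_powInt_eq_zero D.r_pos (D.memLp_r (htest.inV (p := p) (q := q)
    (μ := μ))) h0.symm
  rw [Filter.EventuallyEq, ae_restrict_iff' D.isOpen.measurableSet] at hz
  refine (Metric.measure_ball_pos volume x (show 0 < δ / 2 by positivity)).ne'
    (measure_mono_null (fun y hy => ?_) hz)
  intro hcon
  exact (f.pos_of_mem_ball hy).ne' (hcon (hball (Metric.ball_subset_ball (by linarith) hy)))

end Data

end

/-! ### The barrier and the local minimizer. -/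

section

variable {N : ℕ} {Ω : Set (EuclideanSpace ℝ (Fin N))} {p q r γ lam : ℝ}
  {μ a : EuclideanSpace ℝ (Fin N) → ℝ}

lemma powInt_le_add_powInt {α F : Type*} [MeasurableSpace α] {m : Measure α} [IsFiniteMeasure m]
    [NormedAddCommGroup F] {s t : ℝ} (hs : 0 < s) (hst : s ≤ t) {f : α → F}
    (hf : MemLp f (ENNReal.ofReal t) m) :
    powInt s m f ≤ m.real Set.univ + powInt t m f := by
  have hi := integrable_norm_rpow_of_memLp (hs.trans_le hst) hf
  have e : m.real Set.univ + powInt t m f = ∫ x, (1 + ‖f x‖ ^ t) ∂m := by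
    rw [integral_add (integrable_const 1) hi]
    simp [powInt]
  rw [e]
  refine integral_mono_of_nonneg (ae_of_all _ fun x => Real.rpow_nonneg (norm_nonneg _) _)
    ((integrable_const 1).add hi) (ae_of_all _ fun x => ?_)
  have hz := norm_nonneg (f x)
  rcases le_total ‖f x‖ 1 with h | h
  · exact (Real.rpow_le_one hz h hs.le).trans (le_add_of_nonneg_right (by positivity))
  · exact (Real.rpow_le_rpow_of_exponent_le h hst).trans (le_add_of_nonneg_left zero_le_one)

lemma gradEnergy_mono {α β : ℝ} (hα : 0 ≤ α) (hβ : 0 ≤ β)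
    {G H : EuclideanSpace ℝ (Fin N) → EuclideanSpace ℝ (Fin N)}
    (h1 : powInt p (volume.restrict Ω) G ≤ powInt p (volume.restrict Ω) H)
    (h2 : powInt q (wt Ω μ) G ≤ powInt q (wt Ω μ) H) :
    gradEnergy Ω p q μ α β G ≤ gradEnergy Ω p q μ α β H :=
  add_le_add (mul_le_mul_of_nonneg_left h1 hα) (mul_le_mul_of_nonneg_left h2 hβ)

lemma singInt_abs (u : EuclideanSpace ℝ (Fin N) → ℝ) :
    singInt Ω γ a (fun x => |u x|) = singInt Ω γ a u := by
  simp [singInt]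

lemma powInt_abs {s : ℝ} (u : EuclideanSpace ℝ (Fin N) → ℝ) :
    powInt s (volume.restrict Ω) (fun x => |u x|) = powInt s (volume.restrict Ω) u := by
  simp [powInt]

namespace Setting

variable (S : Setting Ω p q μ)
include S

lemma gradEnergy_one_one_le (G : EuclideanSpace ℝ (Fin N) → EuclideanSpace ℝ (Fin N)) :
    gradEnergy Ω p q μ 1 1 G ≤ q * gradEnergy Ω p q μ (1 / p) (1 / q) G := by
  have hp := S.p_pos
  have hq := S.q_pos
  have h1 : 1 ≤ q * (1 / p) := by
    rw [mul_one_div, one_le_div hp]; exact S.lt.le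
  have h2 : q * (1 / q) = 1 := by field_simp
  unfold gradEnergy
  rw [mul_add, ← mul_assoc, ← mul_assoc, h2]
  gcongr
  exact powInt_nonneg _ _

lemma powInt_le_of_gradEnergy_le {ρ : ℝ}
    {G : EuclideanSpace ℝ (Fin N) → EuclideanSpace ℝ (Fin N)}
    (h : gradEnergy Ω p q μ (1 / p) (1 / q) G ≤ ρ) : powInt p (volume.restrict Ω) G ≤ p * ρ := by
  have hp := S.p_pos
  have hq := S.q_pos
  unfold gradEnergy at h
  have h1 : 0 ≤ 1 / q * powInt q (wt Ω μ) G := mul_nonneg (by positivity) (powInt_nonneg _ _)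
  have h2 : p * (1 / p * powInt p (volume.restrict Ω) G) ≤ p * ρ :=
    mul_le_mul_of_nonneg_left (by linarith) hp.le
  rwa [← mul_assoc, mul_one_div_cancel hp.ne', one_mul] at h2

end Setting

namespace Data

variable (D : Data Ω p q r γ μ a)
include D

variable {u v : EuclideanSpace ℝ (Fin N) → ℝ}
  {G H : EuclideanSpace ℝ (Fin N) → EuclideanSpace ℝ (Fin N)}

/-- For small `lam` the energy is bounded below by a positive constant on a level set of the
gradient part. -/
theorem exists_barrier : ∃ ρ lam₀ : ℝ, 0 < ρ ∧ 0 < lam₀ ∧ ∀ lam, 0 < lam → lam ≤ lam₀ →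
    ∀ u G, InV Ω p q μ u G → gradEnergy Ω p q μ (1 / p) (1 / q) G = ρ →
      ρ / 4 ≤ functional Ω p q r γ lam μ a u G := by
  obtain ⟨C, hC0, hC⟩ := D.powInt_le
  obtain ⟨B, hB0, hB⟩ := D.singInt_le
  have hp := D.p_pos
  have hr := D.r_pos
  have hk := D.one_sub_γ_pos
  have hkp := D.one_sub_γ_lt_p
  have hexp : 0 < 1 - (1 - γ) / p := sub_pos.2 ((div_lt_one hp).2 hkp)
  -- Here x = pρ bounds ∫|∇u|^p. The singular term grows only like x^((1-γ)/p), with exponent below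
  -- 1, so for large x it is at most ρ/2; λ is made small only afterwards.
  obtain ⟨x, hx, hx0⟩ := (((tendsto_rpow_atTop hexp).eventually (eventually_ge_atTop
    (1 / (1 - γ) * (B * C) * (2 * p)))).and (eventually_gt_atTop 0)).exists
  have hxx : x ^ (1 - (1 - γ) / p) * x ^ ((1 - γ) / p) = x := by
    rw [← Real.rpow_add hx0, sub_add_cancel, Real.rpow_one]
  set ρ := x / p with hρ
  have hρ0 : 0 < ρ := div_pos hx0 hp
  have hpρ : p * ρ = x := mul_div_cancel₀ _ hp.ne'
  have hR0 : 0 < C * x ^ (r / p) + 1 := by positivity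
  refine ⟨ρ, ρ / 4 * r / (C * x ^ (r / p) + 1), hρ0, by positivity,
    fun lam hlam hlam₀ u G hu hE => ?_⟩
  have hP := D.powInt_le_of_gradEnergy_le hE.le
  rw [hpρ] at hP
  have hR := hC r D.r_pos D.r_lt_crit.le x hx0 u G hu hP
  have hA := (hB u G hu).trans (mul_le_mul_of_nonneg_left (hC (1 - γ) hk
    (by linarith [D.one_lt_crit, D.γ_pos]) x hx0 u G hu hP) hB0)
  have h1 : 1 / (1 - γ) * singInt Ω γ a u ≤ ρ / 2 := by
    calc 1 / (1 - γ) * singInt Ω γ a u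
        ≤ 1 / (1 - γ) * (B * (C * x ^ ((1 - γ) / p))) := by gcongr
      _ = (1 / (1 - γ) * (B * C) * (2 * p)) * x ^ ((1 - γ) / p) / (2 * p) := by field_simp
      _ ≤ x ^ (1 - (1 - γ) / p) * x ^ ((1 - γ) / p) / (2 * p) := by gcongr
      _ = ρ / 2 := by rw [hxx, hρ]; field_simp
  have h2 : lam / r * powInt r (volume.restrict Ω) u ≤ ρ / 4 := by
    rw [le_div_iff₀ hR0] at hlam₀
    calc lam / r * powInt r (volume.restrict Ω) u
        ≤ lam / r * (C * x ^ (r / p) + 1) := by gcongr; linarith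
      _ = lam * (C * x ^ (r / p) + 1) / r := by ring
      _ ≤ ρ / 4 * r / r := by gcongr
      _ = ρ / 4 := by field_simp
  unfold functional
  rw [hE]
  linarith

/-- Compactness of energy-bounded sequences, for all terms of the energy. -/
theorem compactness_energy {u : ℕ → EuclideanSpace ℝ (Fin N) → ℝ}
    {G : ℕ → EuclideanSpace ℝ (Fin N) → EuclideanSpace ℝ (Fin N)}
    (hu : ∀ n, InV Ω p q μ (u n) (G n)) {M : ℝ}
    (hM : ∀ n, gradEnergy Ω p q μ (1 / p) (1 / q) (G n) ≤ M) :
    ∃ σ : ℕ → ℕ, StrictMono σ ∧ ∃ v K, InV Ω p q μ v K ∧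
      Tendsto (fun n => singInt Ω γ a (u (σ n))) atTop (𝓝 (singInt Ω γ a v)) ∧
      Tendsto (fun n => powInt r (volume.restrict Ω) (u (σ n))) atTop
        (𝓝 (powInt r (volume.restrict Ω) v)) ∧
      ∀ α β, 0 < α → 0 < β → ∀ (b : ℕ → ℝ) (c : ℝ), Tendsto b atTop (𝓝 c) →
        (∀ n, gradEnergy Ω p q μ α β (G (σ n)) ≤ b n) → gradEnergy Ω p q μ α β K ≤ c := by
  obtain ⟨σ, hσ, v, K, hv, hlim, hlsc⟩ := D.compactness hu (M := q * M) fun n =>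
    (D.gradEnergy_one_one_le _).trans (mul_le_mul_of_nonneg_left (hM n) D.q_pos.le)
  refine ⟨σ, hσ, v, K, hv,
    D.tendsto_singInt (fun n => hu _) hv (hlim _ D.one_sub_γ_pos
      (by linarith [D.one_lt_crit, D.γ_pos])),
    D.tendsto_powInt_r (fun n => hu _) hv (hlim _ D.r_pos D.r_lt_crit),
    fun α β hα hβ b c hb hle => ?_⟩
  -- Convergent upper bounds reduce to constant ones: every c' > c is eventually an upper bound.
  refine le_of_forall_gt_imp_ge_of_dense fun c' hc' => hlsc α β c' hα hβ ?_
  filter_upwards [hb.eventually (gt_mem_nhds hc')] with n hn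
  exact (hle n).trans hn.le

lemma bddBelow_functional {ρ : ℝ} (hlam : 0 ≤ lam) (hρ : 0 < ρ) :
    BddBelow {c | ∃ u G, InV Ω p q μ u G ∧ gradEnergy Ω p q μ (1 / p) (1 / q) G ≤ ρ ∧
      functional Ω p q r γ lam μ a u G = c} := by
  obtain ⟨C, hC0, hC⟩ := D.powInt_le
  obtain ⟨B, hB0, hB⟩ := D.singInt_le
  have hp := D.p_pos
  have hq := D.q_pos
  have hr := D.r_pos
  have hk := D.one_sub_γ_pos
  refine ⟨-(1 / (1 - γ) * (B * (C * (p * ρ) ^ ((1 - γ) / p)))) -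
    lam / r * (C * (p * ρ) ^ (r / p)), ?_⟩
  rintro _ ⟨u, G, hu, hE, rfl⟩
  have hP := D.powInt_le_of_gradEnergy_le hE
  have hR := hC r D.r_pos D.r_lt_crit.le _ (by positivity) u G hu hP
  have hA := (hB u G hu).trans (mul_le_mul_of_nonneg_left (hC (1 - γ) hk
    (by linarith [D.one_lt_crit, D.γ_pos]) _ (by positivity) u G hu hP) hB0)
  have h1 := mul_le_mul_of_nonneg_left hA (show 0 ≤ 1 / (1 - γ) by positivity)
  have h2 := mul_le_mul_of_nonneg_left hR (show 0 ≤ lam / r by positivity)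
  have h3 : 0 ≤ gradEnergy Ω p q μ (1 / p) (1 / q) G :=
    gradEnergy_nonneg (by positivity) (by positivity) G
  unfold functional
  linarith

/-- Near t = 0 the gradient part of tu is O(t^p), whereas the singular gain has exact order t^(1-γ)
with 1 - γ < p. The power term only lowers the energy. -/
lemma exists_functional_neg {ρ : ℝ} (hlam : 0 ≤ lam) (hρ : 0 < ρ) (hne : Ω.Nonempty) :
    ∃ u G, InV Ω p q μ u G ∧ gradEnergy Ω p q μ (1 / p) (1 / q) G ≤ ρ ∧
      functional Ω p q r γ lam μ a u G < 0 := by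
  obtain ⟨u, G, hu, hR⟩ := D.exists_powInt_pos hne
  have hp := D.p_pos
  have hq := D.q_pos
  have hr := D.r_pos
  have hk := D.one_sub_γ_pos
  have hA := D.singInt_pos hu hR
  set E := gradEnergy Ω p q μ (1 / p) (1 / q) G with hE
  have hE0 : 0 ≤ E := gradEnergy_nonneg (by positivity) (by positivity) G
  have tend : ∀ s : ℝ, 0 < s → Tendsto (fun t : ℝ => t ^ s * E) (𝓝[>] 0) (𝓝 0) := fun s hs => by
    have h := (Real.continuous_rpow_const hs.le).tendsto 0
    rw [Real.zero_rpow hs.ne'] at h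
    simpa using (h.mono_left nhdsWithin_le_nhds).mul_const E
  obtain ⟨t, ⟨⟨h1, h2⟩, h3⟩, h4⟩ := ((((tend p hp).eventually (gt_mem_nhds hρ)).and
    ((tend (p - (1 - γ)) (sub_pos.2 D.one_sub_γ_lt_p)).eventually
      (gt_mem_nhds (show 0 < 1 / (1 - γ) * singInt Ω γ a u by positivity)))).and
    (self_mem_nhdsWithin (a := (0 : ℝ)) (s := Set.Ioi 0))).and
    (nhdsWithin_le_nhds (gt_mem_nhds one_pos)) |>.exists
  have ht0 : 0 < t := h3
  have hEt : gradEnergy Ω p q μ (1 / p) (1 / q) (t • G) ≤ t ^ p * E := by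
    have hqp : t ^ q ≤ t ^ p := Real.rpow_le_rpow_of_exponent_ge ht0 h4.le D.lt.le
    rw [gradEnergy_smul ht0.le, hE]
    unfold gradEnergy
    have := powInt_nonneg (m := wt Ω μ) q G
    have h5 : 1 / q * t ^ q * powInt q (wt Ω μ) G ≤ 1 / q * t ^ p * powInt q (wt Ω μ) G := by
      gcongr
    linarith
  refine ⟨t • u, t • G, hu.smul t, hEt.trans h1.le, ?_⟩
  have h6 : t ^ p = t ^ (1 - γ) * t ^ (p - (1 - γ)) := by
    rw [← Real.rpow_add ht0]; congr 1; ring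
  have h7 : 0 ≤ lam / r * powInt r (volume.restrict Ω) (t • u) :=
    mul_nonneg (by positivity) (powInt_nonneg _ _)
  have h8 := mul_lt_mul_of_pos_left h2 (Real.rpow_pos_of_pos ht0 (1 - γ))
  rw [← mul_assoc, ← h6] at h8
  unfold functional
  rw [singInt_smul ht0.le]
  linarith

/-- The energy has a nonnegative local minimizer of negative energy. -/
theorem exists_minimizer {ρ : ℝ} (hlam : 0 ≤ lam) (hρ : 0 < ρ) (hne : Ω.Nonempty)
    (hbar : ∀ u G, InV Ω p q μ u G → gradEnergy Ω p q μ (1 / p) (1 / q) G = ρ →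
      0 < functional Ω p q r γ lam μ a u G) :
    ∃ u G, InV Ω p q μ u G ∧ (∀ᵐ x ∂(volume.restrict Ω), 0 ≤ u x) ∧
      functional Ω p q r γ lam μ a u G < 0 ∧ IsDirMin Ω p q r γ lam μ a u G ∧
      powInt p (volume.restrict Ω) G + powInt q (wt Ω μ) G =
        singInt Ω γ a u + lam * powInt r (volume.restrict Ω) u := by
  have hp := D.p_pos
  have hq := D.q_pos
  have hr := D.r_pos
  have hk := D.one_sub_γ_pos
  have hbdd := D.bddBelow_functional hlam hρ
  set A := {c | ∃ u G, InV Ω p q μ u G ∧ gradEnergy Ω p q μ (1 / p) (1 / q) G ≤ ρ ∧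
      functional Ω p q r γ lam μ a u G = c} with hA
  obtain ⟨w₀, K₀, hw₀, hE₀, hneg⟩ := D.exists_functional_neg hlam hρ hne
  have hA0 : A.Nonempty := ⟨_, w₀, K₀, hw₀, hE₀, rfl⟩
  set d := sInf A with hd
  have hd0 : d < 0 := (csInf_le hbdd ⟨w₀, K₀, hw₀, hE₀, rfl⟩).trans_lt hneg
  have hchoose : ∀ n : ℕ, ∃ u G, InV Ω p q μ u G ∧ gradEnergy Ω p q μ (1 / p) (1 / q) G ≤ ρ ∧
      functional Ω p q r γ lam μ a u G < d + 1 / ((n : ℝ) + 1) := fun n => by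
    obtain ⟨_, ⟨u, G, h1, h2, rfl⟩, h3⟩ := exists_lt_of_csInf_lt hA0
      (show sInf A < d + 1 / ((n : ℝ) + 1) from lt_add_of_pos_right _ (by positivity))
    exact ⟨u, G, h1, h2, h3⟩
  choose w K hw hwE hwd using hchoose
  obtain ⟨σ, hσ, v, K', hv, hlA, hlR, hlsc⟩ := D.compactness_energy hw hwE
  have hvE := hlsc (1 / p) (1 / q) (by positivity) (by positivity) _ ρ tendsto_const_nhds
    fun n => hwE (σ n)
  -- Lower semicontinuity of the gradient part, with the convergent singular and power integrals
  -- moved into the upper bound.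
  have hvd : functional Ω p q r γ lam μ a v K' ≤ d := by
    have h0 : Tendsto (fun n : ℕ => d + 1 / ((σ n : ℝ) + 1)) atTop (𝓝 d) := by
      simpa using ((tendsto_one_div_add_atTop_nhds_zero_nat (𝕜 := ℝ)).comp
        hσ.tendsto_atTop).const_add d
    have := hlsc (1 / p) (1 / q) (by positivity) (by positivity) _ _
      ((h0.add (hlA.const_mul (1 / (1 - γ)))).add (hlR.const_mul (lam / r))) fun n => by
        have := hwd (σ n)
        unfold functional at this
        linarith
    unfold functional
    linarith
  obtain ⟨G, hu, hGp, hGq⟩ := D.exists_abs hv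
  set u := fun x => |v x| with hu'
  have hGE : gradEnergy Ω p q μ (1 / p) (1 / q) G ≤ gradEnergy Ω p q μ (1 / p) (1 / q) K' :=
    gradEnergy_mono (by positivity) (by positivity) hGp hGq
  have hud : functional Ω p q r γ lam μ a u G ≤ d := by
    refine le_trans ?_ hvd
    unfold functional
    rw [hu', singInt_abs, powInt_abs]
    linarith
  have hmin : ∀ w K, InV Ω p q μ w K → gradEnergy Ω p q μ (1 / p) (1 / q) K ≤ ρ →
      functional Ω p q r γ lam μ a u G ≤ functional Ω p q r γ lam μ a w K := fun w K h1 h2 =>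
    hud.trans (csInf_le hbdd ⟨w, K, h1, h2, rfl⟩)
  -- The energy is positive on the level ρ and negative at u, so the constraint is inactive.
  have hlt : gradEnergy Ω p q μ (1 / p) (1 / q) G < ρ :=
    lt_of_le_of_ne (hGE.trans hvE) fun h => by linarith [hbar u G hu h]
  refine ⟨u, G, hu, ae_of_all _ fun x => abs_nonneg _, hud.trans_lt hd0, fun h H hh _ => ?_, ?_⟩
  · have hc := (D.continuousAt_gradEnergy (α := 1 / p) (β := 1 / q) hu hh).tendsto
    simp only [zero_smul, add_zero] at hc
    have hlim := tendsto_one_div_add_atTop_nhds_zero_nat (𝕜 := ℝ)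
    -- Small perturbations respect the constraint, so no rescaling is needed and t_n = 1.
    obtain ⟨n₀, hn₀⟩ := eventually_atTop.1 ((hc.comp hlim).eventually (gt_mem_nhds hlt))
    refine ⟨fun n => 1 / (((n + n₀ : ℕ) : ℝ) + 1), fun _ => 1, fun n => by positivity,
      hlim.comp (tendsto_add_atTop_nat n₀), fun _ => one_pos, tendsto_const_nhds, fun n => ?_⟩
    simp only [one_smul]
    exact hmin _ _ (hu.add D.toSetting (hh.smul _)) (hn₀ _ (Nat.le_add_left _ _)).le
  · refine fiber_balance hp.ne' hq.ne' hr.ne' hk.ne' (Or.inl ?_)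
    have hc : Continuous fun t : ℝ => 1 / p * t ^ p * powInt p (volume.restrict Ω) G +
        1 / q * t ^ q * powInt q (wt Ω μ) G :=
      ((continuous_const.mul (Real.continuous_rpow_const hp.le)).mul continuous_const).add
      ((continuous_const.mul (Real.continuous_rpow_const hq.le)).mul continuous_const)
    have h1 := hc.tendsto 1
    simp only [Real.one_rpow, mul_one] at h1
    filter_upwards [h1.eventually (gt_mem_nhds hlt), lt_mem_nhds one_pos] with t ht ht0
    rw [← functional_eq_fiber_one, ← functional_eq_fiber ht0.le]
    refine hmin _ _ (hu.smul t) ?_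
    rw [gradEnergy_smul ht0.le]
    exact ht.le

end Data

end

/-! ### The minimax point. -/

section

variable {N : ℕ} {Ω : Set (EuclideanSpace ℝ (Fin N))} {p q r γ lam : ℝ}
  {μ a : EuclideanSpace ℝ (Fin N) → ℝ}

namespace Data

variable (D : Data Ω p q r γ μ a)
include D

variable {u v : EuclideanSpace ℝ (Fin N) → ℝ}
  {G H : EuclideanSpace ℝ (Fin N) → EuclideanSpace ℝ (Fin N)}

/-- A point whose energy is the minimax level over rays is minimal in nonnegative directions. -/
theorem isDirMin_of_minimax (hlam : 0 < lam) (hu : InV Ω p q μ u G)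
    (hu0 : ∀ᵐ x ∂(volume.restrict Ω), 0 ≤ u x) (hR : 0 < powInt r (volume.restrict Ω) u)
    (hpos : 0 < functional Ω p q r γ lam μ a u G)
    (hmax : ∀ t : ℝ, 0 < t → functional Ω p q r γ lam μ a (t • u) (t • G) ≤
      functional Ω p q r γ lam μ a u G)
    (hmm : ∀ w K, InV Ω p q μ w K → 0 < powInt r (volume.restrict Ω) w → ∃ t : ℝ, 0 < t ∧
      functional Ω p q r γ lam μ a u G ≤ functional Ω p q r γ lam μ a (t • w) (t • K)) :
    IsDirMin Ω p q r γ lam μ a u G := by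
  intro h H hh hh0
  have hp := D.p_pos
  have hq := D.q_pos
  have hr := D.r_pos
  have hk := D.one_sub_γ_pos
  set ε : ℕ → ℝ := fun n => 1 / ((n : ℝ) + 1) with hε
  have hε0 : ∀ n, 0 < ε n := fun n => by positivity
  have hεlim : Tendsto ε atTop (𝓝 0) := tendsto_one_div_add_atTop_nhds_zero_nat
  have hw : ∀ n, InV Ω p q μ (u + ε n • h) (G + ε n • H) := fun n =>
    hu.add D.toSetting (hh.smul (ε n))
  have hRw : ∀ n, powInt r (volume.restrict Ω) u ≤ powInt r (volume.restrict Ω) (u + ε n • h) :=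
    fun n => by
      refine integral_mono_of_nonneg (ae_of_all _ fun x => Real.rpow_nonneg (norm_nonneg _) _)
        (integrable_norm_rpow_of_memLp hr (D.memLp_r (hw n))) ?_
      filter_upwards [hu0, hh0] with x h1 h2
      have h3 : 0 ≤ ε n * h x := mul_nonneg (hε0 n).le h2
      simp only [Pi.add_apply, Pi.smul_apply, smul_eq_mul, Real.norm_eq_abs]
      rw [abs_of_nonneg h1, abs_of_nonneg (add_nonneg h1 h3)]
      exact Real.rpow_le_rpow h1 (by linarith) hr.le
  -- On each perturbed ray some point lies at or above the minimax level. As h ≥ 0, the r-integral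
  -- does not decrease, so these rays stay nontrivial.
  choose t ht0 ht using fun n => hmm _ _ (hw n) (hR.trans_le (hRw n))
  have hdiff : ∀ s : ℝ, 0 < s → Tendsto (fun n =>
      powInt s (volume.restrict Ω) ((u + ε n • h) - u)) atTop (𝓝 0) := fun s hs => by
    have e : ∀ n, powInt s (volume.restrict Ω) ((u + ε n • h) - u) =
        ε n ^ s * powInt s (volume.restrict Ω) h := fun n => by
      rw [add_sub_cancel_left]
      exact powInt_smul (hε0 n).le h
    simp_rw [e]
    have := hεlim.rpow_const (p := s) (Or.inr hs.le)
    rw [Real.zero_rpow hs.ne'] at this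
    simpa using this.mul_const _
  have hlA := D.tendsto_singInt hw hu (hdiff _ hk)
  have hlR := (D.tendsto_powInt_r hw hu (hdiff _ hr)).const_mul lam
  have hlE : ∀ α β, Tendsto (fun n => gradEnergy Ω p q μ α β (G + ε n • H)) atTop
      (𝓝 (gradEnergy Ω p q μ α β G)) := fun α β => by
    have hc := (D.continuousAt_gradEnergy (α := α) (β := β) hu hh).tendsto
    simp only [zero_smul, add_zero] at hc
    exact hc.comp hεlim
  have hlP : Tendsto (fun n => powInt p (volume.restrict Ω) (G + ε n • H)) atTop
      (𝓝 (powInt p (volume.restrict Ω) G)) := by simpa [gradEnergy] using hlE 1 0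
  have hlQ : Tendsto (fun n => powInt q (wt Ω μ) (G + ε n • H)) atTop
      (𝓝 (powInt q (wt Ω μ) G)) := by simpa [gradEnergy] using hlE 0 1
  obtain ⟨B, hB⟩ := (hlE (1 / p) (1 / q)).bddAbove_range
  -- The perturbed fibers are nonpositive beyond a common T, while their values at t_n are positive;
  -- hence t_n ≤ T.
  obtain ⟨T, hT0, hT⟩ := exists_fiber_nonpos hp D.lt D.q_lt_r hk (mul_pos hlam hR) B
  simp only [functional_eq_fiber (ht0 _).le] at ht
  have htT : ∀ n, t n ∈ Set.Icc 0 T := fun n => by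
    refine ⟨(ht0 n).le, le_of_not_ge fun hn => ?_⟩
    exact absurd (hT _ _ _ _ (powInt_nonneg _ _) (powInt_nonneg _ _) (D.singInt_nonneg _)
      (mul_le_mul_of_nonneg_left (hRw n) hlam.le) (hB ⟨n, rfl⟩) (t n) hn)
      (not_le.2 (hpos.trans_le (ht n)))
  obtain ⟨t₀, ht₀, σ, hσ, hlt⟩ := isCompact_Icc.tendsto_subseq htT
  have hσt := hσ.tendsto_atTop
  have hlim := tendsto_fiber hp.le hq.le hr.le hk.le (hlP.comp hσt) (hlQ.comp hσt)
    (hlA.comp hσt) (hlR.comp hσt) hlt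
  have hge := ge_of_tendsto' hlim fun n => ht (σ n)
  have ht₀pos : 0 < t₀ := lt_of_le_of_ne ht₀.1 fun h0 => by
    rw [← h0, fiber_zero hp.ne' hq.ne' hr.ne' hk.ne'] at hge
    exact absurd hge (not_le.2 hpos)
  have hm₁ : ∀ s : ℝ, 0 < s → fiber p q r (1 - γ) (powInt p (volume.restrict Ω) G)
      (powInt q (wt Ω μ) G) (singInt Ω γ a u) (lam * powInt r (volume.restrict Ω) u) s ≤
      functional Ω p q r γ lam μ a u G := fun s hs => by
    rw [← functional_eq_fiber hs.le]; exact hmax s hs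
  have hP := D.powInt_grad_pos hu hR
  -- Both t₀ and 1 are global maximum points of the fiber of u, and there is only one.
  have ht₀one : t₀ = 1 := by
    have hm₂ := fun s hs => (hm₁ s hs).trans hge
    rw [functional_eq_fiber_one] at hm₁
    rcases lt_trichotomy t₀ 1 with hlt | heq | hgt
    · exact (fiber_max_unique hk D.one_sub_γ_lt_p D.lt D.q_lt_r hP (powInt_nonneg _ _) ht₀pos
        hlt hm₂ hm₁).elim
    · exact heq
    · exact (fiber_max_unique hk D.one_sub_γ_lt_p D.lt D.q_lt_r hP (powInt_nonneg _ _) one_pos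
        hgt hm₁ hm₂).elim
  rw [ht₀one] at hlt
  refine ⟨ε ∘ σ, t ∘ σ, fun n => hε0 _, hεlim.comp hσt, fun n => ht0 _, hlt, fun n => ?_⟩
  -- The energy at u lies between the two sides: it is maximal along the ray of u and equal to the
  -- minimax level.
  refine (hmax _ (ht0 _)).trans ((ht (σ n)).trans_eq ?_)
  exact (functional_eq_fiber (ht0 _).le _ _).symm

lemma exists_smul_powInt_eq_one (hR : 0 < powInt r (volume.restrict Ω) u) :
    ∃ s : ℝ, 0 < s ∧ powInt r (volume.restrict Ω) (s • u) = 1 := by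
  refine ⟨powInt r (volume.restrict Ω) u ^ (-r⁻¹), Real.rpow_pos_of_pos hR _, ?_⟩
  refine (powInt_smul (Real.rpow_nonneg hR.le _) u).trans ?_
  rw [← Real.rpow_mul hR.le, neg_mul, inv_mul_cancel₀ D.r_pos.ne', Real.rpow_neg_one,
    inv_mul_cancel₀ hR.ne']

lemma exists_ray_max (hlam : 0 < lam) (hR : 0 < powInt r (volume.restrict Ω) u) {t₀ : ℝ}
    (ht₀ : 0 < t₀) (hpos : 0 < functional Ω p q r γ lam μ a (t₀ • u) (t₀ • G)) :
    ∃ t : ℝ, 0 < t ∧ ∀ s : ℝ, 0 < s → functional Ω p q r γ lam μ a (s • u) (s • G) ≤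
      functional Ω p q r γ lam μ a (t • u) (t • G) := by
  rw [functional_eq_fiber ht₀.le] at hpos
  obtain ⟨t, ht, hmax⟩ := exists_fiber_max D.p_pos D.lt D.q_lt_r D.one_sub_γ_pos
    (powInt_nonneg _ _) (powInt_nonneg _ _) (D.singInt_nonneg _) (mul_pos hlam hR) ht₀ hpos
  refine ⟨t, ht, fun s hs => ?_⟩
  rw [functional_eq_fiber hs.le, functional_eq_fiber ht.le]
  exact hmax s hs

/-- The energy has a nonnegative minimax point of positive energy. -/
theorem exists_minimax {ρ c₀ : ℝ} (hlam : 0 < lam) (hρ : 0 < ρ) (hc₀ : 0 < c₀)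
    (hne : Ω.Nonempty)
    (hbar : ∀ u G, InV Ω p q μ u G → gradEnergy Ω p q μ (1 / p) (1 / q) G = ρ →
      c₀ ≤ functional Ω p q r γ lam μ a u G) :
    ∃ u G, InV Ω p q μ u G ∧ (∀ᵐ x ∂(volume.restrict Ω), 0 ≤ u x) ∧
      0 < functional Ω p q r γ lam μ a u G ∧ IsDirMin Ω p q r γ lam μ a u G ∧
      powInt p (volume.restrict Ω) G + powInt q (wt Ω μ) G =
        singInt Ω γ a u + lam * powInt r (volume.restrict Ω) u := by
  have := D.finite
  have hp := D.p_pos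
  have hq := D.q_pos
  have hr := D.r_pos
  have hk := D.one_sub_γ_pos
  -- Every nontrivial ray meets the level ρ, where the barrier applies.
  have hray : ∀ w K, InV Ω p q μ w K → 0 < powInt r (volume.restrict Ω) w → ∃ t : ℝ, 0 < t ∧
      c₀ ≤ functional Ω p q r γ lam μ a (t • w) (t • K) := fun w K hw hR => by
    obtain ⟨t, ht, hE⟩ := D.exists_smul_gradEnergy_eq (α := 1 / p) (β := 1 / q) (by positivity)
      (by positivity) hρ (D.powInt_grad_pos hw hR)
    exact ⟨t, ht, hbar _ _ (hw.smul t) hE⟩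
  have hmaxray : ∀ w K, InV Ω p q μ w K → 0 < powInt r (volume.restrict Ω) w →
      ∃ t : ℝ, 0 < t ∧ ∀ s : ℝ, 0 < s → functional Ω p q r γ lam μ a (s • w) (s • K) ≤
        functional Ω p q r γ lam μ a (t • w) (t • K) := fun w K hw hR => by
    obtain ⟨t, ht, hE⟩ := hray w K hw hR
    exact D.exists_ray_max hlam hR ht (hc₀.trans_le hE)
  -- Upper bounds for the energy along normalized rays. The normalization survives strong L^r
  -- convergence, so the limit is nonzero.
  set A : Set ℝ := {c | ∃ w K, InV Ω p q μ w K ∧ powInt r (volume.restrict Ω) w = 1 ∧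
    ∀ t : ℝ, 0 < t → functional Ω p q r γ lam μ a (t • w) (t • K) ≤ c} with hA
  have hAc : c₀ ∈ lowerBounds A := by
    rintro c ⟨w, K, hw, hR, hc⟩
    obtain ⟨t, ht, hE⟩ := hray w K hw (hR ▸ one_pos)
    exact hE.trans (hc t ht)
  have hbdd : BddBelow A := ⟨c₀, hAc⟩
  set m := sInf A with hm
  have hml : ∀ w K, InV Ω p q μ w K → 0 < powInt r (volume.restrict Ω) w → ∀ c,
      (∀ t : ℝ, 0 < t → functional Ω p q r γ lam μ a (t • w) (t • K) ≤ c) → c ∈ A :=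
    fun w K hw hR c hc => by
      obtain ⟨s, hs, hs1⟩ := D.exists_smul_powInt_eq_one hR
      refine ⟨s • w, s • K, hw.smul s, hs1, fun t ht => ?_⟩
      rw [smul_smul, smul_smul]
      exact hc _ (mul_pos ht hs)
  have hmm : ∀ w K, InV Ω p q μ w K → 0 < powInt r (volume.restrict Ω) w → ∃ t : ℝ, 0 < t ∧
      m ≤ functional Ω p q r γ lam μ a (t • w) (t • K) := fun w K hw hR => by
    obtain ⟨t, ht, hmax⟩ := hmaxray w K hw hR
    exact ⟨t, ht, csInf_le hbdd (hml w K hw hR _ hmax)⟩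
  have hA0 : A.Nonempty := by
    obtain ⟨w, K, hw, hR⟩ := D.exists_powInt_pos hne
    obtain ⟨t, ht, hmax⟩ := hmaxray w K hw hR
    exact ⟨_, hml w K hw hR _ hmax⟩
  have hmc : c₀ ≤ m := le_csInf hA0 hAc
  have hchoose : ∀ n : ℕ, ∃ w K, InV Ω p q μ w K ∧ powInt r (volume.restrict Ω) w = 1 ∧
      ∀ t : ℝ, 0 < t → functional Ω p q r γ lam μ a (t • w) (t • K) ≤
        m + 1 / ((n : ℝ) + 1) := fun n => by
    obtain ⟨c, ⟨w, K, h1, h2, h3⟩, h4⟩ := exists_lt_of_csInf_lt hA0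
      (show sInf A < m + 1 / ((n : ℝ) + 1) from lt_add_of_pos_right _ (by positivity))
    exact ⟨w, K, h1, h2, fun t ht => (h3 t ht).trans h4.le⟩
  choose w K hw hwR hwm using hchoose
  obtain ⟨B, hB0, hB⟩ := D.singInt_le
  have hwA : ∀ n, singInt Ω γ a (w n) ≤ B * ((volume.restrict Ω).real Set.univ + 1) := fun n => by
    refine (hB _ _ (hw n)).trans (mul_le_mul_of_nonneg_left ?_ hB0)
    have := powInt_le_add_powInt hk (show 1 - γ ≤ r by linarith [D.one_lt_r, D.γ_pos])
      (D.memLp_r (hw n))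
    rwa [hwR] at this
  -- The bound at t = 1 controls the gradients, as the normalization bounds the singular and power
  -- terms.
  have hwE : ∀ n, gradEnergy Ω p q μ (1 / p) (1 / q) (K n) ≤
      m + 1 + 1 / (1 - γ) * (B * ((volume.restrict Ω).real Set.univ + 1)) + lam / r := fun n => by
    have h1 := hwm n 1 one_pos
    rw [one_smul, one_smul] at h1
    unfold functional at h1
    rw [hwR] at h1
    have h2 := mul_le_mul_of_nonneg_left (hwA n) (show 0 ≤ 1 / (1 - γ) by positivity)
    have h3 : 1 / ((n : ℝ) + 1) ≤ 1 := by
      rw [div_le_one (by positivity)]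
      linarith [(Nat.cast_nonneg n : (0 : ℝ) ≤ n)]
    linarith
  obtain ⟨σ, hσ, v, K', hv, hlA, hlR, hlsc⟩ := D.compactness_energy hw hwE
  have hvR : powInt r (volume.restrict Ω) v = 1 := by
    simp only [hwR] at hlR
    exact tendsto_nhds_unique hlR tendsto_const_nhds
  -- Lower semicontinuity is used for each t separately, with weights t^p/p and t^q/q.
  have hvm : ∀ t : ℝ, 0 < t → functional Ω p q r γ lam μ a (t • v) (t • K') ≤ m := fun t ht => by
    have h0 : Tendsto (fun n : ℕ => m + 1 / ((σ n : ℝ) + 1)) atTop (𝓝 m) := by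
      simpa using ((tendsto_one_div_add_atTop_nhds_zero_nat (𝕜 := ℝ)).comp
        hσ.tendsto_atTop).const_add m
    have := hlsc (1 / p * t ^ p) (1 / q * t ^ q) (by positivity) (by positivity) _ _
      ((h0.add ((hlA.const_mul (t ^ (1 - γ))).const_mul (1 / (1 - γ)))).add
        ((hlR.const_mul (t ^ r)).const_mul (lam / r))) fun n => by
        have := hwm (σ n) t ht
        rw [functional_smul ht.le] at this
        unfold gradEnergy
        linarith
    rw [functional_smul ht.le]
    unfold gradEnergy at this
    linarith
  obtain ⟨G, hu, hGp, hGq⟩ := D.exists_abs hv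
  set u := fun x => |v x| with hu'
  have huR : 0 < powInt r (volume.restrict Ω) u := by
    rw [hu', powInt_abs, hvR]; exact one_pos
  have hum : ∀ t : ℝ, 0 < t → functional Ω p q r γ lam μ a (t • u) (t • G) ≤ m := fun t ht => by
    refine le_trans ?_ (hvm t ht)
    rw [functional_smul ht.le, functional_smul ht.le, hu', singInt_abs, powInt_abs]
    gcongr
  -- The ray of u stays at or below m and reaches m somewhere; that point is the solution.
  obtain ⟨t, ht, hmt⟩ := hmm u G hu huR
  have hval : functional Ω p q r γ lam μ a (t • u) (t • G) = m := le_antisymm (hum t ht) hmt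
  have hmax : ∀ s : ℝ, 0 < s → functional Ω p q r γ lam μ a (s • t • u) (s • t • G) ≤
      functional Ω p q r γ lam μ a (t • u) (t • G) := fun s hs => by
    rw [hval, smul_smul, smul_smul]
    exact hum _ (mul_pos hs ht)
  have hpos : 0 < functional Ω p q r γ lam μ a (t • u) (t • G) :=
    hval ▸ hc₀.trans_le hmc
  have ht0 : ∀ᵐ x ∂(volume.restrict Ω), 0 ≤ (t • u) x :=
    ae_of_all _ fun x => mul_nonneg ht.le (abs_nonneg _)
  refine ⟨t • u, t • G, hu.smul t, ht0, hpos, ?_, ?_⟩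
  · refine D.isDirMin_of_minimax hlam (hu.smul t) ht0 ?_ hpos hmax ?_
    · rw [show t • u = fun x => t • u x from rfl, powInt_smul ht.le]
      exact mul_pos (Real.rpow_pos_of_pos ht _) huR
    · rw [hval]
      exact hmm
  · refine fiber_balance hp.ne' hq.ne' hr.ne' hk.ne' (Or.inr ?_)
    filter_upwards [lt_mem_nhds one_pos] with s hs
    rw [← functional_eq_fiber_one, ← functional_eq_fiber hs.le]
    exact hmax s hs

end Data

end

end DoublePhase

end

/-! ### The two solutions for small λ. -/

theorem theorem1p1 (N : ℕ) (hN : 2 ≤ N) (Ω : Set (EuclideanSpace ℝ (Fin N)))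
    (hΩ_open : IsOpen Ω) (hΩ_conn : IsConnected Ω) (hΩ_bdd : Bornology.IsBounded Ω)
    (hΩ_lip : DoublePhase.HasLipschitzBoundary Ω)
    (p q r γ : ℝ) (μ a : EuclideanSpace ℝ (Fin N) → ℝ)
    (hp : 1 < p) (hpN : p < N) (hpq : p < q) (hq : q < N * p / (N - p))
    (hμ : MemLp μ ∞ (volume.restrict Ω)) (hμ_nonneg : ∀ᵐ x ∂(volume.restrict Ω), 0 ≤ μ x)
    (hγ₀ : 0 < γ) (hγ₁ : γ < 1) (hqr : q < r) (hr : r < N * p / (N - p))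
    (ha : MemLp a ∞ (volume.restrict Ω)) (ha_pos : ∀ᵐ x ∂(volume.restrict Ω), 0 < a x) :
    ∃ lam₀ : ℝ, 0 < lam₀ ∧ ∀ lam : ℝ, 0 < lam → lam ≤ lam₀ →
      ∃ u v : EuclideanSpace ℝ (Fin N) → ℝ,
        DoublePhase.IsWeakSolution Ω p q r γ lam μ a u ∧
        DoublePhase.IsWeakSolution Ω p q r γ lam μ a v ∧
        DoublePhase.energy Ω p q r γ lam μ a u < 0 ∧
        0 < DoublePhase.energy Ω p q r γ lam μ a v := by
  have D : DoublePhase.Data Ω p q r γ μ a :=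
    { isOpen := hΩ_open, isBounded := hΩ_bdd, one_lt := hp, lt_dim := hpN, lt := hpq,
      lt_crit := hq, memLp := hμ, nonneg := hμ_nonneg, γ_pos := hγ₀, γ_lt := hγ₁,
      q_lt_r := hqr, r_lt_crit := hr, memLp_a := ha, a_pos := ha_pos }
  obtain ⟨ρ, lam₀, hρ, hlam₀, hbar⟩ := D.exists_barrier
  refine ⟨lam₀, hlam₀, fun lam hlam hle => ?_⟩
  have hb := hbar lam hlam hle
  have hρ4 : 0 < ρ / 4 := by positivity
  obtain ⟨u, G, hu, hu0, hneg, hmin, hbal⟩ := D.exists_minimizer hlam.le hρ hΩ_conn.nonempty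
    fun u G h1 h2 => hρ4.trans_le (hb u G h1 h2)
  obtain ⟨v, K, hv, hv0, hpos, hmin', hbal'⟩ := D.exists_minimax hlam hρ hρ4 hΩ_conn.nonempty hb
  refine ⟨u, v, D.isWeakSolution hlam.le hu hu0 hmin hbal,
    D.isWeakSolution hlam.le hv hv0 hmin' hbal', ?_, ?_⟩
  · rw [D.energy_eq hu]; exact hneg
  · rw [D.energy_eq hv]; exact hpos
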